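/- **Setting.** Write $r=|x|$ and $L=L(x,v)=|x\times v|^2=|x|^2|v|^2-(x\cdot v)^2$ for $x,v\in\mathbb R^3$. Call $f:\mathbb R^6\to\mathbb R$ spherically symmetric if $f(Ax,Av)=f(x,v)$ for all $A\in SO(3)$; functions are identified if they agree almost everywhere, and an equivalence class is spherically symmetric if it has a spherically symmetric representative. Let $l>-1$, $0<k_1,k_2,k_3<l+\tfrac32$, $C_1,C_2,F_0>0$, and let $Q\in C^1([0,\infty))\cap C^2((0,\infty))$, $Q\ge 0$, satisfy - (Q1) $Q(f)\ge C_1f^{1+1/k_1}$ for all $f\ge 0$ (if $l=0$: for all $f\ge F_0$ only); - (Q2) $Q(f)\le C_2f^{1+1/k_2}$ for $0\le f\le F_0$; - (Q3) $Q(\lambda f)\ge\lambda^{1+1/k_3}Q(f)$ for $f\ge 0$, $0\le\lambda\le 1$; - (Q4) $Q''(f)>0$ for $f>0$, and $Q'(0)=0$. For $f\in L^1(\mathbb R^6)$ let $\rho_f(x)=\int f(x,v)\,dv$, $m_f(r)=\int_{|y|\le r}\rho_f(y)\,dy$ and $\nabla U_f(x)=\frac{m_f(r)}{r^2}\frac xr$.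 For $\gamma\ge 0$ and $f\ge0$ put $$\mathcal P(f)=\gamma\iint Lf\,dv\,dx+\iint Q(L^{-l}f)L^l\,dv\,dx+\tfrac12\iint|v|^2f\,dv\,dx,\qquad \mathcal D(f)=\mathcal P(f)-\frac1{8\pi}\int|\nabla U_f|^2dx .$$ For $M>0$ let $\mathcal F_M$ be the set of spherically symmetric $f\in L^1(\mathbb R^6)$ with $f\ge0$, $\iint f\,dv\,dx=M$ and $\mathcal P(f)<\infty$, and let $\mathcal D_M=\inf_{\mathcal F_M}\mathcal D$. A minimizing sequence is a sequence $(f_n)\subset\mathcal F_M$ with $\mathcal D(f_n)\to\mathcal D_M$. Call $R>0$ a concentration radius if $\lim_{n\to\infty}\int_{|x|\ge R'}\int f_n\,dv\,dx=0$ for every minimizing sequence $(f_n)$ and every $R'>R$. Let $L^{k_1,l}(\mathbb R^6)$ be the Banach space of measurable spherically symmetric $f$ with norm $\bigl(\iint|f|^{1+1/k_1}L^{-l/k_1}dv\,dx\bigr)^{k_1/(k_1+1)}<\infty$. **Theorem.** Let $M>0$. 1. There is $\gamma_0>0$ such that $-\infty<\mathcal D_M<0$ for all $\gamma\in[0,\gamma_0]$.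 2. Let $\gamma\ge0$ be such that $\mathcal D_M<0$. Then a concentration radius exists, and for every minimizing sequence $(f_n)$ there are a subsequence $(f_{n_j})$ and a function $f_0\in\mathcal F_M$ such that - $\mathcal D(f_0)=\mathcal D_M$; - $f_0=0$ almost everywhere outside $B_{R_M}\times\mathbb R^3$ for every concentration radius $R_M$, where $B_R=\{x\in\mathbb R^3:|x|\le R\}$; - all $f_{n_j}$ and $f_0$ lie in $L^{k_1,l}(\mathbb R^6)$, and $f_{n_j}\rightharpoonup f_0$ weakly in $L^{k_1,l}(\mathbb R^6)$; - $\nabla U_{f_{n_j}},\nabla U_{f_0}\in L^2(\mathbb R^3)$, and $\nabla U_{f_{n_j}}\to\nabla U_{f_0}$ strongly in $L^2(\mathbb R^3)$. -/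

import Mathlib

open MeasureTheory Filter
open scoped ENNReal Topology

noncomputable section

namespace VlasovPoisson

/-- Physical (position or velocity) space `ℝ³` with its Euclidean norm. -/
abbrev Space : Type := EuclideanSpace ℝ (Fin 3)

/-- Phase space `ℝ⁶ = ℝ³ × ℝ³`, with points `z = (x, v)`. -/
abbrev Phase : Type := Space × Space

/-- Modulus of angular momentum squared,
`L(x, v) = |x × v|² = |x|² |v|² - (x · v)²`. -/
def angMom (z : Phase) : ℝ :=
  ‖z.1‖ ^ 2 * ‖z.2‖ ^ 2 - (inner ℝ z.1 z.2) ^ 2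

/-- Spherical symmetry: `f (A x, A v) = f (x, v)` for all `A ∈ SO(3)`. -/
def SphericallySymmetric (f : Phase → ℝ) : Prop :=
  ∀ A : Space ≃ₗᵢ[ℝ] Space, LinearMap.det (A.toLinearEquiv : Space →ₗ[ℝ] Space) = 1 →
    ∀ x v : Space, f (A x, A v) = f (x, v)

/-- Spatial density `ρ_f (x) = ∫ f (x, v) dv`. -/
def density (f : Phase → ℝ) (x : Space) : ℝ := ∫ v, f (x, v)

/-- Mass inside the closed ball of radius `r`: `m_f (r) = ∫_{|y| ≤ r} ρ_f (y) dy`. -/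
def massFun (f : Phase → ℝ) (r : ℝ) : ℝ :=
  ∫ y in Metric.closedBall (0 : Space) r, density f y

/-- The gravitational field `∇U_f (x) = (m_f (r) / r²) (x / r)`, `r = |x|`. -/
def gradU (f : Phase → ℝ) (x : Space) : Space :=
  (massFun f ‖x‖ / ‖x‖ ^ 2) • (‖x‖⁻¹ • x)

/-- Kinetic energy `(1/2) ∫∫ |v|² f dv dx` of a non-negative `f`. -/
def kineticEnergy (f : Phase → ℝ) : ℝ≥0∞ :=
  ENNReal.ofReal (1 / 2) * ∫⁻ z : Phase, ENNReal.ofReal (‖z.2‖ ^ 2 * f z)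

/-- The Casimir functional `∫∫ Q (L^{-l} f) L^l dv dx`. -/
def casimir (Q : ℝ → ℝ) (l : ℝ) (f : Phase → ℝ) : ℝ≥0∞ :=
  ∫⁻ z : Phase, ENNReal.ofReal (Q (angMom z ^ (-l) * f z) * angMom z ^ l)

/-- The positive part `γ ∫∫ L f + C(f) + E_kin(f)` of the energy-Casimir functional. -/
def positivePart (Q : ℝ → ℝ) (l γ : ℝ) (f : Phase → ℝ) : ℝ≥0∞ :=
  ENNReal.ofReal γ * (∫⁻ z : Phase, ENNReal.ofReal (angMom z * f z))
    + casimir Q l f + kineticEnergy f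

/-- The modulus `-E_pot(f) = (1 / 8π) ∫ |∇U_f|² dx` of the potential energy. -/
def negPotentialEnergy (f : Phase → ℝ) : ℝ≥0∞ :=
  ENNReal.ofReal (1 / (8 * Real.pi)) * ∫⁻ x : Space, ‖gradU f x‖ₑ ^ 2

/-- The energy-Casimir functional. -/
def energyCasimir (Q : ℝ → ℝ) (l γ : ℝ) (f : Phase → ℝ) : EReal :=
  (positivePart Q l γ f : EReal) - (negPotentialEnergy f : EReal)

/-- The constraint set `F_M`. Its elements are integrable functions, to be understood up to
equality almost everywhere; symmetry of such a class is symmetry of a representative. -/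
def feasible (Q : ℝ → ℝ) (l γ M : ℝ) : Set (Phase → ℝ) :=
  {f | Integrable f ∧ 0 ≤ᵐ[volume] f ∧ ∫ z, f z = M ∧ positivePart Q l γ f < ⊤ ∧
    ∃ g : Phase → ℝ, SphericallySymmetric g ∧ g =ᵐ[volume] f}

/-- The infimum `D_M` of the energy-Casimir functional over `F_M`, in `[-∞, ∞]`. -/
def infEnergy (Q : ℝ → ℝ) (l γ M : ℝ) : EReal :=
  ⨅ f ∈ feasible Q l γ M, energyCasimir Q l γ f

/-- Minimizing sequences of the energy-Casimir functional over `F_M`. -/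
def IsMinimizingSeq (Q : ℝ → ℝ) (l γ M : ℝ) (f : ℕ → Phase → ℝ) : Prop :=
  (∀ n, f n ∈ feasible Q l γ M) ∧
    Tendsto (fun n => energyCasimir Q l γ (f n)) atTop (𝓝 (infEnergy Q l γ M))

/-- `R` is a concentration radius: along every minimizing sequence, the mass outside any
larger ball tends to zero. -/
def IsConcentrationRadius (Q : ℝ → ℝ) (l γ M R : ℝ) : Prop :=
  0 < R ∧ ∀ f : ℕ → Phase → ℝ, IsMinimizingSeq Q l γ M f → ∀ R' : ℝ, R < R' →
    Tendsto (fun n => ∫ z in {z : Phase | R' ≤ ‖z.1‖}, f n z) atTop (𝓝 0)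

/-- The assumptions on the function `Q : [0, ∞) → [0, ∞)` (extended arbitrarily to `ℝ`). -/
structure CasimirAssumptions (l k₁ k₂ k₃ C₁ C₂ F₀ : ℝ) (Q : ℝ → ℝ) : Prop where
  l_gt : -1 < l
  k₁_pos : 0 < k₁
  k₁_lt : k₁ < l + 3 / 2
  k₂_pos : 0 < k₂
  k₂_lt : k₂ < l + 3 / 2
  k₃_pos : 0 < k₃
  k₃_lt : k₃ < l + 3 / 2
  C₁_pos : 0 < C₁
  C₂_pos : 0 < C₂
  F₀_pos : 0 < F₀
  contDiffOn_one : ContDiffOn ℝ 1 Q (Set.Ici 0)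
  contDiffOn_two : ContDiffOn ℝ 2 Q (Set.Ioi 0)
  nonneg : ∀ f, 0 ≤ f → 0 ≤ Q f
  Q1 : ∀ f, 0 ≤ f → (l = 0 → F₀ ≤ f) → C₁ * f ^ (1 + 1 / k₁) ≤ Q f
  Q2 : ∀ f, 0 ≤ f → f ≤ F₀ → Q f ≤ C₂ * f ^ (1 + 1 / k₂)
  Q3 : ∀ f lam, 0 ≤ f → 0 ≤ lam → lam ≤ 1 → lam ^ (1 + 1 / k₃) * Q f ≤ Q (lam * f)
  Q4 : ∀ f, 0 < f → 0 < deriv (deriv Q) f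
  Q4_zero : derivWithin Q (Set.Ici 0) 0 = 0

/-- The exponent `1 + 1/k` (for `k > 0`). -/
def lpExponent (k : ℝ) : ℝ≥0∞ := 1 + ENNReal.ofReal (1 / k)

instance fact_one_le_lpExponent (k : ℝ) : Fact (1 ≤ lpExponent k) :=
  ⟨le_self_add⟩

/-- The weighted measure `L^{-l/k} dv dx`. -/
def weightedMeasure (k l : ℝ) : Measure Phase :=
  (volume : Measure Phase).withDensity fun z => ENNReal.ofReal (angMom z ^ (-l / k))

/-- The space `L^{k,l}(ℝ⁶)` of (classes of) measurable spherically symmetric functions with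
`∫∫ |f|^{1+1/k} L^{-l/k} dv dx < ∞`, with the norm
`(∫∫ |f|^{1+1/k} L^{-l/k} dv dx)^{k/(k+1)}` inherited from the weighted Lebesgue space. -/
def weightedSpace (k l : ℝ) : Submodule ℝ (Lp ℝ (lpExponent k) (weightedMeasure k l)) where
  carrier := {h | ∃ g : Phase → ℝ, SphericallySymmetric g ∧ g =ᵐ[weightedMeasure k l] h}
  zero_mem' := ⟨0, fun _ _ _ _ => rfl, (Lp.coeFn_zero _ _ _).symm⟩
  add_mem' := by
    rintro a b ⟨g, hg, hga⟩ ⟨h, hh, hhb⟩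
    refine ⟨g + h, fun A hA x v => ?_, (hga.add hhb).trans (Lp.coeFn_add a b).symm⟩
    simp only [Pi.add_apply, hg A hA, hh A hA]
  smul_mem' := by
    rintro c a ⟨g, hg, hga⟩
    refine ⟨c • g, fun A hA x v => ?_, (hga.const_smul c).trans (Lp.coeFn_smul c a).symm⟩
    simp only [Pi.smul_apply, hg A hA]

/-- Weak convergence in `L^{k,l}(ℝ⁶)` of a sequence of functions; it includes that all the
functions belong to the space. -/
def WeaklyConverges (k l : ℝ) (f : ℕ → Phase → ℝ) (f₀ : Phase → ℝ) : Prop :=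
  ∃ (h : ℕ → weightedSpace k l) (h₀ : weightedSpace k l),
    (∀ n, (h n : Lp ℝ (lpExponent k) (weightedMeasure k l)) =ᵐ[weightedMeasure k l] f n) ∧
    (h₀ : Lp ℝ (lpExponent k) (weightedMeasure k l)) =ᵐ[weightedMeasure k l] f₀ ∧
    ∀ φ : StrongDual ℝ (weightedSpace k l),
      Tendsto (fun n => φ (h n)) atTop (𝓝 (φ h₀))

end VlasovPoisson

end

open VlasovPoisson

/-! The proof is the direct method; the loss of mass to infinity is excluded by a scaling that
respects $L$.

Lower bound. Hölder's inequality with weight $L^l$ on a box $\{|x|\le r,|v|\le V\}$, together with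
the kinetic energy for the fast particles, gives $m_f(r)\le C X^e r^a$ with $X=1+\mathcal P(f)$
(`exists_massIn_le`). Interpolating with $m_f\le M$ and using $k_1<l+3/2$ bounds the potential
energy by $\mathcal P/2+C$ (`exists_negPotentialEnergy_le`). Hence $\mathcal D_M>-\infty$, and
$\mathcal P$ is bounded along minimizing sequences. A dilute state $cL^l$ on a large box has
negative energy since $k_2<l+3/2$ (`exists_infEnergy_neg`).

Concentration. The map $(x,v)\mapsto(\sigma x,v_r+\sigma^{-1}v_t)$, with $v_r,v_t$ the radial and
tangential parts of $v$, preserves $L$. Composing $f$ with it multiplies the mass, the $L$-term, the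
Casimir term and the potential energy by $\sigma^{-1}$, and the kinetic energy by at most
$\sigma^{-1}$ if $\sigma\le1$. So states of mass $\sigma M$ have energy at least $\sigma\mathcal
D_M$ (`infEnergy_le_scaled`). Removing the mass $\lambda$ outside radius $R$ costs at most
$c\lambda/R$ of potential energy, and therefore $\mathcal D(f)-\mathcal D_M\ge\lambda(-\mathcal
D_M/M-c/R)$. If $\mathcal D_M<0$ and $R$ is large, $\lambda$ must tend to zero
(`exists_isConcentrationRadius`).

Limit. Minimizing sequences are bounded in the reflexive space $L^{k_1,l}$, so a subsequence
converges weakly (`exists_weak_limit`). Concentration in $x$ and the kinetic bound in $v$ give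
tightness, so no mass is lost and $m_{f_n}(r)\to m_{f_0}(r)$ for each $r$. By spherical symmetry the
field depends on $m_f$ alone, and dominated convergence gives strong convergence of the fields.
Convexity of $Q$ makes $\mathcal P$ lower semicontinuous (`positivePart_le_of_testConvergence`), so
$f_0$ is a minimizer (`exists_minimizer`). -/

/-! ### Duality of $L^p$ and $L^q$, and weak sequential compactness of bounded sequences. -/

section LpDuality

variable {α : Type*} [MeasurableSpace α] {κ : Measure α} {p q : ℝ≥0∞}

theorem continuousLinearMap_Lp_ext [IsFiniteMeasure κ] [Fact (1 ≤ p)] (hp : p ≠ ⊤)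
    {φ ψ : StrongDual ℝ (Lp ℝ p κ)}
    (h : ∀ (A : Set α) (hA : MeasurableSet A),
      φ (indicatorConstLp p hA (measure_ne_top κ A) 1) =
        ψ (indicatorConstLp p hA (measure_ne_top κ A) 1)) : φ = ψ := by
  ext f
  refine Lp.induction hp (motive := fun f => φ f = ψ f) ?_ ?_ ?_ f
  · intro c s hs hμs
    have : ((Lp.simpleFunc.indicatorConst p hs hμs.ne c : Lp.simpleFunc ℝ p κ) : Lp ℝ p κ)
        = c • indicatorConstLp p hs (measure_ne_top κ s) 1 := by
      rw [Lp.simpleFunc.coe_indicatorConst]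
      apply Lp.ext
      filter_upwards [indicatorConstLp_coeFn (p := p) (hs := hs) (hμs := hμs.ne) (c := c),
        Lp.coeFn_smul c (indicatorConstLp p hs (measure_ne_top κ s) (1 : ℝ)),
        indicatorConstLp_coeFn (p := p) (hs := hs) (hμs := measure_ne_top κ s) (c := (1 : ℝ))]
        with x h1 h2 h3
      rw [h1, h2, Pi.smul_apply, h3]
      by_cases hx : x ∈ s <;> simp [hx]
    rw [this, map_smul, map_smul, h]
  · intro f g hf hg _ h1 h2
    rw [map_add, map_add, h1, h2]
  · exact isClosed_eq φ.continuous ψ.continuous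

open Classical in
/-- The signed measure `A ↦ φ (1_A)` of a continuous linear functional `φ` on `L^p`. -/
noncomputable def dualSignedMeasure (κ : Measure α) [IsFiniteMeasure κ] (p : ℝ≥0∞) [Fact (1 ≤ p)]
    (hp : p ≠ ⊤) (φ : StrongDual ℝ (Lp ℝ p κ)) : SignedMeasure α where
  measureOf' A := if hA : MeasurableSet A then
    φ (indicatorConstLp p hA (measure_ne_top κ A) 1) else 0
  empty' := by simp
  not_measurable' A hA := by simp [hA]
  m_iUnion' A hA hd := by
    simp only [hA, MeasurableSet.iUnion hA, dif_pos]
    refine HasSum.mapL φ ?_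
    have hsum : ∀ s : Finset ℕ, ∑ i ∈ s, indicatorConstLp p (hA i) (measure_ne_top κ (A i)) (1 : ℝ)
        = indicatorConstLp p (s.measurableSet_biUnion fun i _ => hA i)
          (measure_ne_top κ (⋃ i ∈ s, A i)) 1 := by
      intro s
      induction s using Finset.induction_on with
      | empty => simp
      | insert a s ha ih =>
        rw [Finset.sum_insert ha, ih, ← indicatorConstLp_disjoint_union]
        · congr 1
          rw [Finset.set_biUnion_insert]
        · rw [Set.disjoint_iUnion₂_right]
          intro i hi
          exact hd (fun h => ha (h ▸ hi))
    rw [HasSum]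
    simp only [hsum]
    refine tendsto_indicatorConstLp_set hp ?_
    -- The part of the union still missing has the measure of the tail of a convergent series. It
    -- tends to zero because $\kappa$ is finite, and then so does the $L^p$ distance of the
    -- indicators, as $p<\infty$.
    have key : ∀ s : Finset ℕ, κ (symmDiff (⋃ i ∈ s, A i) (⋃ i, A i))
        = κ (⋃ i, A i) - ∑ i ∈ s, κ (A i) := by
      intro s
      have hsub : (⋃ i ∈ s, A i) ⊆ ⋃ i, A i := Set.iUnion₂_subset fun i _ => Set.subset_iUnion A i
      rw [symmDiff_of_le hsub, measure_sdiff hsub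
        (s.measurableSet_biUnion fun i _ => hA i).nullMeasurableSet (measure_ne_top _ _),
        measure_biUnion_finset (fun i _ j _ hij => hd hij) (fun i _ => hA i)]
    simp only [key]
    have h1 : Tendsto (fun s : Finset ℕ => ∑ i ∈ s, κ (A i)) atTop (𝓝 (κ (⋃ i, A i))) := by
      rw [measure_iUnion hd hA]
      exact ENNReal.summable.hasSum
    have := ENNReal.Tendsto.sub (tendsto_const_nhds (x := κ (⋃ i, A i)) (f := atTop)) h1
      (Or.inl (measure_ne_top _ _))
    simpa using this

open Classical in
theorem dualSignedMeasure_apply [IsFiniteMeasure κ] [Fact (1 ≤ p)]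
    (hp : p ≠ ⊤) (φ : StrongDual ℝ (Lp ℝ p κ)) {A : Set α} (hA : MeasurableSet A) :
    dualSignedMeasure κ p hp φ A = φ (indicatorConstLp p hA (measure_ne_top κ A) 1) := by
  change dite _ _ _ = _
  rw [dif_pos hA]

/-- Radon–Nikodym: the indicator of a null set is zero in $L^p$, so $A\mapsto\varphi(1_A)$ is
absolutely continuous. At this stage the density is only known to be in $L^1$. -/
theorem exists_density_of_dual [IsFiniteMeasure κ] [Fact (1 ≤ p)] (hp : p ≠ ⊤)
    (φ : StrongDual ℝ (Lp ℝ p κ)) :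
    ∃ G : α → ℝ, Measurable G ∧ Integrable G κ ∧ ∀ (A : Set α) (hA : MeasurableSet A),
      φ (indicatorConstLp p hA (measure_ne_top κ A) 1) = ∫ x in A, G x ∂κ := by
  set ν := dualSignedMeasure κ p hp φ with hν
  have hac : VectorMeasure.AbsolutelyContinuous ν κ.toENNRealVectorMeasure := by
    refine VectorMeasure.AbsolutelyContinuous.mk fun A hA h0 => ?_
    rw [Measure.toENNRealVectorMeasure_apply_measurable hA] at h0
    rw [hν, dualSignedMeasure_apply hp φ hA]
    have : indicatorConstLp p hA (measure_ne_top κ A) (1 : ℝ) = 0 := by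
      rw [← indicatorConstLp_empty (p := p) (μ := κ) (c := (1 : ℝ)),
        indicatorConstLp_inj _ _ _ _ one_ne_zero]
      exact ae_eq_empty.2 h0
    rw [this, map_zero]
  refine ⟨ν.rnDeriv κ, SignedMeasure.measurable_rnDeriv _ _,
    SignedMeasure.integrable_rnDeriv _ _, fun A hA => ?_⟩
  rw [← withDensityᵥ_apply (SignedMeasure.integrable_rnDeriv _ _) hA,
    SignedMeasure.withDensityᵥ_rnDeriv_eq ν κ hac, hν, dualSignedMeasure_apply hp φ hA]

/-- The pairing of `L^q` and `L^p`. -/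
noncomputable def dualPairing (κ : Measure α) (q p : ℝ≥0∞) [Fact (1 ≤ p)] [Fact (1 ≤ q)]
    [ENNReal.HolderConjugate q p] : Lp ℝ q κ →L[ℝ] StrongDual ℝ (Lp ℝ p κ) :=
  (ContinuousLinearMap.mul ℝ ℝ).lpPairing κ q p

theorem dualPairing_apply [Fact (1 ≤ p)] [Fact (1 ≤ q)] [ENNReal.HolderConjugate q p]
    (g : Lp ℝ q κ) (h : Lp ℝ p κ) : dualPairing κ q p g h = ∫ x, g x * h x ∂κ := by
  rw [dualPairing, ContinuousLinearMap.lpPairing_eq_integral]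
  rfl

theorem dualPairing_indicator [IsFiniteMeasure κ] [Fact (1 ≤ p)] [Fact (1 ≤ q)]
    [ENNReal.HolderConjugate q p] (g : Lp ℝ q κ) {A : Set α} (hA : MeasurableSet A) :
    dualPairing κ q p g (indicatorConstLp p hA (measure_ne_top κ A) 1) = ∫ x in A, g x ∂κ := by
  rw [dualPairing_apply, ← integral_indicator hA]
  refine integral_congr_ae ?_
  filter_upwards [indicatorConstLp_coeFn (p := p) (hs := hA) (hμs := measure_ne_top κ A)
    (c := (1 : ℝ))] with x hx
  rw [hx]
  by_cases h : x ∈ A <;> simp [h]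

/-- The bound is uniform in the truncation level `n`, which is what allows the truncation to be
removed. With $g$ the truncated density and $h=\operatorname{sign}(g)|g|^{q-1}$, the equality case
of Hölder gives $J=\int|g|^q=\varphi(h)\le\|\varphi\|J^{1/p}$, that is $\|g\|_q\le\|\varphi\|$.
Truncation makes $J$ finite. -/
theorem eLpNorm_le_of_dual_pairing [IsFiniteMeasure κ] [Fact (1 ≤ p)] [Fact (1 ≤ q)]
    (hp : p ≠ ⊤) (hq : q ≠ ⊤)
    [ENNReal.HolderConjugate q p] {φ : StrongDual ℝ (Lp ℝ p κ)} {G : α → ℝ} (hG : Measurable G)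
    {n : ℝ} (hφ : ∀ (A : Set α) (hA : MeasurableSet A), A ⊆ {x | |G x| ≤ n} →
      φ (indicatorConstLp p hA (measure_ne_top κ A) 1) = ∫ x in A, G x ∂κ) :
    eLpNorm ({x | |G x| ≤ n}.indicator G) q κ ≤ ENNReal.ofReal ‖φ‖ := by
  set B : Set α := {x | |G x| ≤ n} with hB
  have hBm : MeasurableSet B := measurableSet_le (by fun_prop) measurable_const
  set g : α → ℝ := B.indicator G with hg
  have hgm : Measurable g := hG.indicator hBm
  have hgb : ∀ x, |g x| ≤ |n| := by
    intro x
    by_cases hx : x ∈ B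
    · rw [hg, Set.indicator_of_mem hx]
      exact le_trans hx (le_abs_self n)
    · rw [hg, Set.indicator_of_notMem hx]
      simp
  have hbdd : ∀ {r : ℝ≥0∞} {u : α → ℝ} (C : ℝ), Measurable u → (∀ x, |u x| ≤ C) →
      MemLp u r κ := fun C hu hC =>
    MemLp.of_bound hu.aestronglyMeasurable C (Eventually.of_forall hC)
  have hgq : MemLp g q κ := hbdd |n| hgm hgb
  have hone : MemLp (B.indicator (fun _ => (1 : ℝ))) ⊤ κ :=
    hbdd 1 (measurable_const.indicator hBm) fun x => by
      by_cases hx : x ∈ B <;> simp [hx]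
  -- Multiplication by $1_B$. The functional $\varphi\circ E$ has the bounded density $g$, so it
  -- agrees with a pairing on indicators and hence on all of $L^p$.
  set E : Lp ℝ p κ →L[ℝ] Lp ℝ p κ :=
    (ContinuousLinearMap.mul ℝ ℝ).holderL κ ⊤ p p (hone.toLp _) with hE
  have hEc : ∀ h : Lp ℝ p κ, E h =ᵐ[κ] B.indicator h := by
    intro h
    have h1 := ContinuousLinearMap.coeFn_holder (r := p) (ContinuousLinearMap.mul ℝ ℝ)
      (hone.toLp _) h
    filter_upwards [h1, hone.coeFn_toLp] with x hx hx2
    rw [hE, ContinuousLinearMap.holderL_apply_apply, hx, hx2]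
    by_cases hxB : x ∈ B <;> simp [hxB]
  have heq : φ.comp E = dualPairing κ q p (hgq.toLp g) := by
    refine continuousLinearMap_Lp_ext hp fun A hA => ?_
    rw [dualPairing_indicator, ContinuousLinearMap.comp_apply]
    have h1 : E (indicatorConstLp p hA (measure_ne_top κ A) 1) =
        indicatorConstLp p (hA.inter hBm) (measure_ne_top κ _) 1 := by
      apply Lp.ext
      filter_upwards [hEc (indicatorConstLp p hA (measure_ne_top κ A) 1),
        indicatorConstLp_coeFn (p := p) (hs := hA) (hμs := measure_ne_top κ A) (c := (1 : ℝ)),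
        indicatorConstLp_coeFn (p := p) (hs := hA.inter hBm) (hμs := measure_ne_top κ _)
          (c := (1 : ℝ))] with x h1 h2 h3
      rw [h1, h3]
      by_cases hxB : x ∈ B <;> by_cases hxA : x ∈ A <;> simp [hxB, hxA, h2]
    rw [h1, hφ _ _ Set.inter_subset_right, ← setIntegral_indicator hBm]
    refine setIntegral_congr_ae hA ?_
    filter_upwards [hgq.coeFn_toLp] with x hx _
    rw [hx]
  have hq1 : 1 ≤ q := Fact.out
  have hp1 : 1 ≤ p := Fact.out
  have hconj : q.toReal.HolderConjugate p.toReal := by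
    refine ENNReal.HolderConjugate.toReal_of_ne_top ?_ ?_ <;> assumption
  set J : ℝ := ∫ x, |g x| ^ q.toReal ∂κ with hJ
  have hJ0 : 0 ≤ J := integral_nonneg fun x => by positivity
  set h : α → ℝ := fun x => SignType.sign (g x) * |g x| ^ (q.toReal - 1) with hh
  have hhm : Measurable h := by
    have : Measurable fun x => ((SignType.sign (g x) : SignType) : ℝ) := by
      have h2 : (fun x => ((SignType.sign (g x) : SignType) : ℝ)) =
          fun x => if 0 < g x then (1 : ℝ) else if g x < 0 then -1 else 0 := by
        ext x
        rw [sign_apply]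
        split_ifs <;> simp
      rw [h2]
      exact Measurable.ite (measurableSet_lt measurable_const hgm) measurable_const
        (Measurable.ite (measurableSet_lt hgm measurable_const) measurable_const measurable_const)
    exact this.mul ((hgm.abs).pow_const _)
  have hhabs : ∀ x, |h x| = |g x| ^ (q.toReal - 1) := by
    intro x
    have hpos : 0 < q.toReal - 1 := sub_pos.2 hconj.lt
    rw [hh, abs_mul, abs_of_nonneg (Real.rpow_nonneg (abs_nonneg _) _)]
    rcases lt_trichotomy (g x) 0 with h0 | h0 | h0
    · simp [h0]
    · simp [h0, Real.zero_rpow hpos.ne']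
    · simp [h0]
  have hhp : MemLp h p κ := hbdd (|n| ^ (q.toReal - 1)) hhm fun x => by
    rw [hhabs]
    exact Real.rpow_le_rpow (abs_nonneg _) (hgb x) (sub_nonneg.2 hconj.lt.le)
  have hEh : E (hhp.toLp h) = hhp.toLp h := by
    apply Lp.ext
    filter_upwards [hEc (hhp.toLp h), hhp.coeFn_toLp] with x h1 h2
    rw [h1]
    by_cases hxB : x ∈ B
    · simp [hxB]
    · rw [Set.indicator_of_notMem hxB, h2]
      simp [hh, hg, hxB]
  have hφh : φ (hhp.toLp h) = J := by
    have : φ (E (hhp.toLp h)) = dualPairing κ q p (hgq.toLp g) (hhp.toLp h) := by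
      rw [← heq]; rfl
    rw [hEh, dualPairing_apply] at this
    rw [this]
    refine integral_congr_ae ?_
    filter_upwards [hgq.coeFn_toLp, hhp.coeFn_toLp] with x h1 h2
    rw [h1, h2, hh]
    have h3 : g x * (SignType.sign (g x) : ℝ) = |g x| := self_mul_sign _
    rw [← mul_assoc, h3]
    rcases eq_or_ne (g x) 0 with h0 | h0
    · simp [h0, Real.zero_rpow hconj.pos.ne']
    · nth_rewrite 1 [← Real.rpow_one |g x|]
      rw [← Real.rpow_add (abs_pos.2 h0)]
      congr 1; ring
  have hnorm : ‖hhp.toLp h‖ = J ^ (p.toReal)⁻¹ := by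
    rw [Lp.norm_toLp, MemLp.eLpNorm_eq_integral_rpow_norm (zero_lt_one.trans_le hp1).ne' hp hhp,
      ENNReal.toReal_ofReal (by positivity)]
    congr 1
    refine integral_congr_ae (Eventually.of_forall fun x => ?_)
    simp only [Real.norm_eq_abs]
    rw [hhabs, ← Real.rpow_mul (abs_nonneg _)]
    congr 1
    exact hconj.sub_one_mul_conj
  rw [MemLp.eLpNorm_eq_integral_rpow_norm (zero_lt_one.trans_le hq1).ne' hq hgq]
  refine ENNReal.ofReal_le_ofReal ?_
  change J ^ (q.toReal)⁻¹ ≤ _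
  rcases hJ0.eq_or_lt with h0 | h0
  · rw [← h0, Real.zero_rpow (inv_pos.2 hconj.pos).ne']
    exact norm_nonneg _
  · have h1 : J ≤ ‖φ‖ * J ^ (p.toReal)⁻¹ := by
      rw [← hnorm, ← hφh]
      exact (le_abs_self _).trans (φ.le_opNorm _)
    have h2 : J = J ^ (q.toReal)⁻¹ * J ^ (p.toReal)⁻¹ := by
      rw [← Real.rpow_add h0, hconj.inv_add_inv_eq_one, Real.rpow_one]
    have h3 : 0 < J ^ (p.toReal)⁻¹ := by positivity
    nth_rewrite 1 [h2] at h1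
    exact le_of_mul_le_mul_right h1 h3

/-- Riesz representation: every continuous linear functional on `L^p` is integration against an
element of `L^q`. -/
theorem exists_eq_dualPairing [IsFiniteMeasure κ] [Fact (1 ≤ p)] [Fact (1 ≤ q)]
    (hp : p ≠ ⊤) (hq : q ≠ ⊤) [ENNReal.HolderConjugate q p] (φ : StrongDual ℝ (Lp ℝ p κ)) :
    ∃ g : Lp ℝ q κ, φ = dualPairing κ q p g := by
  obtain ⟨G, hGm, hGi, hG⟩ := exists_density_of_dual hp φ
  have hb : ∀ n : ℕ, eLpNorm ({x | |G x| ≤ n}.indicator G) q κ ≤ ENNReal.ofReal ‖φ‖ := fun n =>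
    eLpNorm_le_of_dual_pairing hp hq hGm fun A hA _ => hG A hA
  -- Fatou: the truncations converge pointwise to `G`, and their norms are bounded by $\|\varphi\|$.
  have hGq : eLpNorm G q κ ≤ ENNReal.ofReal ‖φ‖ := by
    refine (Lp.eLpNorm_lim_le_liminf_eLpNorm (f := fun n : ℕ => {x | |G x| ≤ n}.indicator G)
      (fun n => (hGm.indicator (measurableSet_le (by fun_prop)
        measurable_const)).aestronglyMeasurable) G (Eventually.of_forall fun x => ?_)).trans ?_
    · refine tendsto_const_nhds.congr' ?_
      obtain ⟨N, hN⟩ := exists_nat_ge |G x|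
      filter_upwards [eventually_ge_atTop N] with n hn
      rw [Set.indicator_of_mem]
      exact hN.trans (by exact_mod_cast hn)
    · refine (liminf_le_liminf (Eventually.of_forall hb)).trans ?_
      simp
  have hmem : MemLp G q κ := ⟨hGm.aestronglyMeasurable, hGq.trans_lt ENNReal.ofReal_lt_top⟩
  refine ⟨hmem.toLp G, continuousLinearMap_Lp_ext hp fun A hA => ?_⟩
  rw [dualPairing_indicator, hG A hA]
  refine setIntegral_congr_ae hA ?_
  filter_upwards [hmem.coeFn_toLp] with x hx _
  rw [hx]

/-- $L^p$ is mapped into the dual of the separable space $L^q$, where bounded sequences have weak-*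
convergent subsequences. Riesz representation turns the limit into an element of $L^p$, and a second
use of it shows that every functional on $L^p$ is an evaluation at an element of $L^q$. -/
theorem exists_weakly_convergent_subseq_of_finite [MeasurableSpace.CountablyGenerated α]
    [IsFiniteMeasure κ] [Fact (1 ≤ p)] [Fact (1 ≤ q)] (hp : p ≠ ⊤) (hq : q ≠ ⊤)
    [ENNReal.HolderConjugate p q] {h : ℕ → Lp ℝ p κ} {C : ℝ} (hC : ∀ n, ‖h n‖ ≤ C) :
    ∃ (h₀ : Lp ℝ p κ) (n : ℕ → ℕ), StrictMono n ∧
      ∀ φ : StrongDual ℝ (Lp ℝ p κ), Tendsto (fun j => φ (h (n j))) atTop (𝓝 (φ h₀)) := by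
  have : Fact (q ≠ ⊤) := ⟨hq⟩
  have : ENNReal.HolderConjugate q p := ENNReal.HolderConjugate.symm
  set J := dualPairing κ p q
  have hJ : ∀ n, StrongDual.toWeakDual (J (h n)) ∈
      WeakDual.toStrongDual ⁻¹' Metric.closedBall (0 : StrongDual ℝ (Lp ℝ q κ)) (‖J‖ * C) := by
    intro n
    simp only [Set.mem_preimage, Metric.mem_closedBall, dist_zero_right]
    exact (J.le_opNorm _).trans (mul_le_mul_of_nonneg_left (hC n) (norm_nonneg _))
  have : TopologicalSpace.SeparableSpace (Lp ℝ q κ) := inferInstance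
  obtain ⟨Λ, -, n, hn, hlim⟩ := WeakDual.isSeqCompact_closedBall ℝ (Lp ℝ q κ) 0 (‖J‖ * C) hJ
  obtain ⟨h₀, hh₀⟩ := exists_eq_dualPairing (p := q) (q := p) hq hp (WeakDual.toStrongDual Λ)
  refine ⟨h₀, n, hn, fun φ => ?_⟩
  obtain ⟨g, rfl⟩ := exists_eq_dualPairing (p := p) (q := q) hp hq φ
  have hswap : ∀ k : Lp ℝ p κ, dualPairing κ q p g k = J k g := by
    intro k
    rw [dualPairing_apply, dualPairing_apply]
    simp only [mul_comm]
  simp only [hswap]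
  have := (WeakBilin.tendsto_iff_forall_eval_tendsto _
    (ContinuousLinearMap.coe_injective)).1 hlim g
  have h0 : J h₀ g = Λ g := by rw [← hh₀]; rfl
  rw [h0]
  exact this

/-- Reduction to a finite measure: if $\kappa$ is a finite measure equivalent to $\mu$ and
$W=d\mu/d\kappa$, then $k\mapsto W^{1/p}k$ is an isometry from $L^p(\mu)$ to $L^p(\kappa)$. Weak
convergence is carried back by its inverse `S`. -/
theorem exists_weakly_convergent_subseq [MeasurableSpace.CountablyGenerated α]
    {μ : Measure α} [SigmaFinite μ] [Fact (1 ≤ p)] [Fact (1 ≤ q)] (hp : p ≠ ⊤) (hq : q ≠ ⊤)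
    [ENNReal.HolderConjugate p q] {h : ℕ → Lp ℝ p μ} {C : ℝ} (hC : ∀ n, ‖h n‖ ≤ C) :
    ∃ (h₀ : Lp ℝ p μ) (n : ℕ → ℕ), StrictMono n ∧
      ∀ φ : StrongDual ℝ (Lp ℝ p μ), Tendsto (fun j => φ (h (n j))) atTop (𝓝 (φ h₀)) := by
  have hp1 : 1 ≤ p := Fact.out
  have hp0 : p ≠ 0 := (zero_lt_one.trans_le hp1).ne'
  have hpr : 0 < p.toReal := ENNReal.toReal_pos hp0 hp
  set κ := μ.toFinite
  have hμκ : μ ≪ κ := absolutelyContinuous_toFinite μ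
  have hκμ : κ ≪ μ := toFinite_absolutelyContinuous μ
  set W := μ.rnDeriv κ with hW
  have hWm : Measurable W := Measure.measurable_rnDeriv _ _
  set u : α → ℝ := fun x => (W x).toReal ^ (p.toReal)⁻¹ with hu
  have hum : Measurable u := hWm.ennreal_toReal.pow_const _
  have hWpos : ∀ᵐ x ∂μ, 0 < W x := Measure.rnDeriv_pos hμκ
  have hWfin : ∀ᵐ x ∂κ, W x < ⊤ := Measure.rnDeriv_lt_top μ κ
  have hupos : ∀ᵐ x ∂μ, u x ≠ 0 := by
    filter_upwards [hWpos, hμκ.ae_le hWfin] with x h1 h2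
    exact (Real.rpow_pos_of_pos (ENNReal.toReal_pos h1.ne' h2.ne) _).ne'
  have hnorm : ∀ k : α → ℝ, AEStronglyMeasurable k κ →
      eLpNorm (fun x => u x * k x) p κ = eLpNorm k p μ := by
    intro k hk
    rw [eLpNorm_eq_lintegral_rpow_enorm_toReal hp0 hp,
      eLpNorm_eq_lintegral_rpow_enorm_toReal hp0 hp,
      ← lintegral_rnDeriv_mul hμκ (hk.enorm.pow_const _)]
    congr 1
    refine lintegral_congr_ae ?_
    filter_upwards [hWfin] with x hx
    rw [enorm_mul, ENNReal.mul_rpow_of_nonneg _ _ hpr.le]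
    congr 1
    rw [Real.enorm_eq_ofReal (by positivity), ENNReal.ofReal_rpow_of_nonneg (by positivity) hpr.le,
      ← Real.rpow_mul ENNReal.toReal_nonneg, inv_mul_cancel₀ hpr.ne', Real.rpow_one,
      ENNReal.ofReal_toReal hx.ne]
  have hT : ∀ k : Lp ℝ p μ, MemLp (fun x => u x * k x) p κ := fun k => by
    have hk : AEStronglyMeasurable (k : α → ℝ) κ := (Lp.aestronglyMeasurable k).mono_ac hκμ
    refine ⟨hum.aestronglyMeasurable.mul hk, ?_⟩
    rw [hnorm _ hk]
    exact Lp.eLpNorm_lt_top k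
  have hSn : ∀ k : Lp ℝ p κ, eLpNorm (fun x => (u x)⁻¹ * k x) p μ = eLpNorm k p κ := fun k => by
    have hk : AEStronglyMeasurable (k : α → ℝ) κ := Lp.aestronglyMeasurable k
    rw [← hnorm (fun x => (u x)⁻¹ * k x) (hum.inv.aestronglyMeasurable.mul hk)]
    refine eLpNorm_congr_ae ?_
    filter_upwards [hκμ.ae_le hupos] with x hx
    rw [mul_inv_cancel_left₀ hx]
  have hS : ∀ k : Lp ℝ p κ, MemLp (fun x => (u x)⁻¹ * k x) p μ := fun k => by
    refine ⟨hum.inv.aestronglyMeasurable.mul ((Lp.aestronglyMeasurable k).mono_ac hμκ), ?_⟩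
    rw [hSn]
    exact Lp.eLpNorm_lt_top k
  let S₀ : Lp ℝ p κ →ₗ[ℝ] Lp ℝ p μ :=
    { toFun := fun k => (hS k).toLp _
      map_add' := fun a b => by
        rw [← MemLp.toLp_add]
        refine MemLp.toLp_congr _ _ ?_
        filter_upwards [hμκ.ae_le (Lp.coeFn_add a b)] with x hx
        rw [hx, Pi.add_apply, Pi.add_apply, mul_add]
      map_smul' := fun c a => by
        rw [RingHom.id_apply, ← MemLp.toLp_const_smul]
        refine MemLp.toLp_congr _ _ ?_
        filter_upwards [hμκ.ae_le (Lp.coeFn_smul c a)] with x hx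
        rw [hx, Pi.smul_apply, Pi.smul_apply, smul_eq_mul, smul_eq_mul]
        ring }
  let S : Lp ℝ p κ →L[ℝ] Lp ℝ p μ := S₀.mkContinuous 1 fun k => by
    rw [one_mul]
    change ‖(hS k).toLp _‖ ≤ _
    rw [Lp.norm_toLp, hSn, Lp.norm_def]
  have hST : ∀ k : Lp ℝ p μ, S ((hT k).toLp _) = k := fun k => by
    change (hS _).toLp _ = _
    apply Lp.ext
    filter_upwards [(hS ((hT k).toLp _)).coeFn_toLp, hμκ.ae_le (hT k).coeFn_toLp, hupos]
      with x h1 h2 h3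
    rw [h1, h2, inv_mul_cancel_left₀ h3]
  have hbound : ∀ n, ‖(hT (h n)).toLp _‖ ≤ C := fun n => by
    rw [Lp.norm_toLp, hnorm _ ((Lp.aestronglyMeasurable (h n)).mono_ac hκμ), ← Lp.norm_def]
    exact hC n
  obtain ⟨k₀, n, hn, hlim⟩ := exists_weakly_convergent_subseq_of_finite hp hq hbound
  refine ⟨S k₀, n, hn, fun φ => ?_⟩
  have := hlim (φ.comp S)
  simpa only [ContinuousLinearMap.comp_apply, hST] using this

end LpDuality

namespace VlasovPoisson

/-! ### Angular momentum and the changes of variables in phase space. -/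

section Geometry

theorem continuous_angMom : Continuous angMom := by
  unfold angMom
  fun_prop

theorem measurable_angMom : Measurable angMom := continuous_angMom.measurable

theorem angMom_nonneg (z : Phase) : 0 ≤ angMom z := by
  have h := abs_real_inner_le_norm z.1 z.2
  have : (inner ℝ z.1 z.2) ^ 2 ≤ (‖z.1‖ * ‖z.2‖) ^ 2 := by
    rw [← sq_abs]
    exact pow_le_pow_left₀ (abs_nonneg _) h 2
  unfold angMom
  nlinarith

theorem angMom_le (z : Phase) : angMom z ≤ ‖z.1‖ ^ 2 * ‖z.2‖ ^ 2 := by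
  unfold angMom
  nlinarith [sq_nonneg (inner ℝ z.1 z.2)]

theorem angMom_isometry (A : Space ≃ₗᵢ[ℝ] Space) (x v : Space) :
    angMom (A x, A v) = angMom (x, v) := by
  simp [angMom]

theorem ae_fst_ne_zero : ∀ᵐ z : Phase, z.1 ≠ 0 := by
  have h : ∀ᵐ x : Space, x ≠ 0 := by
    rw [ae_iff]; simp
  rw [Measure.volume_eq_prod]
  exact Measure.quasiMeasurePreserving_fst.ae h

/-- For $x\ne0$ the equality case of Cauchy–Schwarz puts the fibre of $\{L=0\}$ inside the line
$\mathbb Rx$, a null set of $\mathbb R^3$. Consequently the conventional values of negative powers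
of $L$ at $L=0$ never matter. -/
theorem ae_angMom_pos : ∀ᵐ z : Phase, 0 < angMom z := by
  have h0 : volume {z : Phase | angMom z = 0} = 0 := by
    have hm : MeasurableSet {z : Phase | angMom z = 0} :=
      measurable_angMom (measurableSet_singleton 0)
    rw [Measure.volume_eq_prod, Measure.measure_prod_null hm]
    have h : ∀ᵐ x : Space, x ≠ 0 := by
      rw [ae_iff]; simp
    filter_upwards [h] with x hx
    have hsub : Prod.mk x ⁻¹' {z : Phase | angMom z = 0} ⊆ (Submodule.span ℝ {x} : Set Space) := by
      intro v hv
      simp only [Set.mem_preimage, Set.mem_ofPred_eq, angMom] at hv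
      have h1 : ‖inner ℝ x v‖ = ‖x‖ * ‖v‖ := by
        rw [Real.norm_eq_abs]
        have : (inner ℝ x v) ^ 2 = (‖x‖ * ‖v‖) ^ 2 := by nlinarith
        rw [← abs_of_nonneg (by positivity : 0 ≤ ‖x‖ * ‖v‖)]
        exact (sq_eq_sq_iff_abs_eq_abs _ _).1 this
      rcases (norm_inner_eq_norm_tfae ℝ x v).out 0 2 |>.1 h1 with h | ⟨r, rfl⟩
      · exact absurd h hx
      · exact Submodule.smul_mem _ _ (Submodule.mem_span_singleton_self x)
    refine measure_mono_null hsub (Measure.addHaar_submodule _ _ ?_)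
    intro htop
    have h1 : Module.finrank ℝ (Submodule.span ℝ {x}) = 1 := finrank_span_singleton hx
    rw [htop, finrank_top] at h1
    simp at h1
  have : ∀ᵐ z : Phase, angMom z ≠ 0 := by
    rw [ae_iff]; simpa using h0
  filter_upwards [this] with z hz
  exact lt_of_le_of_ne (angMom_nonneg z) (Ne.symm hz)

/-- The linear map multiplying the component of `v` orthogonal to `x` by `t`. -/
noncomputable def stretch (t : ℝ) (x : Space) : Space →ₗ[ℝ] Space :=
  t • LinearMap.transvection (((1 - t) / t / ‖x‖ ^ 2) • (innerSL ℝ x : Space →ₗ[ℝ] ℝ)) x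

theorem stretch_apply (t : ℝ) (x v : Space) :
    stretch t x v = t • (v + ((1 - t) / t / ‖x‖ ^ 2 * inner ℝ x v) • x) := rfl

/-- The map is $t$ times a transvection, whose determinant is $1+(1-t)/t=1/t$; this leaves $t^3\cdot
t^{-1}$. -/
theorem det_stretch {t : ℝ} (ht : t ≠ 0) {x : Space} (hx : x ≠ 0) :
    LinearMap.det (stretch t x) = t ^ 2 := by
  have hx' : ‖x‖ ≠ 0 := norm_ne_zero_iff.2 hx
  rw [stretch, LinearMap.det_smul, LinearMap.transvection.det]
  simp only [LinearMap.smul_apply, ContinuousLinearMap.coe_coe, innerSL_apply_apply,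
    real_inner_self_eq_norm_sq, smul_eq_mul, finrank_euclideanSpace, Fintype.card_fin]
  field_simp
  ring

theorem inner_stretch {t : ℝ} (ht : t ≠ 0) {x : Space} (hx : x ≠ 0) (v : Space) :
    inner ℝ x (stretch t x v) = inner ℝ x v := by
  have hx' : ‖x‖ ≠ 0 := norm_ne_zero_iff.2 hx
  rw [stretch_apply, inner_smul_right, inner_add_right, inner_smul_right,
    real_inner_self_eq_norm_sq]
  field_simp
  ring

theorem norm_sq_stretch {t : ℝ} (ht : t ≠ 0) {x : Space} (hx : x ≠ 0) (v : Space) :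
    ‖x‖ ^ 2 * ‖stretch t x v‖ ^ 2 = t ^ 2 * angMom (x, v) + (inner ℝ x v) ^ 2 := by
  have hx' : ‖x‖ ≠ 0 := norm_ne_zero_iff.2 hx
  rw [stretch_apply, norm_smul, mul_pow, ← real_inner_self_eq_norm_sq (v + _), inner_add_left,
    inner_add_right, inner_add_right]
  simp only [inner_smul_left, inner_smul_right, real_inner_self_eq_norm_sq, angMom,
    Real.norm_eq_abs, sq_abs, RCLike.conj_to_real, real_inner_comm x v]
  field_simp
  ring

/-- The choice $t=1/s$ leaves $L$ invariant, which is the point of stretching only the tangential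
velocity. -/
theorem angMom_stretch {s t : ℝ} (ht : t ≠ 0) {x : Space} (hx : x ≠ 0) (v : Space) :
    angMom (s • x, stretch t x v) = (s * t) ^ 2 * angMom (x, v) := by
  have h1 := norm_sq_stretch ht hx v
  have h2 : angMom (s • x, stretch t x v)
      = s ^ 2 * (‖x‖ ^ 2 * ‖stretch t x v‖ ^ 2) - s ^ 2 * (inner ℝ x v) ^ 2 := by
    simp only [angMom, norm_smul, inner_smul_left, inner_stretch ht hx, Real.norm_eq_abs,
      RCLike.conj_to_real, mul_pow, sq_abs]
    ring
  rw [h2, h1]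
  ring

theorem measurable_stretch (t : ℝ) : Measurable fun z : Phase => stretch t z.1 z.2 := by
  simp only [stretch_apply]
  fun_prop

theorem stretch_isometry (t : ℝ) (A : Space ≃ₗᵢ[ℝ] Space) (x v : Space) :
    stretch t (A x) (A v) = A (stretch t x v) := by
  simp only [stretch_apply, A.norm_map, A.inner_map_map, map_smul, map_add]

/-- Fubini: each fibre over $x\ne0$ contributes the factor $1/d$, and the dilation of $x$ the factor
$s^{-3}$. The point $x=0$, where `stretch` has a different determinant, is null. -/
theorem map_fiberwise_linear {s d : ℝ} (hs : 0 < s) (hd : 0 < d) {T : Space → Space →ₗ[ℝ] Space}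
    (hT : ∀ x, x ≠ 0 → |LinearMap.det (T x)| = d) (hm : Measurable fun z : Phase => T z.1 z.2) :
    Measure.map (fun z : Phase => (s • z.1, T z.1 z.2)) volume
      = ENNReal.ofReal (s ^ 3 * d)⁻¹ • (volume : Measure Phase) := by
  have hΦ : Measurable fun z : Phase => (s • z.1, T z.1 z.2) := (by fun_prop :
    Measurable fun z : Phase => s • z.1).prodMk hm
  ext B hB
  rw [Measure.map_apply hΦ hB, Measure.smul_apply, Measure.volume_eq_prod,
    Measure.prod_apply (hΦ hB), Measure.prod_apply hB]
  have h0 : ∀ᵐ x : Space, x ≠ 0 := by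
    rw [ae_iff]; simp
  have h1 : ∀ᵐ x : Space, volume (Prod.mk x ⁻¹' ((fun z : Phase => (s • z.1, T z.1 z.2)) ⁻¹' B))
      = ENNReal.ofReal d⁻¹ * volume (Prod.mk (s • x) ⁻¹' B) := by
    filter_upwards [h0] with x hx
    have hdet : LinearMap.det (T x) ≠ 0 := by
      intro h
      have := hT x hx
      rw [h, abs_zero] at this
      exact hd.ne this
    rw [← hT x hx, ← abs_inv, ← Measure.addHaar_preimage_linearMap volume hdet]
    rfl
  rw [lintegral_congr_ae h1]
  have hmeas : Measurable fun x : Space => volume (Prod.mk x ⁻¹' B) :=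
    measurable_measure_prodMk_left hB
  have hmeas' : Measurable fun x : Space => volume (Prod.mk (s • x) ⁻¹' B) :=
    hmeas.comp (measurable_const_smul s)
  rw [lintegral_const_mul _ hmeas']
  have h2 : ∫⁻ x : Space, volume (Prod.mk (s • x) ⁻¹' B)
      = ENNReal.ofReal (s ^ 3)⁻¹ * ∫⁻ x : Space, volume (Prod.mk x ⁻¹' B) := by
    rw [← lintegral_map (μ := volume) hmeas (measurable_const_smul s),
      Measure.map_addHaar_smul _ hs.ne', lintegral_smul_measure, abs_of_pos (by positivity),
      finrank_euclideanSpace, Fintype.card_fin, smul_eq_mul]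
  rw [h2, ← mul_assoc, ← ENNReal.ofReal_mul (by positivity), ← mul_inv, mul_comm d, smul_eq_mul]

/-- The change of variables `(x, v) ↦ (s x, v_r + t v_t)`. -/
noncomputable def stretchMap (s t : ℝ) (z : Phase) : Phase := (s • z.1, stretch t z.1 z.2)

theorem measurable_stretchMap (s t : ℝ) : Measurable (stretchMap s t) :=
  (by fun_prop : Measurable fun z : Phase => s • z.1).prodMk (measurable_stretch t)

theorem map_stretchMap {s t : ℝ} (hs : 0 < s) (ht : 0 < t) :
    Measure.map (stretchMap s t) volume
      = ENNReal.ofReal (s ^ 3 * t ^ 2)⁻¹ • (volume : Measure Phase) :=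
  map_fiberwise_linear hs (by positivity)
    (fun x hx => by rw [det_stretch ht.ne' hx, abs_of_pos (by positivity)]) (measurable_stretch t)

theorem map_scale {s t : ℝ} (hs : 0 < s) (ht : 0 < t) :
    Measure.map (fun z : Phase => (s • z.1, t • z.2)) volume
      = ENNReal.ofReal (s ^ 3 * t ^ 3)⁻¹ • (volume : Measure Phase) :=
  map_fiberwise_linear (T := fun _ => t • LinearMap.id) hs (by positivity)
    (fun x _ => by simp [abs_of_pos ht]) (by
      simp only [LinearMap.smul_apply, LinearMap.id_apply]; fun_prop)

theorem angMom_scale (s t : ℝ) (z : Phase) :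
    angMom (s • z.1, t • z.2) = (s * t) ^ 2 * angMom z := by
  simp only [angMom, norm_smul, inner_smul_left, inner_smul_right, Real.norm_eq_abs,
    RCLike.conj_to_real, mul_pow, sq_abs]
  ring

end Geometry

/-! ### Integrals of powers of $|x|$ in $\mathbb R^3$. -/

section Radial

theorem lintegral_norm_rpow_lt_top {s : ℝ} (hs : -3 < s) :
    ∫⁻ x in Metric.ball (0 : Space) 1, ENNReal.ofReal (‖x‖ ^ s) < ⊤ := by
  have h : IntegrableOn (fun x : Space => ‖x‖ ^ s) (Metric.ball 0 1) := by
    rw [integrableOn_fun_norm_addHaar volume (f := fun y : ℝ => y ^ s)]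
    have : IntegrableOn (fun y : ℝ => y ^ (s + 2)) (Set.Ioo 0 1) := by
      rw [intervalIntegral.integrableOn_Ioo_rpow_iff zero_lt_one]
      linarith
    refine this.congr_fun (fun y hy => ?_) measurableSet_Ioo
    simp only [finrank_euclideanSpace, Fintype.card_fin, smul_eq_mul]
    rw [Real.rpow_add hy.1, mul_comm]
    norm_num
  exact (hasFiniteIntegral_iff_ofReal (Eventually.of_forall fun x => by positivity)).1 h.2

/-- `∫_{|x| ≥ 1} |x|⁻⁴ dx`. -/
noncomputable def tailConst : ℝ≥0∞ := ∫⁻ x in {x : Space | 1 ≤ ‖x‖}, ENNReal.ofReal ((‖x‖ ^ 4)⁻¹)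

theorem tailConst_lt_top : tailConst < ⊤ := by
  have h : Integrable (fun x : Space =>
      (Set.Ici (1 : ℝ)).indicator (fun y : ℝ => (y ^ 4)⁻¹) ‖x‖) := by
    rw [integrable_fun_norm_addHaar volume
      (f := (Set.Ici (1 : ℝ)).indicator (fun y : ℝ => (y ^ 4)⁻¹))]
    have h1 : IntegrableOn (fun y : ℝ => y ^ (-2 : ℝ)) (Set.Ioi (1 : ℝ)) :=
      integrableOn_Ioi_rpow_of_lt (by norm_num) zero_lt_one
    rw [← integrableOn_Ici_iff_integrableOn_Ioi] at h1
    have h2 : Integrable ((Set.Ici (1 : ℝ)).indicator fun y : ℝ => y ^ (-2 : ℝ)) :=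
      (integrable_indicator_iff measurableSet_Ici).2 h1
    refine (h2.integrableOn (s := Set.Ioi 0)).congr_fun (fun y hy => ?_) measurableSet_Ioi
    have hy' : (0 : ℝ) < y := hy
    by_cases h : y ∈ Set.Ici (1 : ℝ)
    · simp only [h, Set.indicator_of_mem, finrank_euclideanSpace, Fintype.card_fin, smul_eq_mul]
      rw [Real.rpow_neg hy'.le]
      norm_num
      field_simp
    · simp only [h, Set.indicator_of_notMem, not_false_iff, smul_zero]
  have h3 := (hasFiniteIntegral_iff_ofReal (Eventually.of_forall fun x =>
    Set.indicator_nonneg (fun y _ => by positivity) _)).1 h.2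
  rw [tailConst, ← lintegral_indicator (measurableSet_le measurable_const (by fun_prop))]
  refine lt_of_le_of_lt (lintegral_mono fun x => ?_) h3
  by_cases hx : 1 ≤ ‖x‖
  · simp [hx]
  · simp [hx]

theorem tailConst_pos : 0 < tailConst := by
  rw [tailConst, setLIntegral_pos_iff (by fun_prop)]
  refine lt_of_lt_of_le ?_ (measure_mono (s := {x : Space | 1 < ‖x‖}) ?_)
  · refine IsOpen.measure_pos _ (isOpen_lt continuous_const continuous_norm) ?_
    obtain ⟨x, hx⟩ := NormedSpace.exists_lt_norm ℝ Space 1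
    exact ⟨x, hx⟩
  · intro x hx
    have hx' : 1 < ‖x‖ := hx
    refine ⟨?_, hx'.le⟩
    simp only [Function.mem_support, ne_eq, ENNReal.ofReal_eq_zero, not_le]
    positivity

theorem lintegral_tail {R : ℝ} (hR : 0 < R) :
    ∫⁻ x in {x : Space | R ≤ ‖x‖}, ENNReal.ofReal ((‖x‖ ^ 4)⁻¹)
      = ENNReal.ofReal R⁻¹ * tailConst := by
  have hmR : ∀ r : ℝ, MeasurableSet {x : Space | r ≤ ‖x‖} := fun r =>
    measurableSet_le measurable_const (by fun_prop)
  set G : Space → ℝ≥0∞ := {x : Space | R ≤ ‖x‖}.indicator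
    fun x => ENNReal.ofReal ((‖x‖ ^ 4)⁻¹) with hG
  have hGm : Measurable G := Measurable.indicator (by fun_prop) (hmR R)
  have h1 : ∫⁻ x, G (R • x) = ENNReal.ofReal (R ^ 3)⁻¹ * ∫⁻ x, G x := by
    rw [← lintegral_map (μ := volume) hGm (measurable_const_smul R),
      Measure.map_addHaar_smul _ hR.ne', lintegral_smul_measure, abs_of_pos (by positivity),
      finrank_euclideanSpace, Fintype.card_fin, smul_eq_mul]
  have h2 : ∫⁻ x, G (R • x) = ENNReal.ofReal (R ^ 4)⁻¹ * tailConst := by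
    rw [tailConst, ← lintegral_indicator (hmR 1), ← lintegral_const_mul _
      (Measurable.indicator (by fun_prop) (hmR 1))]
    refine lintegral_congr fun x => ?_
    have hiff : R ≤ ‖R • x‖ ↔ 1 ≤ ‖x‖ := by
      rw [norm_smul, Real.norm_of_nonneg hR.le]
      constructor
      · intro h; nlinarith
      · intro h; nlinarith
    by_cases hx : 1 ≤ ‖x‖
    · rw [hG, Set.indicator_of_mem (by exact hiff.2 hx), Set.indicator_of_mem (by exact hx),
        ← ENNReal.ofReal_mul (by positivity), norm_smul, Real.norm_of_nonneg hR.le, mul_pow,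
        mul_inv]
    · rw [hG, Set.indicator_of_notMem (by exact fun h => hx (hiff.1 h)),
        Set.indicator_of_notMem (by exact hx), mul_zero]
  rw [← lintegral_indicator (hmR R)]
  change ∫⁻ x, G x = _
  have h3 : ∫⁻ x, G x = ENNReal.ofReal (R ^ 3) * ∫⁻ x, G (R • x) := by
    rw [h1, ← mul_assoc, ← ENNReal.ofReal_mul (by positivity), mul_inv_cancel₀ (by positivity),
      ENNReal.ofReal_one, one_mul]
  rw [h3, h2, ← mul_assoc, ← ENNReal.ofReal_mul (by positivity)]
  congr 2
  field_simp

end Radial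

/-! ### The weight $L^l$ is integrable on boxes in phase space. -/

section Boxes

/-- The set `{|x| ≤ R, |v| ≤ V}` in phase space. -/
def box (R V : ℝ) : Set Phase := {z | ‖z.1‖ ≤ R ∧ ‖z.2‖ ≤ V}

theorem measurableSet_box (R V : ℝ) : MeasurableSet (box R V) :=
  (measurableSet_le measurable_fst.norm measurable_const).inter
    (measurableSet_le measurable_snd.norm measurable_const)

theorem box_eq_prod (R V : ℝ) :
    box R V = Metric.closedBall (0 : Space) R ×ˢ Metric.closedBall (0 : Space) V := by
  ext z; simp [box]

theorem volume_box_lt_top (R V : ℝ) : volume (box R V) < ⊤ := by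
  rw [box_eq_prod, Measure.volume_eq_prod, Measure.prod_prod]
  exact ENNReal.mul_lt_top measure_closedBall_lt_top measure_closedBall_lt_top

theorem volume_box_pos {R V : ℝ} (hR : 0 < R) (hV : 0 < V) : 0 < volume (box R V) := by
  rw [box_eq_prod, Measure.volume_eq_prod, Measure.prod_prod]
  exact ENNReal.mul_pos (Metric.measure_closedBall_pos volume _ hR).ne'
    (Metric.measure_closedBall_pos volume _ hV).ne'

/-- `∫∫_{|x| ≤ R, |v| ≤ V} L^l dv dx`. -/
noncomputable def boxWeight (l R V : ℝ) : ℝ≥0∞ := ∫⁻ z in box R V, ENNReal.ofReal (angMom z ^ l)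

/-- $L$ is homogeneous of degree two in $x$ and in $v$, and the volume is homogeneous of degree
three in each; hence the exponent $2l+3$. -/
theorem boxWeight_scale (l : ℝ) {R V : ℝ} (hR : 0 < R) (hV : 0 < V) :
    boxWeight l R V = ENNReal.ofReal ((R * V) ^ (2 * l + 3)) * boxWeight l 1 1 := by
  set w : Phase → ℝ≥0∞ := fun z => ENNReal.ofReal (angMom z ^ l) with hw
  have hwm : Measurable w := (measurable_angMom.pow_const l).ennreal_ofReal
  set G : Phase → ℝ≥0∞ := (box R V).indicator w with hG
  have hGm : Measurable G := hwm.indicator (measurableSet_box R V)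
  have hS : Measurable fun z : Phase => (R • z.1, V • z.2) := by fun_prop
  have h1 : ∫⁻ z : Phase, G (R • z.1, V • z.2) =
      ENNReal.ofReal (R ^ 3 * V ^ 3)⁻¹ * ∫⁻ z, G z := by
    rw [← lintegral_map (μ := volume) (g := fun z : Phase => (R • z.1, V • z.2)) hGm hS,
      map_scale hR hV, lintegral_smul_measure, smul_eq_mul]
  have h2 : ∫⁻ z : Phase, G (R • z.1, V • z.2) =
      ENNReal.ofReal ((R * V) ^ (2 * l)) * boxWeight l 1 1 := by
    rw [boxWeight, ← lintegral_indicator (measurableSet_box 1 1), ← lintegral_const_mul _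
      (hwm.indicator (measurableSet_box 1 1))]
    refine lintegral_congr fun z => ?_
    have hiff : (R • z.1, V • z.2) ∈ box R V ↔ z ∈ box 1 1 := by
      simp only [box, Set.mem_ofPred_eq, norm_smul, Real.norm_of_nonneg hR.le,
        Real.norm_of_nonneg hV.le]
      constructor
      · rintro ⟨h, h'⟩; constructor <;> nlinarith
      · rintro ⟨h, h'⟩; constructor <;> nlinarith
    by_cases hz : z ∈ box 1 1
    · rw [hG, Set.indicator_of_mem (hiff.2 hz), Set.indicator_of_mem hz]
      simp only [hw]
      rw [← ENNReal.ofReal_mul (by positivity), angMom_scale,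
        Real.mul_rpow (by positivity) (angMom_nonneg z), Real.rpow_mul (by positivity),
        Real.rpow_two]
    · rw [hG, Set.indicator_of_notMem (fun h => hz (hiff.1 h)), Set.indicator_of_notMem hz,
        mul_zero]
  have h3 : boxWeight l R V = ENNReal.ofReal (R ^ 3 * V ^ 3) *
      ∫⁻ z : Phase, G (R • z.1, V • z.2) := by
    rw [h1, ← mul_assoc, ← ENNReal.ofReal_mul (by positivity), mul_inv_cancel₀ (by positivity),
      ENNReal.ofReal_one, one_mul, boxWeight, hG, lintegral_indicator (measurableSet_box R V)]
  rw [h3, h2, ← mul_assoc, ← ENNReal.ofReal_mul (by positivity), Real.rpow_add (by positivity)]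
  congr 2
  rw [mul_comm, ← mul_pow]
  norm_num

/-- Small $L$ forces the tangential velocity to be at most $s/|x|$. Stretching it by $|x|/s$ maps
the fibre into a fixed ball, so the fibre has volume at most a constant times $s^2|x|^{-2}$, and
$|x|^{-2}$ is integrable near the origin of $\mathbb R^3$. -/
theorem volume_small_angMom : ∃ C : ℝ≥0∞, C < ⊤ ∧ ∀ s : ℝ, 0 < s →
    volume (box 1 1 ∩ {z | angMom z ≤ s ^ 2}) ≤ ENNReal.ofReal (s ^ 2) * C := by
  set B : ℝ≥0∞ := volume (Metric.closedBall (0 : Space) 2) with hB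
  set I : ℝ≥0∞ := ∫⁻ x in Metric.ball (0 : Space) 1, ENNReal.ofReal (‖x‖ ^ (-2 : ℝ)) with hI
  have hIt : I < ⊤ := lintegral_norm_rpow_lt_top (by norm_num)
  refine ⟨I * B, ENNReal.mul_lt_top hIt measure_closedBall_lt_top, fun s hs => ?_⟩
  have hm : MeasurableSet (box 1 1 ∩ {z | angMom z ≤ s ^ 2}) :=
    (measurableSet_box 1 1).inter (measurableSet_le measurable_angMom measurable_const)
  rw [Measure.volume_eq_prod, Measure.prod_apply hm]
  have h0 : ∀ᵐ x : Space, x ≠ 0 := by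
    rw [ae_iff]; simp
  have hsph : ∀ᵐ x : Space, x ∉ Metric.sphere (0 : Space) 1 := by
    refine compl_mem_ae_iff.2 ?_
    exact Measure.addHaar_sphere volume (0 : Space) 1
  have hb : ∀ᵐ x : Space, volume (Prod.mk x ⁻¹' (box 1 1 ∩ {z | angMom z ≤ s ^ 2})) ≤
      (Metric.ball (0 : Space) 1).indicator
        (fun x => ENNReal.ofReal (s ^ 2) * (ENNReal.ofReal (‖x‖ ^ (-2 : ℝ)) * B)) x := by
    filter_upwards [h0, hsph] with x hx hxs
    by_cases hx1 : ‖x‖ < 1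
    · rw [Set.indicator_of_mem (by simpa using hx1)]
      have hxp : 0 < ‖x‖ := norm_pos_iff.2 hx
      have ht : 0 < ‖x‖ / s := by positivity
      have hsub : Prod.mk x ⁻¹' (box 1 1 ∩ {z | angMom z ≤ s ^ 2}) ⊆
          stretch (‖x‖ / s) x ⁻¹' Metric.closedBall 0 2 := by
        rintro v ⟨⟨-, hv⟩, hL⟩
        simp only [Set.mem_ofPred_eq] at hL hv
        simp only [Set.mem_preimage, Metric.mem_closedBall, dist_zero_right]
        have h1 := norm_sq_stretch ht.ne' hx v
        have h2 : (inner ℝ x v) ^ 2 ≤ ‖x‖ ^ 2 := by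
          have := angMom_nonneg (x, v)
          unfold angMom at this
          have h3 : ‖v‖ ^ 2 ≤ 1 := by nlinarith [norm_nonneg v]
          simp only at this
          nlinarith [sq_nonneg ‖x‖]
        have h3 : (‖x‖ / s) ^ 2 * angMom (x, v) ≤ ‖x‖ ^ 2 := by
          calc (‖x‖ / s) ^ 2 * angMom (x, v) ≤ (‖x‖ / s) ^ 2 * s ^ 2 :=
                mul_le_mul_of_nonneg_left hL (by positivity)
            _ = ‖x‖ ^ 2 := by field_simp
        have h4 : ‖x‖ ^ 2 * ‖stretch (‖x‖ / s) x v‖ ^ 2 ≤ ‖x‖ ^ 2 * 2 := by linarith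
        have h5 := le_of_mul_le_mul_left h4 (by positivity)
        nlinarith [norm_nonneg (stretch (‖x‖ / s) x v)]
      refine (measure_mono hsub).trans ?_
      rw [Measure.addHaar_preimage_linearMap _ (by rw [det_stretch ht.ne' hx]; positivity),
        det_stretch ht.ne' hx, abs_of_pos (by positivity), ← mul_assoc,
        ← ENNReal.ofReal_mul (by positivity)]
      refine le_of_eq ?_
      congr 2
      rw [Real.rpow_neg hxp.le, Real.rpow_two]
      field_simp
    · have hx2 : ‖x‖ ≠ 1 := by simpa using hxs
      have : Prod.mk x ⁻¹' (box 1 1 ∩ {z | angMom z ≤ s ^ 2}) = ∅ := by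
        ext v
        simp only [box, Set.mem_preimage, Set.mem_inter_iff, Set.mem_ofPred_eq,
          Set.mem_empty_iff_false, iff_false]
        rintro ⟨⟨h, -⟩, -⟩
        exact hx1 (lt_of_le_of_ne h hx2)
      rw [this, measure_empty]
      exact zero_le
  refine (lintegral_mono_ae hb).trans ?_
  rw [lintegral_indicator Metric.isOpen_ball.measurableSet,
    lintegral_const_mul _ (by fun_prop), lintegral_mul_const _ (by fun_prop)]

/-- For $l<0$ the box is cut into shells $4^{-(j+1)}<L\le4^{-j}$. The shell $j$ has volume of order
$4^{-j}$ and carries a weight of order $4^{-jl}$, so the series is geometric with ratio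
$4^{-(1+l)}$. This is where $l>-1$ is needed. -/
theorem boxWeight_one_lt_top {l : ℝ} (hl : -1 < l) : boxWeight l 1 1 < ⊤ := by
  rcases le_or_gt 0 l with hl0 | hl0
  · refine lt_of_le_of_lt (lintegral_mono_ae (g := fun _ => 1) ?_) ?_
    · filter_upwards [ae_restrict_mem (measurableSet_box 1 1)] with z hz
      rw [← ENNReal.ofReal_one]
      refine ENNReal.ofReal_le_ofReal (Real.rpow_le_one (angMom_nonneg z) ?_ hl0)
      refine (angMom_le z).trans ?_
      have h1 : ‖z.1‖ ^ 2 ≤ 1 := pow_le_one₀ (norm_nonneg _) hz.1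
      have h2 : ‖z.2‖ ^ 2 ≤ 1 := pow_le_one₀ (norm_nonneg _) hz.2
      exact mul_le_one₀ h1 (by positivity) h2
    · simpa using volume_box_lt_top 1 1
  obtain ⟨C, hC, hvol⟩ := volume_small_angMom
  set E : ℕ → Set Phase := fun j =>
    (box 1 1 ∩ {z | angMom z ≤ ((1 / 2 : ℝ) ^ j) ^ 2}) ∩
      {z | ((1 / 2 : ℝ) ^ (j + 1)) ^ 2 < angMom z}
    with hE
  have hEm : ∀ j, MeasurableSet (E j) := fun j =>
    ((measurableSet_box 1 1).inter (measurableSet_le measurable_angMom measurable_const)).inter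
      (measurableSet_lt measurable_const measurable_angMom)
  have hcover : box 1 1 ≤ᵐ[volume] (⋃ j, E j : Set Phase) := by
    filter_upwards [ae_angMom_pos] with z hz hzb
    have hz1 : angMom z ≤ 1 := by
      refine (angMom_le z).trans ?_
      have h1 : ‖z.1‖ ^ 2 ≤ 1 := pow_le_one₀ (norm_nonneg _) hzb.1
      have h2 : ‖z.2‖ ^ 2 ≤ 1 := pow_le_one₀ (norm_nonneg _) hzb.2
      exact mul_le_one₀ h1 (by positivity) h2
    obtain ⟨j, hj1, hj2⟩ := exists_nat_pow_near_of_lt_one hz hz1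
      (by norm_num : (0 : ℝ) < 1 / 4) (by norm_num)
    refine Set.mem_iUnion.2 ⟨j, ⟨hzb, ?_⟩, ?_⟩
    · simp only [Set.mem_ofPred_eq]
      rw [← pow_mul, mul_comm, pow_mul]
      norm_num at hj2 ⊢
      exact hj2
    · simp only [Set.mem_ofPred_eq]
      rw [← pow_mul, mul_comm, pow_mul]
      norm_num at hj1 ⊢
      exact hj1
  set r : ℝ := (1 / 4 : ℝ) ^ (1 + l) with hr
  have hr1 : r < 1 := Real.rpow_lt_one (by norm_num) (by norm_num) (by linarith)
  have hbound : ∀ j, ∫⁻ z in E j, ENNReal.ofReal (angMom z ^ l) ≤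
      ENNReal.ofReal ((1 / 4 : ℝ) ^ l) * C * ENNReal.ofReal r ^ j := by
    intro j
    have h1 : ∫⁻ z in E j, ENNReal.ofReal (angMom z ^ l) ≤
        ∫⁻ _ in E j, ENNReal.ofReal ((((1 / 2 : ℝ) ^ (j + 1)) ^ 2) ^ l) := by
      refine setLIntegral_mono measurable_const fun z hz => ?_
      refine ENNReal.ofReal_le_ofReal ?_
      exact Real.rpow_le_rpow_of_nonpos (by positivity) (le_of_lt hz.2) hl0.le
    refine h1.trans ?_
    rw [setLIntegral_const]
    have h2 : volume (E j) ≤ ENNReal.ofReal (((1 / 2 : ℝ) ^ j) ^ 2) * C :=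
      (measure_mono Set.inter_subset_left).trans (hvol _ (by positivity))
    refine (mul_le_mul_right h2 _).trans (le_of_eq ?_)
    rw [← ENNReal.ofReal_pow (by positivity), ← mul_assoc, ← ENNReal.ofReal_mul (by positivity),
      mul_right_comm, ← ENNReal.ofReal_mul (by positivity)]
    congr 2
    have h4 : ∀ m : ℕ, ((1 / 2 : ℝ) ^ m) ^ 2 = (1 / 4 : ℝ) ^ m := fun m => by
      rw [← pow_mul, mul_comm, pow_mul]; norm_num
    rw [h4, h4, hr, pow_succ, Real.mul_rpow (by positivity) (by positivity),
      Real.rpow_add (by norm_num), Real.rpow_one, mul_pow, ← Real.rpow_natCast,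
      ← Real.rpow_natCast ((1 / 4 : ℝ) ^ l), ← Real.rpow_mul (by norm_num),
      ← Real.rpow_mul (by norm_num), mul_comm (j : ℝ) l]
    ring
  calc boxWeight l 1 1 ≤ ∫⁻ z in ⋃ j, E j, ENNReal.ofReal (angMom z ^ l) :=
        lintegral_mono' (Measure.restrict_mono' hcover le_rfl) le_rfl
    _ ≤ ∑' j, ∫⁻ z in E j, ENNReal.ofReal (angMom z ^ l) := lintegral_iUnion_le _ _
    _ ≤ ∑' j, ENNReal.ofReal ((1 / 4 : ℝ) ^ l) * C * ENNReal.ofReal r ^ j :=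
        ENNReal.tsum_le_tsum hbound
    _ = ENNReal.ofReal ((1 / 4 : ℝ) ^ l) * C * (1 - ENNReal.ofReal r)⁻¹ := by
        rw [ENNReal.tsum_mul_left, ENNReal.tsum_geometric]
    _ < ⊤ := by
        refine ENNReal.mul_lt_top (ENNReal.mul_lt_top ENNReal.ofReal_lt_top hC) ?_
        rw [ENNReal.inv_lt_top, tsub_pos_iff_lt, ← ENNReal.ofReal_one]
        exact (ENNReal.ofReal_lt_ofReal_iff zero_lt_one).2 hr1

theorem boxWeight_one_pos (l : ℝ) : 0 < boxWeight l 1 1 := by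
  rw [boxWeight, setLIntegral_pos_iff (measurable_angMom.pow_const l).ennreal_ofReal]
  refine (volume_box_pos one_pos one_pos).trans_le (measure_mono_ae ?_)
  filter_upwards [ae_angMom_pos] with z hz hzb
  refine ⟨?_, hzb⟩
  simp only [Function.mem_support, ne_eq, ENNReal.ofReal_eq_zero, not_le]
  positivity

end Boxes

/-! ### Mass bounds, bound on the potential energy, and boundedness of $\mathcal D$ from below. -/

section Functionals

variable {l k₁ k₂ k₃ C₁ C₂ F₀ γ M : ℝ} {Q : ℝ → ℝ} {f : Phase → ℝ}

/-- The mass in the ball of radius `r` as an extended non-negative number. -/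
noncomputable def massIn (f : Phase → ℝ) (r : ℝ) : ℝ≥0∞ :=
  ∫⁻ z in {z : Phase | ‖z.1‖ ≤ r}, ENNReal.ofReal (f z)

theorem measurableSet_norm_fst_le (r : ℝ) : MeasurableSet {z : Phase | ‖z.1‖ ≤ r} :=
  measurableSet_le measurable_fst.norm measurable_const

theorem measurableSet_le_norm_fst (r : ℝ) : MeasurableSet {z : Phase | r ≤ ‖z.1‖} :=
  measurableSet_le measurable_const measurable_fst.norm

theorem massIn_mono (f : Phase → ℝ) : Monotone (massIn f) := fun _ _ h =>
  lintegral_mono_set fun _ hz => le_trans hz h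

theorem massIn_le_lintegral (f : Phase → ℝ) (r : ℝ) :
    massIn f r ≤ ∫⁻ z, ENNReal.ofReal (f z) :=
  setLIntegral_le_lintegral _ _

theorem setIntegral_eq_toReal (hf : Integrable f) (h0 : 0 ≤ᵐ[volume] f) (S : Set Phase) :
    ∫ z in S, f z = (∫⁻ z in S, ENNReal.ofReal (f z)).toReal :=
  integral_eq_lintegral_of_nonneg_ae (ae_restrict_of_ae h0) hf.aestronglyMeasurable.restrict

theorem massFun_eq_setIntegral (hf : Integrable f) (r : ℝ) :
    massFun f r = ∫ z in {z : Phase | ‖z.1‖ ≤ r}, f z := by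
  have hset : {z : Phase | ‖z.1‖ ≤ r} = Metric.closedBall (0 : Space) r ×ˢ Set.univ := by
    ext z; simp
  rw [hset, Measure.volume_eq_prod, setIntegral_prod _ (by
    rw [← Measure.volume_eq_prod]; exact hf.integrableOn)]
  simp [massFun, density]

theorem massFun_eq (hf : Integrable f) (h0 : 0 ≤ᵐ[volume] f) (r : ℝ) :
    massFun f r = (massIn f r).toReal := by
  rw [massFun_eq_setIntegral hf, setIntegral_eq_toReal hf h0, massIn]

theorem lintegral_ofReal_lt_top (hf : Integrable f) :
    ∫⁻ z, ENNReal.ofReal (f z) < ⊤ :=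
  hf.lintegral_lt_top

theorem enorm_gradU_sq (hf : Integrable f) (h0 : 0 ≤ᵐ[volume] f) (x : Space) :
    ‖gradU f x‖ₑ ^ 2 = massIn f ‖x‖ ^ 2 * ENNReal.ofReal ((‖x‖ ^ 4)⁻¹) := by
  have hm : massIn f ‖x‖ ≠ ⊤ :=
    ((massIn_le_lintegral f _).trans_lt (lintegral_ofReal_lt_top hf)).ne
  have h1 : ‖gradU f x‖ ^ 2 = (massFun f ‖x‖) ^ 2 * (‖x‖ ^ 4)⁻¹ := by
    rcases eq_or_ne x 0 with rfl | hx
    · simp [gradU]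
    · have hx' : ‖x‖ ≠ 0 := norm_ne_zero_iff.2 hx
      rw [gradU, norm_smul, norm_smul, Real.norm_eq_abs, norm_inv, norm_norm,
        inv_mul_cancel₀ hx', mul_one, sq_abs]
      field_simp
  rw [← ofReal_norm, ← ENNReal.ofReal_pow (norm_nonneg _), h1,
    ENNReal.ofReal_mul (sq_nonneg _), massFun_eq hf h0, ENNReal.ofReal_pow ENNReal.toReal_nonneg,
    ENNReal.ofReal_toReal hm]

/-- The gravitational energy expressed through the mass function. -/
noncomputable def fieldEnergy (m : ℝ → ℝ≥0∞) : ℝ≥0∞ :=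
  ENNReal.ofReal (1 / (8 * Real.pi)) *
    ∫⁻ x : Space, m ‖x‖ ^ 2 * ENNReal.ofReal ((‖x‖ ^ 4)⁻¹)

theorem negPotentialEnergy_eq (hf : Integrable f) (h0 : 0 ≤ᵐ[volume] f) :
    negPotentialEnergy f = fieldEnergy (massIn f) := by
  rw [negPotentialEnergy, fieldEnergy]
  simp only [enorm_gradU_sq hf h0]

theorem fieldEnergy_mono {m m' : ℝ → ℝ≥0∞} (h : ∀ r, m r ≤ m' r) :
    fieldEnergy m ≤ fieldEnergy m' := by
  unfold fieldEnergy
  gcongr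
  exact h _

/-- A bound $r^b$ is used in the unit ball and the total mass outside it. The right-hand side is
finite exactly when $2b-4>-3$ in the nontrivial case $B\ne0$, so every later application needs
$b>1/2$. -/
theorem fieldEnergy_le {m : ℝ → ℝ≥0∞} {B b N : ℝ}
    (h1 : ∀ r, 0 < r → r < 1 → m r ≤ ENNReal.ofReal (B * r ^ b))
    (h2 : ∀ r, m r ≤ ENNReal.ofReal N) :
    fieldEnergy m ≤ ENNReal.ofReal (1 / (8 * Real.pi)) *
      (ENNReal.ofReal (B ^ 2) *
        (∫⁻ x in Metric.ball (0 : Space) 1, ENNReal.ofReal (‖x‖ ^ (2 * b - 4)))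
        + ENNReal.ofReal (N ^ 2) * tailConst) := by
  unfold fieldEnergy
  refine mul_le_mul_right ?_ _
  have hball : MeasurableSet (Metric.ball (0 : Space) 1) := Metric.isOpen_ball.measurableSet
  rw [← lintegral_add_compl _ hball]
  refine add_le_add ?_ ?_
  · rw [← lintegral_const_mul _ (by fun_prop)]
    refine setLIntegral_mono (by fun_prop) fun x hx => ?_
    rcases eq_or_ne x 0 with rfl | hx0
    · simp
    have hxp : 0 < ‖x‖ := norm_pos_iff.2 hx0
    have hm := h1 ‖x‖ hxp (by simpa using hx)
    calc m ‖x‖ ^ 2 * ENNReal.ofReal ((‖x‖ ^ 4)⁻¹)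
        ≤ ENNReal.ofReal |B * ‖x‖ ^ b| ^ 2 * ENNReal.ofReal ((‖x‖ ^ 4)⁻¹) := by
          gcongr
          exact hm.trans (ENNReal.ofReal_le_ofReal (le_abs_self _))
      _ = ENNReal.ofReal (B ^ 2) * ENNReal.ofReal (‖x‖ ^ (2 * b - 4)) := by
          rw [← ENNReal.ofReal_pow (abs_nonneg _), ← ENNReal.ofReal_mul (by positivity),
            ← ENNReal.ofReal_mul (by positivity), sq_abs]
          congr 1
          rw [Real.rpow_sub hxp, mul_comm 2 b, Real.rpow_mul hxp.le, Real.rpow_two, mul_pow]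
          norm_num
          ring
  · have hcompl : (Metric.ball (0 : Space) 1)ᶜ = {x : Space | 1 ≤ ‖x‖} := by
      ext x; simp
    rw [hcompl, tailConst, ← lintegral_const_mul _ (by fun_prop)]
    refine lintegral_mono fun x => ?_
    gcongr
    calc m ‖x‖ ^ 2 ≤ ENNReal.ofReal |N| ^ 2 := by
          gcongr
          exact (h2 _).trans (ENNReal.ofReal_le_ofReal (le_abs_self _))
      _ = ENNReal.ofReal (N ^ 2) := by
          rw [← ENNReal.ofReal_pow (abs_nonneg _), sq_abs]

/-- The `(1 + 1/k)`-th power of the norm in `L^{k,l}`. -/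
noncomputable def weightedPow (k l : ℝ) (f : Phase → ℝ) : ℝ≥0∞ :=
  ∫⁻ z, ENNReal.ofReal (f z ^ (1 + 1 / k) * angMom z ^ (-l / k))

theorem weightedPow_le (hQ : CasimirAssumptions l k₁ k₂ k₃ C₁ C₂ F₀ Q)
    (hf : Integrable f) (h0 : 0 ≤ᵐ[volume] f) :
    weightedPow k₁ l f ≤ ENNReal.ofReal C₁⁻¹ * casimir Q l f
      + ENNReal.ofReal (F₀ ^ (1 / k₁)) * ∫⁻ z, ENNReal.ofReal (f z) := by
  have hk := hQ.k₁_pos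
  have hC := hQ.C₁_pos
  have hF := hQ.F₀_pos
  rw [casimir, ← lintegral_const_mul' _ _ ENNReal.ofReal_ne_top,
    ← lintegral_const_mul' _ _ ENNReal.ofReal_ne_top,
    ← lintegral_add_right' _ (hf.aemeasurable.ennreal_ofReal.const_mul _)]
  refine lintegral_mono_ae ?_
  filter_upwards [h0, ae_angMom_pos] with z hz hL
  have hz : 0 ≤ f z := hz
  rw [← ENNReal.ofReal_mul (by positivity), ← ENNReal.ofReal_mul (by positivity),
    ← ENNReal.ofReal_add (mul_nonneg (by positivity) (mul_nonneg (hQ.nonneg _ (by positivity))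
      (by positivity))) (by positivity)]
  refine ENNReal.ofReal_le_ofReal ?_
  set L := angMom z
  -- In this case (Q1) says nothing, but then $f^{1+1/k_1}\le F_0^{1/k_1}f$ and the mass term takes
  -- over.
  by_cases hcase : l = 0 ∧ f z < F₀
  · obtain ⟨rfl, hlt⟩ := hcase
    have h1 : f z ^ (1 + 1 / k₁) * L ^ (-0 / k₁) ≤ F₀ ^ (1 / k₁) * f z := by
      rcases hz.eq_or_lt with h | h
      · rw [← h, Real.zero_rpow (by positivity)]; simp
      · simp only [neg_zero, zero_div, Real.rpow_zero, mul_one]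
        rw [Real.rpow_add h, Real.rpow_one, mul_comm]
        gcongr
    have h2 : 0 ≤ C₁⁻¹ * (Q (L ^ (-(0 : ℝ)) * f z) * L ^ (0 : ℝ)) :=
      mul_nonneg (by positivity) (mul_nonneg (hQ.nonneg _ (by positivity)) (by positivity))
    linarith
  · have h1 := hQ.Q1 (L ^ (-l) * f z) (by positivity) (by
      intro hl
      rw [hl, neg_zero, Real.rpow_zero, one_mul]
      by_contra h
      exact hcase ⟨hl, not_le.1 h⟩)
    have h2 : f z ^ (1 + 1 / k₁) * L ^ (-l / k₁) =
        C₁⁻¹ * (C₁ * (L ^ (-l) * f z) ^ (1 + 1 / k₁) * L ^ l) := by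
      rw [Real.mul_rpow (by positivity) hz, ← Real.rpow_mul hL.le]
      have : -l / k₁ = -l * (1 + 1 / k₁) + l := by field_simp; ring
      rw [this, Real.rpow_add hL]
      field_simp
    rw [h2]
    have h3 : 0 ≤ F₀ ^ (1 / k₁) * f z := by positivity
    have h4 : C₁⁻¹ * (C₁ * (L ^ (-l) * f z) ^ (1 + 1 / k₁) * L ^ l) ≤
        C₁⁻¹ * (Q (L ^ (-l) * f z) * L ^ l) := by gcongr
    linarith

/-- Hölder with exponents $1+1/k$ and $k+1$, after writing $f=(fL^{-l/(k+1)})\cdot L^{l/(k+1)}$. -/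
theorem setLIntegral_le_weightedPow {k l : ℝ} (hk : 0 < k) (hf : AEMeasurable f)
    (h0 : 0 ≤ᵐ[volume] f) {S : Set Phase} :
    ∫⁻ z in S, ENNReal.ofReal (f z) ≤ weightedPow k l f ^ (k / (k + 1)) *
      (∫⁻ z in S, ENNReal.ofReal (angMom z ^ l)) ^ (1 / (k + 1)) := by
  have hpq : (1 + 1 / k).HolderConjugate (k + 1) := by
    rw [Real.holderConjugate_iff]
    constructor
    · have : 0 < 1 / k := by positivity
      linarith
    · field_simp
  have hLm : Measurable fun z : Phase => angMom z := measurable_angMom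
  have hmain := ENNReal.lintegral_mul_le_Lp_mul_Lq (volume.restrict S) hpq
    (f := fun z => ENNReal.ofReal (f z * angMom z ^ (-l / (k + 1))))
    (g := fun z => ENNReal.ofReal (angMom z ^ (l / (k + 1))))
    ((hf.mul (hLm.pow_const _).aemeasurable).ennreal_ofReal.restrict)
    ((hLm.pow_const _).ennreal_ofReal.aemeasurable)
  have hae : ∀ᵐ z ∂(volume.restrict S), 0 ≤ f z ∧ 0 < angMom z :=
    ae_restrict_of_ae (h0.and ae_angMom_pos)
  have e1 : ∫⁻ z in S, ENNReal.ofReal (f z) =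
      ∫⁻ z in S, ((fun z => ENNReal.ofReal (f z * angMom z ^ (-l / (k + 1)))) *
        (fun z => ENNReal.ofReal (angMom z ^ (l / (k + 1))))) z := by
    refine lintegral_congr_ae ?_
    filter_upwards [hae] with z ⟨hz, hL⟩
    rw [Pi.mul_apply, ← ENNReal.ofReal_mul (by positivity), mul_assoc, ← Real.rpow_add hL]
    rw [show -l / (k + 1) + l / (k + 1) = 0 by ring, Real.rpow_zero, mul_one]
  have e2 : ∫⁻ z in S, ENNReal.ofReal (f z * angMom z ^ (-l / (k + 1))) ^ (1 + 1 / k) ≤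
      weightedPow k l f := by
    refine le_trans (le_of_eq (lintegral_congr_ae ?_)) (setLIntegral_le_lintegral S _)
    filter_upwards [hae] with z ⟨hz, hL⟩
    rw [ENNReal.ofReal_rpow_of_nonneg (by positivity) (by positivity),
      Real.mul_rpow hz (by positivity), ← Real.rpow_mul hL.le]
    congr 3
    field_simp
  have e3 : ∫⁻ z in S, ENNReal.ofReal (angMom z ^ (l / (k + 1))) ^ (k + 1) =
      ∫⁻ z in S, ENNReal.ofReal (angMom z ^ l) := by
    refine lintegral_congr_ae ?_
    filter_upwards [hae] with z ⟨hz, hL⟩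
    rw [ENNReal.ofReal_rpow_of_nonneg (by positivity) (by positivity), ← Real.rpow_mul hL.le]
    congr 2
    field_simp
  rw [e1]
  refine hmain.trans ?_
  rw [e3, show k / (k + 1) = 1 / (1 + 1 / k) by field_simp]
  gcongr

theorem setLIntegral_high_velocity_le {V : ℝ} (hV : 0 < V) :
    ∫⁻ z in {z : Phase | V < ‖z.2‖}, ENNReal.ofReal (f z) ≤
      ENNReal.ofReal (2 * (V ^ 2)⁻¹) * kineticEnergy f := by
  rw [kineticEnergy, ← mul_assoc, ← ENNReal.ofReal_mul (by positivity),
    ← lintegral_const_mul' _ _ ENNReal.ofReal_ne_top]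
  refine le_trans (setLIntegral_mono_ae' (measurableSet_lt measurable_const measurable_snd.norm)
    (Eventually.of_forall fun z hz => ?_)) (setLIntegral_le_lintegral _ _)
  have hz' : V < ‖z.2‖ := hz
  rw [← ENNReal.ofReal_mul (by positivity)]
  rcases le_total (f z) 0 with h | h
  · rw [ENNReal.ofReal_of_nonpos h]; exact zero_le
  · refine ENNReal.ofReal_le_ofReal ?_
    have h1 : 1 ≤ (V ^ 2)⁻¹ * ‖z.2‖ ^ 2 := by
      rw [inv_mul_eq_div, one_le_div (by positivity)]
      gcongr
    nlinarith

theorem massIn_le_split {k l : ℝ} (hk : 0 < k) (hf : AEMeasurable f)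
    (h0 : 0 ≤ᵐ[volume] f) (r : ℝ) {V : ℝ} (hV : 0 < V) :
    massIn f r ≤ weightedPow k l f ^ (k / (k + 1)) * boxWeight l r V ^ (1 / (k + 1))
      + ENNReal.ofReal (2 * (V ^ 2)⁻¹) * kineticEnergy f := by
  have hsub : {z : Phase | ‖z.1‖ ≤ r} ⊆ box r V ∪ {z : Phase | V < ‖z.2‖} := by
    intro z hz
    rcases le_or_gt ‖z.2‖ V with h | h
    · exact Or.inl ⟨hz, h⟩
    · exact Or.inr h
  calc massIn f r ≤ ∫⁻ z in box r V ∪ {z : Phase | V < ‖z.2‖}, ENNReal.ofReal (f z) :=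
        lintegral_mono_set hsub
    _ ≤ (∫⁻ z in box r V, ENNReal.ofReal (f z)) +
          ∫⁻ z in {z : Phase | V < ‖z.2‖}, ENNReal.ofReal (f z) := lintegral_union_le _ _ _
    _ ≤ _ := add_le_add (setLIntegral_le_weightedPow hk hf h0) (setLIntegral_high_velocity_le hV)

/-- The positive part as a real number, shifted by one. -/
noncomputable def energySize (Q : ℝ → ℝ) (l γ : ℝ) (f : Phase → ℝ) : ℝ :=
  1 + (positivePart Q l γ f).toReal

theorem one_le_energySize : 1 ≤ energySize Q l γ f := by
  unfold energySize
  linarith [ENNReal.toReal_nonneg (a := positivePart Q l γ f)]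

theorem casimir_le_positivePart : casimir Q l f ≤ positivePart Q l γ f := by
  unfold positivePart
  exact le_trans le_add_self le_self_add

theorem kineticEnergy_le_positivePart : kineticEnergy f ≤ positivePart Q l γ f := by
  unfold positivePart
  exact le_add_self

theorem positivePart_le_energySize (h : positivePart Q l γ f < ⊤) :
    positivePart Q l γ f ≤ ENNReal.ofReal (energySize Q l γ f) := by
  rw [← ENNReal.ofReal_toReal h.ne]
  refine ENNReal.ofReal_le_ofReal ?_
  unfold energySize
  linarith

theorem lintegral_eq_of_feasible (hf : f ∈ feasible Q l γ M) :
    ∫⁻ z, ENNReal.ofReal (f z) = ENNReal.ofReal M := by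
  obtain ⟨h1, h2, h3, -⟩ := hf
  rw [← ofReal_integral_eq_lintegral_ofReal h1 h2, h3]

theorem exists_weightedPow_le (hQ : CasimirAssumptions l k₁ k₂ k₃ C₁ C₂ F₀ Q) (hM : 0 ≤ M) :
    ∃ c : ℝ, 0 < c ∧ ∀ (γ : ℝ) (f : Phase → ℝ), f ∈ feasible Q l γ M →
      weightedPow k₁ l f ≤ ENNReal.ofReal (c * energySize Q l γ f) := by
  have hC := hQ.C₁_pos
  have hF := hQ.F₀_pos
  refine ⟨C₁⁻¹ + F₀ ^ (1 / k₁) * M, by positivity, fun γ f hf => ?_⟩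
  have hX := one_le_energySize (Q := Q) (l := l) (γ := γ) (f := f)
  refine (weightedPow_le hQ hf.1 hf.2.1).trans ?_
  rw [lintegral_eq_of_feasible hf]
  calc _ ≤ ENNReal.ofReal C₁⁻¹ * ENNReal.ofReal (energySize Q l γ f)
        + ENNReal.ofReal (F₀ ^ (1 / k₁)) * ENNReal.ofReal M := by
        gcongr
        exact casimir_le_positivePart.trans (positivePart_le_energySize hf.2.2.2.1)
    _ = ENNReal.ofReal (C₁⁻¹ * energySize Q l γ f + F₀ ^ (1 / k₁) * M) := by
        rw [← ENNReal.ofReal_mul (by positivity), ← ENNReal.ofReal_mul (by positivity),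
          ← ENNReal.ofReal_add (by positivity) (by positivity)]
    _ ≤ _ := by
        refine ENNReal.ofReal_le_ofReal ?_
        have : 0 ≤ F₀ ^ (1 / k₁) * M := by positivity
        nlinarith

/-- The velocity cutoff $V$ in `massIn_le_split` is optimized. Write $m=2l+3$ and $N=2k_1+2+m$. The
slow particles contribute $X^{k_1/(k_1+1)}(rV)^{m/(k_1+1)}$ up to a constant, the fast ones
$2XV^{-2}$. -/
theorem exists_massIn_le (hQ : CasimirAssumptions l k₁ k₂ k₃ C₁ C₂ F₀ Q) (hM : 0 ≤ M) :
    ∃ C : ℝ, 0 < C ∧ ∀ (γ : ℝ) (f : Phase → ℝ), f ∈ feasible Q l γ M → ∀ r : ℝ, 0 < r →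
      massIn f r ≤ ENNReal.ofReal (C * energySize Q l γ f ^
        ((2 * k₁ + (2 * l + 3)) / (2 * k₁ + 2 + (2 * l + 3))) *
          r ^ (2 * (2 * l + 3) / (2 * k₁ + 2 + (2 * l + 3)))) := by
  have hk := hQ.k₁_pos
  have hl := hQ.l_gt
  obtain ⟨c, hc, hcf⟩ := exists_weightedPow_le (M := M) hQ hM
  set K : ℝ := (boxWeight l 1 1).toReal with hK
  have hKt : boxWeight l 1 1 ≠ ⊤ := (boxWeight_one_lt_top hl).ne
  set m : ℝ := 2 * l + 3 with hm
  have hmp : 0 < m := by rw [hm]; linarith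
  set N : ℝ := 2 * k₁ + 2 + m with hN
  have hNp : 0 < N := by positivity
  have hK0 : 0 ≤ K := ENNReal.toReal_nonneg
  refine ⟨c ^ (k₁ / (k₁ + 1)) * K ^ (1 / (k₁ + 1)) + 2, by positivity, fun γ f hf r hr => ?_⟩
  set X := energySize Q l γ f with hX
  have hXp : 0 < X := zero_lt_one.trans_le one_le_energySize
  -- This value makes both contributions multiples of $X^{(2k_1+m)/N}r^{2m/N}$. Since $X\ge1$ and
  -- $r>0$, it is positive.
  set V : ℝ := X ^ (1 / N) * r ^ (-m / N) with hV
  have hVp : 0 < V := by positivity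
  have h1 := massIn_le_split (l := l) hk hf.1.aemeasurable hf.2.1 r hVp
  have hrV : (r * V) = X ^ (1 / N) * r ^ ((2 * k₁ + 2) / N) := by
    have h : (2 * k₁ + 2) / N = 1 + -m / N := by field_simp; rw [hN]; ring
    rw [h, Real.rpow_add hr, Real.rpow_one, hV]
    ring
  have hpow : ∀ (a b s : ℝ), (X ^ a * r ^ b) ^ s = X ^ (a * s) * r ^ (b * s) := fun a b s => by
    rw [Real.mul_rpow (by positivity) (by positivity), ← Real.rpow_mul hXp.le,
      ← Real.rpow_mul hr.le]
  refine h1.trans ?_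
  rw [boxWeight_scale l hr hVp]
  calc _ ≤ ENNReal.ofReal (c * X) ^ (k₁ / (k₁ + 1)) *
          (ENNReal.ofReal ((r * V) ^ m) * ENNReal.ofReal K) ^ (1 / (k₁ + 1))
        + ENNReal.ofReal (2 * (V ^ 2)⁻¹) * ENNReal.ofReal X := by
        rw [hK, ENNReal.ofReal_toReal hKt]
        gcongr
        · exact hcf γ f hf
        · exact kineticEnergy_le_positivePart.trans (positivePart_le_energySize hf.2.2.2.1)
    _ = ENNReal.ofReal ((c * X) ^ (k₁ / (k₁ + 1)) * ((r * V) ^ m * K) ^ (1 / (k₁ + 1))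
          + 2 * (V ^ 2)⁻¹ * X) := by
        rw [← ENNReal.ofReal_mul (by positivity),
          ENNReal.ofReal_rpow_of_nonneg (by positivity) (by positivity),
          ENNReal.ofReal_rpow_of_nonneg (by positivity) (by positivity),
          ← ENNReal.ofReal_mul (by positivity), ← ENNReal.ofReal_mul (by positivity),
          ← ENNReal.ofReal_add (by positivity) (by positivity)]
    _ = _ := by
        congr 1
        have e1 : (c * X) ^ (k₁ / (k₁ + 1)) * ((r * V) ^ m * K) ^ (1 / (k₁ + 1)) =
            c ^ (k₁ / (k₁ + 1)) * K ^ (1 / (k₁ + 1)) *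
              (X ^ ((2 * k₁ + m) / N) * r ^ (2 * m / N)) := by
          rw [hrV, hpow, Real.mul_rpow hc.le hXp.le, Real.mul_rpow (by positivity) hK0, hpow]
          have e2 : X ^ ((2 * k₁ + m) / N) =
              X ^ (k₁ / (k₁ + 1)) * X ^ (1 / N * m * (1 / (k₁ + 1))) := by
            rw [← Real.rpow_add hXp]
            congr 1
            field_simp
            rw [hN]; ring
          have e3 : (2 * k₁ + 2) / N * m * (1 / (k₁ + 1)) = 2 * m / N := by
            field_simp
          rw [e2, e3]
          ring
        have e4 : (V ^ 2)⁻¹ * X = X ^ ((2 * k₁ + m) / N) * r ^ (2 * m / N) := by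
          rw [← Real.rpow_two, ← Real.rpow_neg hVp.le, hV, hpow]
          have e5 : X ^ ((2 * k₁ + m) / N) = X ^ (1 / N * (-2)) * X := by
            nth_rewrite 3 [← Real.rpow_one X]
            rw [← Real.rpow_add hXp]
            congr 1
            field_simp
            rw [hN]; ring
          have e6 : -m / N * (-2) = 2 * m / N := by ring
          rw [e5, e6]
          ring
        rw [e1, mul_assoc 2, e4]
        ring

theorem exists_sublinear_bound {τ c : ℝ} (hτ0 : 0 < τ) (hτ : τ < 1) (hc : 0 ≤ c) :
    ∃ C : ℝ, ∀ X : ℝ, 0 < X → c * X ^ τ ≤ X / 2 + C := by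
  set X₀ : ℝ := (2 * c + 1) ^ (1 / (1 - τ)) with hX₀
  have hX₀p : 0 < X₀ := by positivity
  refine ⟨c * X₀ ^ τ, fun X hX => ?_⟩
  rcases le_total X X₀ with h | h
  · have : c * X ^ τ ≤ c * X₀ ^ τ := by gcongr
    linarith
  · have h1 : 2 * c + 1 ≤ X ^ (1 - τ) := by
      calc 2 * c + 1 = X₀ ^ (1 - τ) := by
            rw [hX₀, ← Real.rpow_mul (by positivity), one_div,
              inv_mul_cancel₀ (by linarith), Real.rpow_one]
        _ ≤ X ^ (1 - τ) := Real.rpow_le_rpow hX₀p.le h (by linarith)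
    have h2 : X = X ^ (1 - τ) * X ^ τ := by
      rw [← Real.rpow_add hX]; simp
    have h3 : 0 < X ^ τ := by positivity
    have h4 : 0 ≤ c * X₀ ^ τ := by positivity
    nlinarith

/-- The mass bound alone may give a superlinear power of $\mathcal P$. Interpolating it with $m_f\le
M$ in the form $m_f\le M^{1-\theta}(CX^er^a)^\theta$ lowers the power of $X$, at the price of a
smaller power of $r$. -/
theorem exists_negPotentialEnergy_le (hQ : CasimirAssumptions l k₁ k₂ k₃ C₁ C₂ F₀ Q)
    (hM : 0 < M) :
    ∃ C : ℝ, 0 ≤ C ∧ ∀ (γ : ℝ) (f : Phase → ℝ), f ∈ feasible Q l γ M →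
      negPotentialEnergy f ≤ ENNReal.ofReal ((positivePart Q l γ f).toReal / 2 + C) := by
  have hk := hQ.k₁_pos
  have hl := hQ.l_gt
  have hkl := hQ.k₁_lt
  obtain ⟨C, hC, hmass⟩ := exists_massIn_le (M := M) hQ hM.le
  set m : ℝ := 2 * l + 3 with hm
  have hmp : 0 < m := by rw [hm]; linarith
  set N : ℝ := 2 * k₁ + 2 + m with hN
  have hNp : 0 < N := by positivity
  -- The lower bound gives $2a\theta>1$, the integrability of the field near the origin. The upper
  -- bound gives $2e\theta<1$, so that the energy is sublinear in $X$. The two are compatible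
  -- because $2k_1<m$, which is $k_1<l+3/2$; that $N<4m$ uses in addition $l>-1$.
  obtain ⟨θ, hθ1, hθ2⟩ : ∃ θ, N / (4 * m) < θ ∧ θ < min 1 (N / (2 * (2 * k₁ + m))) := by
    refine exists_between (lt_min ?_ ?_)
    · rw [div_lt_one (by positivity)]
      linarith
    · refine div_lt_div_of_pos_left hNp (by positivity) ?_
      linarith
  have hθ0 : 0 < θ := lt_trans (by positivity) hθ1
  have hθ3 : θ < 1 := hθ2.trans_le (min_le_left _ _)
  have hθ4 : θ < N / (2 * (2 * k₁ + m)) := hθ2.trans_le (min_le_right _ _)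
  set e : ℝ := (2 * k₁ + m) / N with he
  set a : ℝ := 2 * m / N with ha
  have hep : 0 < e := by positivity
  have hτ : 2 * (e * θ) < 1 := by
    rw [lt_div_iff₀ (by positivity)] at hθ4
    rw [he, div_mul_eq_mul_div, ← mul_div_assoc, div_lt_one hNp]
    linarith
  have haθ : 1 < 2 * (a * θ) := by
    rw [div_lt_iff₀ (by positivity)] at hθ1
    rw [ha, div_mul_eq_mul_div, ← mul_div_assoc, one_lt_div hNp]
    linarith
  set I : ℝ≥0∞ := ∫⁻ x in Metric.ball (0 : Space) 1, ENNReal.ofReal (‖x‖ ^ (2 * (a * θ) - 4))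
    with hI
  have hIt : I < ⊤ := lintegral_norm_rpow_lt_top (by linarith)
  set q : ℝ := 1 / (8 * Real.pi) with hq
  have hq0 : 0 < q := by rw [hq]; positivity
  set D : ℝ := M ^ (1 - θ) * C ^ θ with hD
  have hD0 : 0 < D := by positivity
  obtain ⟨C', hC'⟩ := exists_sublinear_bound (τ := 2 * (e * θ)) (c := q * (D ^ 2 * I.toReal))
    (by positivity) hτ (by positivity)
  refine ⟨|1 / 2 + C' + q * (M ^ 2 * tailConst.toReal)|, abs_nonneg _, fun γ f hf => ?_⟩
  set X := energySize Q l γ f with hX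
  have hXp : 0 < X := zero_lt_one.trans_le one_le_energySize
  have hMr : ∀ r, massIn f r ≤ ENNReal.ofReal M := fun r => by
    rw [← lintegral_eq_of_feasible hf]; exact massIn_le_lintegral f r
  have hsmall : ∀ r, 0 < r → r < 1 →
      massIn f r ≤ ENNReal.ofReal (D * X ^ (e * θ) * r ^ (a * θ)) := by
    intro r hr _
    have h1 : massIn f r = massIn f r ^ (1 - θ) * massIn f r ^ θ := by
      rw [← ENNReal.rpow_add_of_nonneg _ _ (by linarith) hθ0.le]
      simp
    rw [h1]
    calc massIn f r ^ (1 - θ) * massIn f r ^ θ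
        ≤ ENNReal.ofReal M ^ (1 - θ) * ENNReal.ofReal (C * X ^ e * r ^ a) ^ θ :=
          mul_le_mul' (ENNReal.rpow_le_rpow (hMr r) (by linarith))
            (ENNReal.rpow_le_rpow (hmass γ f hf r hr) hθ0.le)
      _ = _ := by
          rw [ENNReal.ofReal_rpow_of_nonneg hM.le (by linarith),
            ENNReal.ofReal_rpow_of_nonneg (by positivity) hθ0.le,
            ← ENNReal.ofReal_mul (by positivity), Real.mul_rpow (by positivity) (by positivity),
            Real.mul_rpow hC.le (by positivity), ← Real.rpow_mul hXp.le, ← Real.rpow_mul hr.le,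
            hD]
          congr 1
          ring
  rw [negPotentialEnergy_eq hf.1 hf.2.1]
  refine (fieldEnergy_le hsmall hMr).trans ?_
  rw [← hI, ← ENNReal.ofReal_toReal hIt.ne, ← ENNReal.ofReal_toReal tailConst_lt_top.ne,
    ← ENNReal.ofReal_mul (by positivity), ← ENNReal.ofReal_mul (by positivity),
    ← ENNReal.ofReal_add (by positivity) (by positivity), ← ENNReal.ofReal_mul (by positivity)]
  refine ENNReal.ofReal_le_ofReal ?_
  have h1 := hC' X hXp
  have h2 : (D * X ^ (e * θ)) ^ 2 = D ^ 2 * X ^ (2 * (e * θ)) := by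
    rw [mul_pow, ← Real.rpow_natCast (X ^ (e * θ)), ← Real.rpow_mul hXp.le]
    congr 2
    push_cast; ring
  have h3 : X = 1 + (positivePart Q l γ f).toReal := rfl
  have h4 := le_abs_self (1 / 2 + C' + q * (M ^ 2 * tailConst.toReal))
  rw [h2]
  rw [ENNReal.toReal_ofReal ENNReal.toReal_nonneg]
  nlinarith

theorem negPotentialEnergy_lt_top (hQ : CasimirAssumptions l k₁ k₂ k₃ C₁ C₂ F₀ Q)
    (hM : 0 < M) (hf : f ∈ feasible Q l γ M) : negPotentialEnergy f < ⊤ := by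
  obtain ⟨C, -, h⟩ := exists_negPotentialEnergy_le (M := M) hQ hM
  exact (h γ f hf).trans_lt ENNReal.ofReal_lt_top

theorem energyCasimir_eq_coe (h1 : positivePart Q l γ f < ⊤) (h2 : negPotentialEnergy f < ⊤) :
    energyCasimir Q l γ f =
      (((positivePart Q l γ f).toReal - (negPotentialEnergy f).toReal : ℝ) : EReal) := by
  rw [energyCasimir, EReal.coe_sub, EReal.coe_ennreal_toReal h1.ne, EReal.coe_ennreal_toReal h2.ne]

/-- This serves twice: it bounds the infimum from below, and it bounds $\mathcal P$ along sequences
of bounded energy. -/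
theorem exists_le_energyCasimir (hQ : CasimirAssumptions l k₁ k₂ k₃ C₁ C₂ F₀ Q) (hM : 0 < M) :
    ∃ C : ℝ, 0 ≤ C ∧ ∀ (γ : ℝ) (f : Phase → ℝ), f ∈ feasible Q l γ M →
      (((positivePart Q l γ f).toReal / 2 - C : ℝ) : EReal) ≤ energyCasimir Q l γ f := by
  obtain ⟨C, hC, h⟩ := exists_negPotentialEnergy_le (M := M) hQ hM
  refine ⟨C, hC, fun γ f hf => ?_⟩
  rw [energyCasimir_eq_coe hf.2.2.2.1 (negPotentialEnergy_lt_top hQ hM hf)]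
  have h1 := ENNReal.toReal_mono ENNReal.ofReal_ne_top (h γ f hf)
  rw [ENNReal.toReal_ofReal (by positivity)] at h1
  exact_mod_cast (by linarith : (positivePart Q l γ f).toReal / 2 - C ≤
    (positivePart Q l γ f).toReal - (negPotentialEnergy f).toReal)

theorem bot_lt_infEnergy (hQ : CasimirAssumptions l k₁ k₂ k₃ C₁ C₂ F₀ Q) (hM : 0 < M) (γ : ℝ) :
    ⊥ < infEnergy Q l γ M := by
  obtain ⟨C, -, h⟩ := exists_le_energyCasimir (M := M) hQ hM
  refine (EReal.bot_lt_coe (-C)).trans_le (le_iInf₂ fun f hf => le_trans ?_ (h γ f hf))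
  exact_mod_cast (by linarith [ENNReal.toReal_nonneg (a := positivePart Q l γ f)] :
    -C ≤ (positivePart Q l γ f).toReal / 2 - C)

end Functionals

/-! ### The scaling that preserves $L$, and the comparison of energies at different masses. -/

section Scaling

variable {l k₁ k₂ k₃ C₁ C₂ F₀ γ M : ℝ} {Q : ℝ → ℝ} {f : Phase → ℝ}

theorem lintegral_comp_smul_space {s : ℝ} (hs : 0 < s) {H : Space → ℝ≥0∞} (hH : Measurable H) :
    ∫⁻ x, H (s • x) = ENNReal.ofReal (s ^ 3)⁻¹ * ∫⁻ x, H x := by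
  rw [← lintegral_map (μ := volume) hH (measurable_const_smul s),
    Measure.map_addHaar_smul _ hs.ne', lintegral_smul_measure, abs_of_pos (by positivity),
    finrank_euclideanSpace, Fintype.card_fin, smul_eq_mul]

theorem CasimirAssumptions.map_zero (hQ : CasimirAssumptions l k₁ k₂ k₃ C₁ C₂ F₀ Q) :
    Q 0 = 0 := by
  refine le_antisymm ?_ (hQ.nonneg 0 le_rfl)
  have h := hQ.Q2 0 le_rfl hQ.F₀_pos.le
  have hk := hQ.k₂_pos
  rwa [Real.zero_rpow (by positivity), mul_zero] at h

theorem CasimirAssumptions.continuous_max (hQ : CasimirAssumptions l k₁ k₂ k₃ C₁ C₂ F₀ Q) :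
    Continuous fun y => Q (max y 0) :=
  hQ.contDiffOn_one.continuousOn.comp_continuous (by fun_prop) fun _ =>
    Set.mem_Ici.2 (le_max_right _ _)

theorem aemeasurable_casimir (hQ : CasimirAssumptions l k₁ k₂ k₃ C₁ C₂ F₀ Q)
    (hf : AEMeasurable f) (h0 : 0 ≤ᵐ[volume] f) :
    AEMeasurable fun z => Q (angMom z ^ (-l) * f z) * angMom z ^ l := by
  have h1 : AEMeasurable fun z => Q (max (angMom z ^ (-l) * f z) 0) * angMom z ^ l :=
    (hQ.continuous_max.measurable.comp_aemeasurable
      ((measurable_angMom.pow_const _).aemeasurable.mul hf)).mul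
      (measurable_angMom.pow_const _).aemeasurable
  refine h1.congr ?_
  filter_upwards [h0] with z hz
  rw [max_eq_left (mul_nonneg (Real.rpow_nonneg (angMom_nonneg z) _) hz)]

theorem quasiMeasurePreserving_stretchMap {s t : ℝ} (hs : 0 < s) (ht : 0 < t) :
    Measure.QuasiMeasurePreserving (stretchMap s t) volume volume :=
  ⟨measurable_stretchMap s t, by
    rw [map_stretchMap hs ht]; exact Measure.smul_absolutelyContinuous⟩

theorem lintegral_comp_stretchMap {s t : ℝ} (hs : 0 < s) (ht : 0 < t) {F : Phase → ℝ≥0∞}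
    (hF : AEMeasurable F) :
    ∫⁻ z, F (stretchMap s t z) = ENNReal.ofReal (s ^ 3 * t ^ 2)⁻¹ * ∫⁻ z, F z := by
  rw [← smul_eq_mul, ← lintegral_smul_measure, ← map_stretchMap hs ht, lintegral_map' _
    (measurable_stretchMap s t).aemeasurable]
  rw [map_stretchMap hs ht]
  exact hF.smul_measure _

theorem integrable_comp_stretchMap {s t : ℝ} (hs : 0 < s) (ht : 0 < t) (hf : Integrable f) :
    Integrable fun z => f (stretchMap s t z) := by
  have h : Integrable f (Measure.map (stretchMap s t) volume) := by
    rw [map_stretchMap hs ht]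
    exact hf.smul_measure ENNReal.ofReal_ne_top
  exact h.comp_measurable (measurable_stretchMap s t)

theorem massIn_comp_stretchMap {s t : ℝ} (hs : 0 < s) (ht : 0 < t) (hf : Integrable f) (r : ℝ) :
    massIn (fun z => f (stretchMap s t z)) r
      = ENNReal.ofReal (s ^ 3 * t ^ 2)⁻¹ * massIn f (s * r) := by
  have hm : AEMeasurable ({z : Phase | ‖z.1‖ ≤ s * r}.indicator fun z => ENNReal.ofReal (f z)) :=
    hf.aemeasurable.ennreal_ofReal.indicator (measurableSet_norm_fst_le _)
  rw [massIn, massIn, ← lintegral_indicator (measurableSet_norm_fst_le _),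
    ← lintegral_indicator (measurableSet_norm_fst_le _), ← lintegral_comp_stretchMap hs ht hm]
  refine lintegral_congr fun z => ?_
  have hiff : stretchMap s t z ∈ {z : Phase | ‖z.1‖ ≤ s * r} ↔ z ∈ {z : Phase | ‖z.1‖ ≤ r} := by
    simp only [stretchMap, Set.mem_ofPred_eq, norm_smul, Real.norm_of_nonneg hs.le]
    exact mul_le_mul_iff_right₀ hs
  by_cases hz : z ∈ {z : Phase | ‖z.1‖ ≤ r}
  · rw [Set.indicator_of_mem hz, Set.indicator_of_mem (hiff.2 hz)]
  · rw [Set.indicator_of_notMem hz, Set.indicator_of_notMem fun h => hz (hiff.1 h)]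

/-- With $y=sx$, the factor $|x|^{-4}$ yields $s^4$ and the volume $s^{-3}$. -/
theorem fieldEnergy_scale {m : ℝ → ℝ≥0∞} (hm : Measurable m) {s : ℝ} (hs : 0 < s) (c : ℝ)
    (hc : 0 ≤ c) :
    fieldEnergy (fun r => ENNReal.ofReal c * m (s * r))
      = ENNReal.ofReal (c ^ 2 * s) * fieldEnergy m := by
  unfold fieldEnergy
  have hH : Measurable fun x : Space => m ‖x‖ ^ 2 * ENNReal.ofReal ((‖x‖ ^ 4)⁻¹) :=
    ((hm.comp measurable_norm).pow_const 2).mul (by fun_prop)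
  have h1 : ∀ x : Space, (ENNReal.ofReal c * m (s * ‖x‖)) ^ 2 * ENNReal.ofReal ((‖x‖ ^ 4)⁻¹)
      = ENNReal.ofReal (c ^ 2 * s ^ 4) *
        (m ‖s • x‖ ^ 2 * ENNReal.ofReal ((‖s • x‖ ^ 4)⁻¹)) := by
    intro x
    rw [norm_smul, Real.norm_of_nonneg hs.le, mul_pow, ← ENNReal.ofReal_pow hc, mul_pow s, mul_inv,
      ENNReal.ofReal_mul (by positivity : 0 ≤ (s ^ 4)⁻¹),
      ENNReal.ofReal_mul (by positivity : 0 ≤ c ^ 2)]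
    have h2 : ENNReal.ofReal (s ^ 4) * ENNReal.ofReal ((s ^ 4)⁻¹) = 1 := by
      rw [← ENNReal.ofReal_mul (by positivity), mul_inv_cancel₀ (by positivity),
        ENNReal.ofReal_one]
    calc _ = ENNReal.ofReal (c ^ 2) * m (s * ‖x‖) ^ 2 * ENNReal.ofReal ((‖x‖ ^ 4)⁻¹) *
          (ENNReal.ofReal (s ^ 4) * ENNReal.ofReal ((s ^ 4)⁻¹)) := by rw [h2, mul_one]
      _ = _ := by ring
  simp only [h1]
  rw [lintegral_const_mul' _ _ ENNReal.ofReal_ne_top,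
    lintegral_comp_smul_space (H := fun x => m ‖x‖ ^ 2 * ENNReal.ofReal ((‖x‖ ^ 4)⁻¹)) hs hH,
    ← mul_assoc (ENNReal.ofReal (c ^ 2 * s ^ 4)), ← ENNReal.ofReal_mul (by positivity),
    mul_left_comm]
  congr 2
  field_simp

/-- Data of an element of `F_m`, without the normalisation of the mass. -/
structure Admissible (Q : ℝ → ℝ) (l γ : ℝ) (f : Phase → ℝ) : Prop where
  integrable : Integrable f
  nonneg : 0 ≤ᵐ[volume] f
  finite : positivePart Q l γ f < ⊤
  symm : ∃ g : Phase → ℝ, SphericallySymmetric g ∧ g =ᵐ[volume] f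

theorem admissible_of_feasible (hf : f ∈ feasible Q l γ M) : Admissible Q l γ f :=
  ⟨hf.1, hf.2.1, hf.2.2.2.1, hf.2.2.2.2⟩

/-- Since $L$ is preserved, the first two terms change only by the Jacobian factor $\sigma^{-1}$.
For $\sigma\le1$ the tangential velocity is enlarged by the map, so the kinetic energy of the
composition is at most $\sigma^{-1}$ times the original one. -/
theorem stretched_positivePart_le (hQ : CasimirAssumptions l k₁ k₂ k₃ C₁ C₂ F₀ Q)
    (hf : Integrable f) (h0 : 0 ≤ᵐ[volume] f) {σ : ℝ} (hσ : 0 < σ) (hσ1 : σ ≤ 1) :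
    positivePart Q l γ (fun z => f (stretchMap σ σ⁻¹ z))
      ≤ ENNReal.ofReal σ⁻¹ * positivePart Q l γ f := by
  have hσi : 0 < σ⁻¹ := inv_pos.2 hσ
  have hcomp : ∀ {F : Phase → ℝ≥0∞}, AEMeasurable F →
      ∫⁻ z, F (stretchMap σ σ⁻¹ z) = ENNReal.ofReal σ⁻¹ * ∫⁻ z, F z := fun hF => by
    rw [lintegral_comp_stretchMap hσ hσi hF]
    congr 2
    field_simp
  have hL : ∀ᵐ z : Phase, angMom (stretchMap σ σ⁻¹ z) = angMom z := by
    filter_upwards [ae_fst_ne_zero] with z hz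
    rw [stretchMap, angMom_stretch hσi.ne' hz, mul_inv_cancel₀ hσ.ne', one_pow, one_mul]
  have hv : ∀ᵐ z : Phase, ‖z.2‖ ^ 2 ≤ ‖(stretchMap σ σ⁻¹ z).2‖ ^ 2 := by
    filter_upwards [ae_fst_ne_zero] with z hz
    have hz' : 0 < ‖z.1‖ := norm_pos_iff.2 hz
    have h1 := norm_sq_stretch hσi.ne' hz z.2
    have h2 : (1 : ℝ) ≤ σ⁻¹ ^ 2 := one_le_pow₀ ((one_le_inv₀ hσ).2 hσ1)
    have h3 : ‖z.1‖ ^ 2 * ‖z.2‖ ^ 2 ≤ ‖z.1‖ ^ 2 * ‖stretch σ⁻¹ z.1 z.2‖ ^ 2 := by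
      rw [h1]
      have h4 := angMom_nonneg z
      have h5 : ‖z.1‖ ^ 2 * ‖z.2‖ ^ 2 = angMom z + (inner ℝ z.1 z.2) ^ 2 := by
        unfold angMom; ring
      have h6 : angMom (z.1, z.2) = angMom z := rfl
      rw [h5, h6]
      nlinarith
    exact le_of_mul_le_mul_left h3 (by positivity)
  have hf0 : ∀ᵐ z : Phase, 0 ≤ f (stretchMap σ σ⁻¹ z) :=
    (quasiMeasurePreserving_stretchMap hσ hσi).ae h0
  have e1 : ∫⁻ z, ENNReal.ofReal (angMom z * f (stretchMap σ σ⁻¹ z)) =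
      ENNReal.ofReal σ⁻¹ * ∫⁻ z, ENNReal.ofReal (angMom z * f z) := by
    rw [← hcomp
      (F := fun z => ENNReal.ofReal (angMom z * f z))
      (measurable_angMom.aemeasurable.mul hf.aemeasurable).ennreal_ofReal]
    refine lintegral_congr_ae ?_
    filter_upwards [hL] with z hz
    rw [hz]
  have e2 : casimir Q l (fun z => f (stretchMap σ σ⁻¹ z)) =
      ENNReal.ofReal σ⁻¹ * casimir Q l f := by
    rw [casimir, casimir, ← hcomp
      (aemeasurable_casimir hQ hf.aemeasurable h0).ennreal_ofReal]
    refine lintegral_congr_ae ?_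
    filter_upwards [hL] with z hz
    rw [hz]
  have e3 : kineticEnergy (fun z => f (stretchMap σ σ⁻¹ z)) ≤
      ENNReal.ofReal σ⁻¹ * kineticEnergy f := by
    rw [kineticEnergy, kineticEnergy, mul_left_comm]
    refine mul_le_mul_right ?_ _
    have hmeas : AEMeasurable fun z : Phase => ENNReal.ofReal (‖z.2‖ ^ 2 * f z) :=
      ((measurable_snd.norm.pow_const 2).aemeasurable.mul hf.aemeasurable).ennreal_ofReal
    rw [← hcomp hmeas]
    refine lintegral_mono_ae ?_
    filter_upwards [hv, hf0] with z hz hz0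
    exact ENNReal.ofReal_le_ofReal (mul_le_mul_of_nonneg_right hz hz0)
  unfold positivePart
  rw [e1, e2, mul_add, mul_add, mul_left_comm]
  gcongr

/-- The composition with the stretch has mass $\sigma^{-1}\cdot\sigma M=M$. Its mass function is
$\sigma^{-1}m_f(\sigma r)$, so its potential energy is exactly $\sigma^{-1}$ times that of $f$. Its
energy is therefore at most $\sigma^{-1}\mathcal D(f)$, and at least $\mathcal D_M$. -/
theorem infEnergy_le_scaled (hQ : CasimirAssumptions l k₁ k₂ k₃ C₁ C₂ F₀ Q) (hM : 0 < M)
    (hf : Admissible Q l γ f) {σ d : ℝ} (hσ : 0 < σ) (hσ1 : σ ≤ 1)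
    (hmass : ∫ z, f z = σ * M) (hd : (d : EReal) ≤ infEnergy Q l γ M) :
    σ * d ≤ (positivePart Q l γ f).toReal - (negPotentialEnergy f).toReal := by
  have hσi : 0 < σ⁻¹ := inv_pos.2 hσ
  have hconst : (σ ^ 3 * σ⁻¹ ^ 2)⁻¹ = σ⁻¹ := by field_simp
  set g : Phase → ℝ := fun z => f (stretchMap σ σ⁻¹ z) with hg
  have hqmp := quasiMeasurePreserving_stretchMap hσ hσi
  have hP := stretched_positivePart_le (γ := γ) hQ hf.integrable hf.nonneg hσ hσ1
  have hPt : ENNReal.ofReal σ⁻¹ * positivePart Q l γ f < ⊤ :=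
    ENNReal.mul_lt_top ENNReal.ofReal_lt_top hf.finite
  have hgi : Integrable g := integrable_comp_stretchMap hσ hσi hf.integrable
  have hg0 : 0 ≤ᵐ[volume] g := hqmp.ae hf.nonneg
  have hgm : ∫ z, g z = M := by
    rw [integral_eq_lintegral_of_nonneg_ae hg0 hgi.aestronglyMeasurable,
      lintegral_comp_stretchMap hσ hσi (F := fun z => ENNReal.ofReal (f z))
        hf.integrable.aemeasurable.ennreal_ofReal, ENNReal.toReal_mul,
      ← integral_eq_lintegral_of_nonneg_ae hf.nonneg hf.integrable.aestronglyMeasurable, hmass,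
      hconst, ENNReal.toReal_ofReal hσi.le]
    field_simp
  have hgf : g ∈ feasible Q l γ M := by
    refine ⟨hgi, hg0, hgm, hP.trans_lt hPt, ?_⟩
    obtain ⟨u, hu, huf⟩ := hf.symm
    refine ⟨fun z => u (stretchMap σ σ⁻¹ z), fun A hA x v => ?_, hqmp.ae huf⟩
    simp only [stretchMap, stretch_isometry]
    rw [← map_smul A, hu A hA]
  have hpot : negPotentialEnergy g = ENNReal.ofReal σ⁻¹ * negPotentialEnergy f := by
    rw [negPotentialEnergy_eq hgi hg0, negPotentialEnergy_eq hf.integrable hf.nonneg]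
    have : massIn g = fun r => ENNReal.ofReal σ⁻¹ * massIn f (σ * r) := by
      ext r
      rw [hg, massIn_comp_stretchMap hσ hσi hf.integrable, hconst]
    rw [this, fieldEnergy_scale (massIn_mono f).measurable hσ _ hσi.le]
    congr 2
    field_simp
  have hpt := negPotentialEnergy_lt_top hQ hM hgf
  have h1 : (d : EReal) ≤ energyCasimir Q l γ g := hd.trans (iInf₂_le g hgf)
  rw [energyCasimir_eq_coe hgf.2.2.2.1 hpt, EReal.coe_le_coe_iff] at h1
  have h2 := ENNReal.toReal_mono hPt.ne hP
  rw [ENNReal.toReal_mul, ENNReal.toReal_ofReal hσi.le] at h2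
  rw [hpot, ENNReal.toReal_mul, ENNReal.toReal_ofReal hσi.le] at h1
  have h3 : d ≤ σ⁻¹ * ((positivePart Q l γ f).toReal - (negPotentialEnergy f).toReal) := by
    linarith
  calc σ * d ≤ σ * (σ⁻¹ * ((positivePart Q l γ f).toReal - (negPotentialEnergy f).toReal)) :=
        mul_le_mul_of_nonneg_left h3 hσ.le
    _ = _ := by field_simp

end Scaling

/-! ### Cutting off the outer mass, and existence of a concentration radius. -/

section Splitting

variable {l k₁ k₂ k₃ C₁ C₂ F₀ γ M : ℝ} {Q : ℝ → ℝ} {f : Phase → ℝ}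

/-- The restriction of `f` to `{|x| < R}`. -/
noncomputable def cutoff (R : ℝ) (f : Phase → ℝ) : Phase → ℝ := {z : Phase | R ≤ ‖z.1‖}ᶜ.indicator f

theorem cutoff_eq_or (R : ℝ) (f : Phase → ℝ) (z : Phase) :
    cutoff R f z = f z ∨ cutoff R f z = 0 := by
  unfold cutoff
  by_cases hz : z ∈ {z : Phase | R ≤ ‖z.1‖}ᶜ
  · exact Or.inl (Set.indicator_of_mem hz _)
  · exact Or.inr (Set.indicator_of_notMem hz _)

theorem positivePart_cutoff_le (hQ : CasimirAssumptions l k₁ k₂ k₃ C₁ C₂ F₀ Q) (R : ℝ) :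
    positivePart Q l γ (cutoff R f) ≤ positivePart Q l γ f := by
  unfold positivePart casimir kineticEnergy
  gcongr ENNReal.ofReal γ * ?_ + ?_ + ENNReal.ofReal (1 / 2) * ?_
  all_goals
    refine lintegral_mono fun z => ?_
    rcases cutoff_eq_or R f z with h | h <;> simp [h, hQ.map_zero]

theorem Admissible.cutoff (hQ : CasimirAssumptions l k₁ k₂ k₃ C₁ C₂ F₀ Q)
    (hf : Admissible Q l γ f) (R : ℝ) : Admissible Q l γ (cutoff R f) := by
  refine ⟨hf.integrable.indicator (measurableSet_le_norm_fst R).compl, ?_,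
    (positivePart_cutoff_le hQ R).trans_lt hf.finite, ?_⟩
  · filter_upwards [hf.nonneg] with z hz
    rcases cutoff_eq_or R f z with h | h
    · rw [h]; exact hz
    · rw [h]; rfl
  · obtain ⟨g, hg, hgf⟩ := hf.symm
    refine ⟨VlasovPoisson.cutoff R g, fun A hA x v => ?_, ?_⟩
    · simp only [VlasovPoisson.cutoff, Set.indicator, Set.mem_compl_iff, Set.mem_ofPred_eq,
        A.norm_map, hg A hA]
    · filter_upwards [hgf] with z hz
      simp only [VlasovPoisson.cutoff]
      by_cases h : z ∈ {z : Phase | R ≤ ‖z.1‖}ᶜ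
      · rw [Set.indicator_of_mem h, Set.indicator_of_mem h, hz]
      · rw [Set.indicator_of_notMem h, Set.indicator_of_notMem h]

theorem massIn_cutoff_of_lt {R r : ℝ} (h : r < R) : massIn (cutoff R f) r = massIn f r := by
  refine setLIntegral_congr_fun (measurableSet_norm_fst_le r) fun z hz => ?_
  have hz' : ‖z.1‖ ≤ r := hz
  have : z ∈ {z : Phase | R ≤ ‖z.1‖}ᶜ := fun h2 => absurd (lt_of_lt_of_le h h2) (not_lt.2 hz')
  simp only [cutoff, Set.indicator_of_mem this]

theorem lintegral_cutoff (f : Phase → ℝ) (R : ℝ) :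
    ∫⁻ z, ENNReal.ofReal (cutoff R f z) =
      ∫⁻ z in {z : Phase | R ≤ ‖z.1‖}ᶜ, ENNReal.ofReal (f z) := by
  rw [← lintegral_indicator (measurableSet_le_norm_fst R).compl]
  refine lintegral_congr fun z => ?_
  by_cases hz : z ∈ {z : Phase | R ≤ ‖z.1‖}ᶜ
  · simp only [cutoff, Set.indicator_of_mem hz]
  · simp only [cutoff, Set.indicator_of_notMem hz, ENNReal.ofReal_zero]

theorem massIn_cutoff_of_le {R r : ℝ} (h : R ≤ r) :
    massIn (cutoff R f) r = ∫⁻ z, ENNReal.ofReal (cutoff R f z) := by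
  rw [massIn, ← lintegral_indicator (measurableSet_norm_fst_le r)]
  refine lintegral_congr fun z => ?_
  by_cases hz : z ∈ {z : Phase | ‖z.1‖ ≤ r}
  · rw [Set.indicator_of_mem hz]
  · rw [Set.indicator_of_notMem hz]
    have hz' : z ∉ {z : Phase | R ≤ ‖z.1‖}ᶜ := fun h2 => h2 (h.trans (le_of_lt (not_le.1 hz)))
    simp only [cutoff, Set.indicator_of_notMem hz', ENNReal.ofReal_zero]

theorem lintegral_cutoff_add (f : Phase → ℝ) (R : ℝ) :
    (∫⁻ z, ENNReal.ofReal (cutoff R f z)) + ∫⁻ z in {z : Phase | R ≤ ‖z.1‖}, ENNReal.ofReal (f z)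
      = ∫⁻ z, ENNReal.ofReal (f z) := by
  rw [lintegral_cutoff, add_comm, lintegral_add_compl _ (measurableSet_le_norm_fst R)]

/-- Inside radius $R$ the two mass functions agree. Outside, the cutoff has constant mass
$a=T-\lambda$, and $T^2-a^2\le2T\lambda$ is integrated against $|x|^{-4}$. The error is thus linear
in $\lambda$ with a factor $1/R$. -/
theorem fieldEnergy_le_cutoff {R : ℝ} (hR : 0 < R) :
    fieldEnergy (massIn f) ≤ fieldEnergy (massIn (cutoff R f)) +
      ENNReal.ofReal (1 / (8 * Real.pi)) * (2 * (∫⁻ z, ENNReal.ofReal (f z)) *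
        (∫⁻ z in {z : Phase | R ≤ ‖z.1‖}, ENNReal.ofReal (f z)) *
          (ENNReal.ofReal R⁻¹ * tailConst)) := by
  set T := ∫⁻ z, ENNReal.ofReal (f z)
  set lam := ∫⁻ z in {z : Phase | R ≤ ‖z.1‖}, ENNReal.ofReal (f z) with hlam
  unfold fieldEnergy
  rw [← mul_add]
  refine mul_le_mul_right ?_ _
  have hset : MeasurableSet {x : Space | R ≤ ‖x‖} := measurableSet_le measurable_const
    measurable_norm
  rw [← lintegral_tail hR, ← lintegral_indicator hset, ← lintegral_const_mul _
    (Measurable.indicator (by fun_prop) hset), ← lintegral_add_right _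
    ((Measurable.indicator (by fun_prop) hset).const_mul _)]
  refine lintegral_mono fun x => ?_
  rcases lt_or_ge ‖x‖ R with hx | hx
  · rw [massIn_cutoff_of_lt hx]
    exact le_self_add
  · rw [Set.indicator_of_mem (by exact hx), ← add_mul]
    gcongr
    rw [massIn_cutoff_of_le hx]
    set a := ∫⁻ z, ENNReal.ofReal (cutoff R f z)
    have hsum : a + lam = T := lintegral_cutoff_add f R
    calc massIn f ‖x‖ ^ 2 ≤ T ^ 2 := by
          gcongr; exact massIn_le_lintegral f _
      _ = a ^ 2 + (2 * a + lam) * lam := by rw [← hsum]; ring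
      _ ≤ a ^ 2 + 2 * T * lam := by
          gcongr
          rw [← hsum, mul_add]
          gcongr
          rw [two_mul]
          exact le_self_add

/-- The outer part contributes a nonnegative amount to $\mathcal P$ and is dropped; the inner part
has mass $M-\lambda$, to which the scaling inequality applies with $\sigma=1-\lambda/M$. -/
theorem energyCasimir_ge_of_split (hQ : CasimirAssumptions l k₁ k₂ k₃ C₁ C₂ F₀ Q) (hM : 0 < M)
    (hf : f ∈ feasible Q l γ M) {d R : ℝ} (hR : 0 < R) (hd : (d : EReal) ≤ infEnergy Q l γ M) :
    (1 - (∫ z in {z : Phase | R ≤ ‖z.1‖}, f z) / M) * d -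
      (1 / (8 * Real.pi) * (2 * M * tailConst.toReal)) *
        (∫ z in {z : Phase | R ≤ ‖z.1‖}, f z) / R
      ≤ (positivePart Q l γ f).toReal - (negPotentialEnergy f).toReal := by
  have hadm := admissible_of_feasible hf
  have hadm1 := hadm.cutoff hQ R
  set f₁ := cutoff R f with hf₁
  set lam : ℝ := ∫ z in {z : Phase | R ≤ ‖z.1‖}, f z with hlam
  have hlamE : ∫⁻ z in {z : Phase | R ≤ ‖z.1‖}, ENNReal.ofReal (f z) = ENNReal.ofReal lam := by
    rw [hlam, setIntegral_eq_toReal hf.1 hf.2.1, ENNReal.ofReal_toReal]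
    exact ((setLIntegral_le_lintegral _ _).trans_lt (lintegral_ofReal_lt_top hf.1)).ne
  have hlam0 : 0 ≤ lam := by
    rw [hlam, setIntegral_eq_toReal hf.1 hf.2.1]; exact ENNReal.toReal_nonneg
  have hmass1 : ∫ z, f₁ z = M - lam := by
    have h := integral_add_compl (measurableSet_le_norm_fst R) hf.1
    rw [hf.2.2.1] at h
    rw [hf₁]
    unfold cutoff
    rw [integral_indicator (measurableSet_le_norm_fst R).compl]
    linarith
  have hmass1' : 0 ≤ M - lam := by
    rw [← hmass1]; exact integral_nonneg_of_ae hadm1.nonneg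
  have hpot := fieldEnergy_le_cutoff (f := f) hR
  rw [← negPotentialEnergy_eq hf.1 hf.2.1, ← negPotentialEnergy_eq hadm1.integrable hadm1.nonneg,
    lintegral_eq_of_feasible hf, hlamE, ← ENNReal.ofReal_toReal tailConst_lt_top.ne] at hpot
  have hpot1 : negPotentialEnergy f₁ < ⊤ := by
    refine lt_of_le_of_lt ?_ (negPotentialEnergy_lt_top hQ hM hf)
    rw [negPotentialEnergy_eq hf.1 hf.2.1, negPotentialEnergy_eq hadm1.integrable hadm1.nonneg]
    refine fieldEnergy_mono fun r => setLIntegral_mono_ae' (measurableSet_norm_fst_le r) ?_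
    filter_upwards [hf.2.1] with z hz _
    refine ENNReal.ofReal_le_ofReal ?_
    rcases cutoff_eq_or R f z with h | h
    · rw [hf₁, h]
    · rw [hf₁, h]; exact hz
  have h2 : (2 : ℝ≥0∞) = ENNReal.ofReal 2 := by simp
  have hM' := hM.le
  have hpotR : (negPotentialEnergy f).toReal ≤ (negPotentialEnergy f₁).toReal +
      1 / (8 * Real.pi) * (2 * M * lam * (R⁻¹ * tailConst.toReal)) := by
    rw [h2, ← ENNReal.ofReal_mul (by positivity), ← ENNReal.ofReal_mul (by positivity),
      ← ENNReal.ofReal_mul (by positivity), ← ENNReal.ofReal_mul (by positivity),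
      ← ENNReal.ofReal_mul (by positivity)] at hpot
    have h3 := ENNReal.toReal_mono (ENNReal.add_lt_top.2 ⟨hpot1, ENNReal.ofReal_lt_top⟩).ne hpot
    rwa [ENNReal.toReal_add hpot1.ne ENNReal.ofReal_ne_top,
      ENNReal.toReal_ofReal (by positivity)] at h3
  have hP : (positivePart Q l γ f₁).toReal ≤ (positivePart Q l γ f).toReal :=
    ENNReal.toReal_mono hadm.finite.ne (positivePart_cutoff_le hQ R)
  have hmain : (1 - lam / M) * d ≤
      (positivePart Q l γ f₁).toReal - (negPotentialEnergy f₁).toReal := by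
    -- If all the mass lies outside, then $\sigma=0$ and no rescaling is available; the inner part
    -- then vanishes almost everywhere and has no potential energy.
    rcases hmass1'.eq_or_lt with h | h
    · have hz : 1 - lam / M = 0 := by
        rw [show lam = M by linarith, div_self hM.ne', sub_self]
      have hpz : negPotentialEnergy f₁ = 0 := by
        rw [negPotentialEnergy_eq hadm1.integrable hadm1.nonneg]
        have hz2 : ∀ r, massIn f₁ r = 0 := fun r => by
          refine le_antisymm ((massIn_le_lintegral _ _).trans ?_) zero_le
          rw [← ofReal_integral_eq_lintegral_ofReal hadm1.integrable hadm1.nonneg, hmass1, ← h]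
          simp
        simp [fieldEnergy, hz2]
      rw [hz, hpz]
      simp
    · refine infEnergy_le_scaled hQ hM hadm1 ?_ ?_ ?_ hd
      · rw [sub_pos, div_lt_one hM]; linarith
      · have : 0 ≤ lam / M := by positivity
        linarith
      · rw [hmass1]; field_simp
  have e : 1 / (8 * Real.pi) * (2 * M * tailConst.toReal) * lam / R =
      1 / (8 * Real.pi) * (2 * M * lam * (R⁻¹ * tailConst.toReal)) := by
    field_simp
  rw [e]
  linarith

theorem exists_coe_infEnergy (hQ : CasimirAssumptions l k₁ k₂ k₃ C₁ C₂ F₀ Q) (hM : 0 < M)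
    (h : infEnergy Q l γ M < 0) : ∃ d : ℝ, d < 0 ∧ infEnergy Q l γ M = d := by
  have h1 := bot_lt_infEnergy hQ hM γ
  lift infEnergy Q l γ M to ℝ using ⟨(h.trans (by simp)).ne, h1.ne'⟩ with d
  exact ⟨d, by exact_mod_cast h, rfl⟩

theorem tendsto_energy_of_isMinimizingSeq (hQ : CasimirAssumptions l k₁ k₂ k₃ C₁ C₂ F₀ Q)
    (hM : 0 < M) {d : ℝ} (hd : infEnergy Q l γ M = d) {f : ℕ → Phase → ℝ}
    (hf : IsMinimizingSeq Q l γ M f) :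
    Tendsto (fun n => (positivePart Q l γ (f n)).toReal - (negPotentialEnergy (f n)).toReal)
      atTop (𝓝 d) := by
  have h := hf.2
  rw [hd] at h
  refine EReal.tendsto_coe.1 (h.congr fun n => ?_)
  exact energyCasimir_eq_coe (hf.1 n).2.2.2.1 (negPotentialEnergy_lt_top hQ hM (hf.1 n))

/-- For $R'>2cM/(-\mathcal D_M)$ the interaction term $c\lambda/R'$ is at most half of the gain
$\lambda(-\mathcal D_M)/M$. The other half bounds $\lambda$ by a multiple of $\mathcal
D(f_n)-\mathcal D_M$, which tends to zero. -/
theorem exists_isConcentrationRadius (hQ : CasimirAssumptions l k₁ k₂ k₃ C₁ C₂ F₀ Q)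
    (hM : 0 < M) (h : infEnergy Q l γ M < 0) : ∃ R, IsConcentrationRadius Q l γ M R := by
  obtain ⟨d, hd0, hd⟩ := exists_coe_infEnergy hQ hM h
  set c : ℝ := 1 / (8 * Real.pi) * (2 * M * tailConst.toReal) with hc
  have ht : 0 < tailConst.toReal := ENNReal.toReal_pos tailConst_pos.ne' tailConst_lt_top.ne
  have hc0 : 0 < c := by rw [hc]; positivity
  have hd' : 0 < -d := by linarith
  refine ⟨2 * c * M / (-d), by positivity, fun f hf R' hR' => ?_⟩
  have hR'0 : 0 < R' := lt_trans (by positivity) hR'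
  set lam : ℕ → ℝ := fun n => ∫ z in {z : Phase | R' ≤ ‖z.1‖}, f n z with hlam
  set E : ℕ → ℝ := fun n =>
    (positivePart Q l γ (f n)).toReal - (negPotentialEnergy (f n)).toReal with hE
  have hlam0 : ∀ n, 0 ≤ lam n := fun n => by
    simp only [hlam]
    rw [setIntegral_eq_toReal (hf.1 n).1 (hf.1 n).2.1]
    exact ENNReal.toReal_nonneg
  have hle : ∀ n, lam n ≤ 2 * M / (-d) * (E n - d) := by
    intro n
    have h1 := energyCasimir_ge_of_split hQ hM (hf.1 n) hR'0 hd.ge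
    change (1 - lam n / M) * d - c * lam n / R' ≤ E n at h1
    have h2 : c / R' ≤ -d / (2 * M) := by
      rw [div_lt_iff₀ hd'] at hR'
      rw [div_le_div_iff₀ hR'0 (by positivity)]
      linarith
    have h3 : lam n * (-d / (2 * M)) ≤ E n - d := by
      have h4 : c * lam n / R' ≤ lam n * (-d / (2 * M)) := by
        rw [mul_comm c, mul_div_assoc]
        exact mul_le_mul_of_nonneg_left h2 (hlam0 n)
      have h5 : (1 - lam n / M) * d = d + 2 * (lam n * (-d / (2 * M))) := by
        field_simp; ring
      linarith
    calc lam n = 2 * M / (-d) * (lam n * (-d / (2 * M))) := by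
          have := hd0.ne
          field_simp
      _ ≤ _ := mul_le_mul_of_nonneg_left h3 (by positivity)
  have hE0 : Tendsto (fun n => 2 * M / (-d) * (E n - d)) atTop (𝓝 0) := by
    have := ((tendsto_energy_of_isMinimizingSeq hQ hM hd hf).sub_const d).const_mul (2 * M / (-d))
    simpa using this
  exact squeeze_zero hlam0 hle hE0

end Splitting

/-! ### A state of negative energy. -/

section TestFunction

variable {l k₁ k₂ k₃ C₁ C₂ F₀ γ M : ℝ} {Q : ℝ → ℝ} {f : Phase → ℝ}

/-- The polytropic test function `c L^l` on `{|x| ≤ R, |v| ≤ V}`. -/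
noncomputable def boxFun (l c R V : ℝ) : Phase → ℝ := (box R V).indicator fun z => c * angMom z ^ l

theorem boxFun_nonneg (l : ℝ) {c : ℝ} (hc : 0 ≤ c) (R V : ℝ) (z : Phase) :
    0 ≤ boxFun l c R V z :=
  Set.indicator_nonneg (fun z _ => mul_nonneg hc (Real.rpow_nonneg (angMom_nonneg z) _)) z

theorem measurable_boxFun (l c R V : ℝ) : Measurable (boxFun l c R V) :=
  ((measurable_angMom.pow_const l).const_mul c).indicator (measurableSet_box R V)

theorem sphericallySymmetric_boxFun (l c R V : ℝ) : SphericallySymmetric (boxFun l c R V) := by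
  intro A _ x v
  have hiff : ((A x, A v) ∈ box R V) ↔ ((x, v) ∈ box R V) := by
    simp [box, A.norm_map]
  by_cases h : (x, v) ∈ box R V
  · simp only [boxFun, Set.indicator_of_mem h, Set.indicator_of_mem (hiff.2 h), angMom_isometry]
  · simp only [boxFun, Set.indicator_of_notMem h,
      Set.indicator_of_notMem (fun h2 => h (hiff.1 h2))]

theorem setLIntegral_boxFun (l : ℝ) {c : ℝ} (hc : 0 ≤ c) (R V : ℝ) :
    ∫⁻ z, ENNReal.ofReal (boxFun l c R V z) = ENNReal.ofReal c * boxWeight l R V := by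
  rw [boxWeight, ← lintegral_const_mul' _ _ ENNReal.ofReal_ne_top,
    ← lintegral_indicator (measurableSet_box R V)]
  refine lintegral_congr fun z => ?_
  by_cases h : z ∈ box R V
  · simp only [boxFun, Set.indicator_of_mem h, ENNReal.ofReal_mul hc]
  · simp only [boxFun, Set.indicator_of_notMem h, ENNReal.ofReal_zero]

/-- The profile $cL^l$ is chosen so that $L^{-l}f$ is the constant $c$ on the box. -/
theorem casimir_boxFun_le (hQ : CasimirAssumptions l k₁ k₂ k₃ C₁ C₂ F₀ Q) {c : ℝ} (hc : 0 ≤ c)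
    (R V : ℝ) : casimir Q l (boxFun l c R V) ≤ ENNReal.ofReal (Q c) * boxWeight l R V := by
  rw [boxWeight, casimir, ← lintegral_const_mul' _ _ ENNReal.ofReal_ne_top,
    ← lintegral_indicator (measurableSet_box R V)]
  refine lintegral_mono_ae ?_
  filter_upwards [ae_angMom_pos] with z hL
  by_cases h : z ∈ box R V
  · simp only [boxFun, Set.indicator_of_mem h]
    rw [mul_left_comm, ← Real.rpow_add hL, neg_add_cancel, Real.rpow_zero, mul_one,
      ENNReal.ofReal_mul (hQ.nonneg c hc)]
  · simp only [boxFun, Set.indicator_of_notMem h, mul_zero, hQ.map_zero, zero_mul,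
      ENNReal.ofReal_zero, le_refl]

/-- Only the field outside radius $R$, where the whole mass is enclosed, is kept in the potential
energy. -/
theorem energyCasimir_boxFun_le (hQ : CasimirAssumptions l k₁ k₂ k₃ C₁ C₂ F₀ Q) (hM : 0 < M)
    (hγ : 0 ≤ γ) {R V c : ℝ} (hR : 0 < R) (hV : 0 < V) (hc : 0 < c)
    (hmass : c * (boxWeight l R V).toReal = M) :
    infEnergy Q l γ M ≤ ((γ * (R ^ 2 * V ^ 2 * M) + Q c * (boxWeight l R V).toReal
      + 1 / 2 * (V ^ 2 * M)
      - 1 / (8 * Real.pi) * (M ^ 2 * (R⁻¹ * tailConst.toReal)) : ℝ) : EReal) := by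
  have hKt : boxWeight l R V ≠ ⊤ := by
    rw [boxWeight_scale l hR hV]
    exact (ENNReal.mul_lt_top ENNReal.ofReal_lt_top (boxWeight_one_lt_top hQ.l_gt)).ne
  set K : ℝ := (boxWeight l R V).toReal with hK
  have hKE : boxWeight l R V = ENNReal.ofReal K := (ENNReal.ofReal_toReal hKt).symm
  have hK0 : 0 ≤ K := ENNReal.toReal_nonneg
  set f := boxFun l c R V with hf
  have hfm : Measurable f := measurable_boxFun l c R V
  have hf0 : ∀ z, 0 ≤ f z := boxFun_nonneg l hc.le R V
  have hf0' : 0 ≤ᵐ[volume] f := Eventually.of_forall hf0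
  have hM' := hM.le
  have hint : ∫⁻ z, ENNReal.ofReal (f z) = ENNReal.ofReal M := by
    rw [hf, setLIntegral_boxFun l hc.le, hKE, ← ENNReal.ofReal_mul hc.le, hmass]
  have hfi : Integrable f := ⟨hfm.aestronglyMeasurable, by
    rw [hasFiniteIntegral_iff_ofReal hf0', hint]; exact ENNReal.ofReal_lt_top⟩
  have hfM : ∫ z, f z = M := by
    rw [integral_eq_lintegral_of_nonneg_ae hf0' hfm.aestronglyMeasurable, hint,
      ENNReal.toReal_ofReal hM.le]
  have hsupp : ∀ {a : Phase → ℝ} {b : ℝ}, 0 ≤ b → (∀ z ∈ box R V, a z ≤ b) →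
      ∫⁻ z, ENNReal.ofReal (a z * f z) ≤ ENNReal.ofReal (b * M) := by
    intro a b hb hab
    rw [ENNReal.ofReal_mul hb, ← hint, ← lintegral_const_mul' _ _ ENNReal.ofReal_ne_top]
    refine lintegral_mono fun z => ?_
    rw [← ENNReal.ofReal_mul hb]
    refine ENNReal.ofReal_le_ofReal ?_
    by_cases hz : z ∈ box R V
    · exact mul_le_mul_of_nonneg_right (hab z hz) (hf0 z)
    · have : f z = 0 := Set.indicator_of_notMem hz _
      rw [this, mul_zero, mul_zero]
  have h1 : ∫⁻ z, ENNReal.ofReal (angMom z * f z) ≤ ENNReal.ofReal (R ^ 2 * V ^ 2 * M) :=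
    hsupp (by positivity) fun z hz => (angMom_le z).trans (by
      have h1 : ‖z.1‖ ≤ R := hz.1
      have h2 : ‖z.2‖ ≤ V := hz.2
      gcongr)
  have h2 : ∫⁻ z : Phase, ENNReal.ofReal (‖z.2‖ ^ 2 * f z) ≤ ENNReal.ofReal (V ^ 2 * M) :=
    hsupp (by positivity) fun z hz => by
      have h2 : ‖z.2‖ ≤ V := hz.2
      gcongr
  have h3 : casimir Q l f ≤ ENNReal.ofReal (Q c * K) := by
    rw [ENNReal.ofReal_mul (hQ.nonneg c hc.le), ← hKE]
    exact casimir_boxFun_le hQ hc.le R V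
  have hQc : 0 ≤ Q c := hQ.nonneg c hc.le
  have hP : positivePart Q l γ f ≤
      ENNReal.ofReal (γ * (R ^ 2 * V ^ 2 * M) + Q c * K + 1 / 2 * (V ^ 2 * M)) := by
    rw [ENNReal.ofReal_add (by positivity) (by positivity),
      ENNReal.ofReal_add (by positivity) (by positivity), ENNReal.ofReal_mul hγ,
      ENNReal.ofReal_mul (by norm_num : (0 : ℝ) ≤ 1 / 2)]
    unfold positivePart kineticEnergy
    gcongr
  have hPt : positivePart Q l γ f < ⊤ := hP.trans_lt ENNReal.ofReal_lt_top
  have hmem : f ∈ feasible Q l γ M :=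
    ⟨hfi, hf0', hfM, hPt, f, sphericallySymmetric_boxFun l c R V, EventuallyEq.rfl⟩
  have hpt := negPotentialEnergy_lt_top hQ hM hmem
  have hpot : ENNReal.ofReal (1 / (8 * Real.pi) * (M ^ 2 * (R⁻¹ * tailConst.toReal))) ≤
      negPotentialEnergy f := by
    rw [negPotentialEnergy_eq hfi hf0', fieldEnergy, ENNReal.ofReal_mul (by positivity),
      ENNReal.ofReal_mul (by positivity), ENNReal.ofReal_mul (by positivity),
      ENNReal.ofReal_toReal tailConst_lt_top.ne, ← lintegral_tail hR,
      ← lintegral_const_mul' _ _ ENNReal.ofReal_ne_top]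
    refine mul_le_mul_right ?_ _
    refine le_trans (setLIntegral_mono_ae' (measurableSet_le measurable_const measurable_norm)
      (Eventually.of_forall fun x hx => ?_)) (setLIntegral_le_lintegral _ _)
    have hx' : R ≤ ‖x‖ := hx
    have hm : massIn f ‖x‖ = ENNReal.ofReal M := by
      rw [← hint, massIn, ← lintegral_indicator (measurableSet_norm_fst_le _)]
      refine lintegral_congr fun z => ?_
      by_cases hz : z ∈ {z : Phase | ‖z.1‖ ≤ ‖x‖}
      · rw [Set.indicator_of_mem hz]
      · rw [Set.indicator_of_notMem hz]
        have : f z = 0 := Set.indicator_of_notMem (fun h => hz (h.1.trans hx')) _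
        rw [this, ENNReal.ofReal_zero]
    rw [hm, ENNReal.ofReal_pow hM.le]
  refine (iInf₂_le f hmem).trans ?_
  rw [energyCasimir_eq_coe hPt hpt, EReal.coe_le_coe_iff]
  have h4 := ENNReal.toReal_mono ENNReal.ofReal_ne_top hP
  have h5 := ENNReal.toReal_mono hpt.ne hpot
  rw [ENNReal.toReal_ofReal (by positivity)] at h4 h5
  linarith

/-- On a box of radius $R$ the potential energy is at least $Mb/R$ in modulus. With $V^2$ of order
$1/R$ the mass constraint forces $c=AR^{-s}$, $s=l+3/2$. By (Q2) the Casimir term is then of order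
$R^{-s/k_2}$, which for large $R$ is negligible against $1/R$ because $k_2<s$. -/
theorem exists_infEnergy_neg (hQ : CasimirAssumptions l k₁ k₂ k₃ C₁ C₂ F₀ Q) (hM : 0 < M) :
    ∃ γ₀ : ℝ, 0 < γ₀ ∧ ∀ γ : ℝ, 0 ≤ γ → γ ≤ γ₀ → infEnergy Q l γ M < 0 := by
  have hk := hQ.k₂_pos
  have hkl := hQ.k₂_lt
  have hC2 := hQ.C₂_pos
  have ht : 0 < tailConst.toReal := ENNReal.toReal_pos tailConst_pos.ne' tailConst_lt_top.ne
  have hKt : boxWeight l 1 1 ≠ ⊤ := (boxWeight_one_lt_top hQ.l_gt).ne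
  set K : ℝ := (boxWeight l 1 1).toReal with hK
  have hK0 : 0 < K := ENNReal.toReal_pos (boxWeight_one_pos l).ne' hKt
  set q : ℝ := 1 / (8 * Real.pi) with hq
  have hq0 : 0 < q := by rw [hq]; positivity
  set b : ℝ := q * M * tailConst.toReal with hb
  have hb0 : 0 < b := by rw [hb]; positivity
  set s : ℝ := (2 * l + 3) / 2 with hs
  have hs0 : 0 < s := by rw [hs]; linarith
  set A : ℝ := M / (K * (b / 2) ^ s) with hA
  have hA0 : 0 < A := by rw [hA]; positivity
  -- The first limit puts $c$ below $F_0$, the range in which (Q2) holds; the second is the ratio of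
  -- the Casimir bound to $M/R$.
  have lim1 : Tendsto (fun R : ℝ => A * R ^ (-s)) atTop (𝓝 0) := by
    simpa using (tendsto_rpow_neg_atTop hs0).const_mul A
  have lim2 : Tendsto (fun R : ℝ => C₂ * A ^ (1 / k₂) * R ^ (-(s / k₂ - 1))) atTop (𝓝 0) := by
    have : 0 < s / k₂ - 1 := by
      rw [sub_pos, one_lt_div hk, hs]; linarith
    simpa using (tendsto_rpow_neg_atTop this).const_mul (C₂ * A ^ (1 / k₂))
  obtain ⟨R, hR1, hR2, hR⟩ := ((lim1.eventually_lt_const hQ.F₀_pos).and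
    ((lim2.eventually_lt_const (by positivity : 0 < b / 4)).and (eventually_gt_atTop 0))).exists
  set c : ℝ := A * R ^ (-s) with hc
  have hc0 : 0 < c := by rw [hc]; positivity
  -- With this value the kinetic energy is at most a quarter of $Mb/R$.
  set V : ℝ := Real.sqrt (b / (2 * R)) with hV
  have hV0 : 0 < V := Real.sqrt_pos.2 (by positivity)
  have hV2 : V ^ 2 = b / (2 * R) := Real.sq_sqrt (by positivity)
  have hRV : (R * V) ^ (2 * l + 3) = (b / 2) ^ s * R ^ s := by
    have h1 : (R * V) ^ (2 * l + 3) = ((R * V) ^ 2) ^ s := by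
      rw [← Real.rpow_two, ← Real.rpow_mul (by positivity)]
      congr 1
      rw [hs]; ring
    rw [h1, mul_pow, hV2, ← Real.mul_rpow (by positivity) hR.le]
    congr 1
    field_simp
  have hbw : (boxWeight l R V).toReal = (b / 2) ^ s * R ^ s * K := by
    rw [boxWeight_scale l hR hV0, ENNReal.toReal_mul, ENNReal.toReal_ofReal (by positivity), hRV]
  have hmass : c * (boxWeight l R V).toReal = M := by
    have h1 : R ^ (-s) * R ^ s = 1 := by
      rw [← Real.rpow_add hR, neg_add_cancel, Real.rpow_zero]
    calc c * (boxWeight l R V).toReal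
        = A * ((b / 2) ^ s * K) * (R ^ (-s) * R ^ s) := by rw [hbw, hc]; ring
      _ = M := by rw [h1, hA]; field_simp
  have hQc : Q c * (boxWeight l R V).toReal ≤ M * b / (4 * R) := by
    have h1 : Q c ≤ C₂ * c ^ (1 / k₂) * c := by
      refine (hQ.Q2 c hc0.le hR1.le).trans (le_of_eq ?_)
      rw [Real.rpow_add hc0, Real.rpow_one]; ring
    have h2 : C₂ * c ^ (1 / k₂) ≤ b / (4 * R) := by
      have h3 : C₂ * c ^ (1 / k₂) = C₂ * A ^ (1 / k₂) * R ^ (-(s / k₂ - 1)) / R := by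
        rw [hc, Real.mul_rpow hA0.le (by positivity), ← Real.rpow_mul hR.le,
          show -(s / k₂ - 1) = -s * (1 / k₂) + 1 by ring, Real.rpow_add hR, Real.rpow_one]
        field_simp
      rw [h3, show b / (4 * R) = b / 4 / R by field_simp]
      gcongr
    calc Q c * (boxWeight l R V).toReal
        ≤ C₂ * c ^ (1 / k₂) * c * (boxWeight l R V).toReal := by gcongr
      _ = C₂ * c ^ (1 / k₂) * M := by rw [mul_assoc, hmass]
      _ ≤ b / (4 * R) * M := by gcongr
      _ = _ := by ring
  have hpot : q * (M ^ 2 * (R⁻¹ * tailConst.toReal)) = M * b / R := by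
    rw [hb]; field_simp
  -- The $\gamma$-term is then at most an eighth of $Mb/R$. Together with a quarter each from the
  -- kinetic and the Casimir term, the total stays below the potential energy.
  refine ⟨1 / (4 * R ^ 2), by positivity, fun γ hγ hγ0 => ?_⟩
  refine (energyCasimir_boxFun_le hQ hM hγ hR hV0 hc0 hmass).trans_lt ?_
  have hγb : γ * (R ^ 2 * V ^ 2 * M) ≤ M * b / (8 * R) := by
    calc γ * (R ^ 2 * V ^ 2 * M) ≤ 1 / (4 * R ^ 2) * (R ^ 2 * V ^ 2 * M) := by gcongr
      _ = _ := by rw [hV2]; field_simp; norm_num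
  have hkin : 1 / 2 * (V ^ 2 * M) = M * b / (4 * R) := by
    rw [hV2]; field_simp; norm_num
  have hpos : 0 < M * b / R := by positivity
  have e1 : M * b / (8 * R) = M * b / R / 8 := by field_simp
  have e2 : M * b / (4 * R) = M * b / R / 4 := by field_simp
  rw [← EReal.coe_zero, EReal.coe_lt_coe_iff, hkin, hpot]
  rw [e1] at hγb
  rw [e2] at hQc ⊢
  linarith

end TestFunction

/-! ### The space $L^{k,l}$ as a closed subspace of a weighted Lebesgue space. -/

section WeightedSpace

variable {k l : ℝ}

theorem measurable_weight (k l : ℝ) : Measurable fun z : Phase => angMom z ^ (-l / k) :=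
  measurable_angMom.pow_const _

instance sigmaFinite_weightedMeasure (k l : ℝ) : SigmaFinite (weightedMeasure k l) := by
  unfold weightedMeasure
  infer_instance

theorem weightedMeasure_ac (k l : ℝ) : weightedMeasure k l ≪ volume :=
  withDensity_absolutelyContinuous _ _

theorem ac_weightedMeasure (k l : ℝ) : (volume : Measure Phase) ≪ weightedMeasure k l := by
  refine withDensity_absolutelyContinuous' (measurable_weight k l).ennreal_ofReal.aemeasurable ?_
  filter_upwards [ae_angMom_pos] with z hz
  simp only [ne_eq, ENNReal.ofReal_eq_zero, not_le]
  positivity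

theorem lpExponent_ne_top (k : ℝ) : lpExponent k ≠ ⊤ := by simp [lpExponent]

theorem toReal_lpExponent (hk : 0 < k) : (lpExponent k).toReal = 1 + 1 / k := by
  rw [lpExponent, ENNReal.toReal_add (by simp) (by simp), ENNReal.toReal_one,
    ENNReal.toReal_ofReal (by positivity)]

theorem lpExponent_eq (hk : 0 < k) : lpExponent k = ENNReal.ofReal (1 + 1 / k) := by
  rw [← toReal_lpExponent hk, ENNReal.ofReal_toReal (lpExponent_ne_top k)]

theorem holderConjugate_lpExponent (hk : 0 < k) :
    ENNReal.HolderConjugate (lpExponent k) (ENNReal.ofReal (k + 1)) := by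
  have hpq : (1 + 1 / k).HolderConjugate (k + 1) := by
    rw [Real.holderConjugate_iff]
    constructor
    · have : 0 < 1 / k := by positivity
      linarith
    · field_simp
  rw [lpExponent_eq hk]
  exact hpq.ennrealOfReal

theorem eLpNorm_weightedMeasure (hk : 0 < k) {f : Phase → ℝ} (h0 : 0 ≤ᵐ[volume] f)
    (hf : AEMeasurable f) :
    eLpNorm f (lpExponent k) (weightedMeasure k l) = weightedPow k l f ^ (1 / (1 + 1 / k)) := by
  rw [eLpNorm_eq_lintegral_rpow_enorm_toReal
    (zero_lt_one.trans_le (fact_one_le_lpExponent k).out).ne' (lpExponent_ne_top k),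
    toReal_lpExponent hk, weightedMeasure,
    lintegral_withDensity_eq_lintegral_mul₀ (measurable_weight k l).ennreal_ofReal.aemeasurable
      (hf.enorm.pow_const _)]
  congr 1
  refine lintegral_congr_ae ?_
  filter_upwards [h0, ae_angMom_pos] with z hz hL
  have hz : 0 ≤ f z := hz
  rw [Pi.mul_apply, Real.enorm_eq_ofReal hz, ENNReal.ofReal_rpow_of_nonneg hz (by positivity),
    ← ENNReal.ofReal_mul (by positivity), mul_comm]

/-- A subsequence converges almost everywhere. The pointwise `limUnder` of symmetric representatives
is symmetric at every point, also where no limit exists, since its value depends only on the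
sequence of values. -/
theorem isClosed_weightedSpace (k l : ℝ) :
    IsClosed (weightedSpace k l : Set (Lp ℝ (lpExponent k) (weightedMeasure k l))) := by
  refine IsSeqClosed.isClosed fun u h hu hlim => ?_
  obtain ⟨n, -, hn⟩ := (tendstoInMeasure_of_tendsto_Lp hlim).exists_seq_tendsto_ae
  choose g hg hgu using hu
  refine ⟨fun z => limUnder atTop fun i => g (n i) z, fun A hA x v => ?_, ?_⟩
  · simp only [fun i => hg (n i) A hA x v]
  · have hall : ∀ᵐ z ∂(weightedMeasure k l), ∀ i, g (n i) z = u (n i) z :=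
      ae_all_iff.2 fun i => hgu (n i)
    filter_upwards [hn, hall] with z hz hz2
    simp only [hz2]
    exact hz.limUnder_eq

/-- A closed convex set is weakly closed: otherwise a separating functional would contradict the
weak convergence. -/
theorem mem_weightedSpace_of_weak_limit {h : ℕ → weightedSpace k l}
    {h₀ : Lp ℝ (lpExponent k) (weightedMeasure k l)}
    (hlim : ∀ φ : StrongDual ℝ (Lp ℝ (lpExponent k) (weightedMeasure k l)),
      Tendsto (fun j => φ (h j)) atTop (𝓝 (φ h₀))) : h₀ ∈ weightedSpace k l := by
  by_contra hnot
  obtain ⟨φ, c, h1, h2⟩ := geometric_hahn_banach_closed_point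
    (weightedSpace k l).convex (isClosed_weightedSpace k l) hnot
  exact absurd h2 (not_lt.2 (le_of_tendsto (hlim φ) (Eventually.of_forall fun j =>
    (h1 _ (h j).2).le)))

/-- With $w=L^{-l/k}$ the functional is the pairing with $u/w$. It is bounded because $\int
w\,|u/w|^{k+1}=\int|u|^{k+1}L^l$, and $L^l$ is integrable on boxes. -/
theorem exists_test_functional (hk : 0 < k) (hl : -1 < l) {u : Phase → ℝ} (hu : Measurable u)
    {B R : ℝ} (hR : 0 < R) (hB : ∀ z, |u z| ≤ B) (hsupp : ∀ z, z ∉ box R R → u z = 0) :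
    ∃ φ : StrongDual ℝ (Lp ℝ (lpExponent k) (weightedMeasure k l)),
      ∀ h : Lp ℝ (lpExponent k) (weightedMeasure k l),
        Integrable (fun z => u z * h z) ∧ φ h = ∫ z, u z * h z := by
  have hconj := holderConjugate_lpExponent hk
  have hconj' : ENNReal.HolderConjugate (ENNReal.ofReal (k + 1)) (lpExponent k) :=
    ENNReal.HolderConjugate.symm
  have : Fact (1 ≤ ENNReal.ofReal (k + 1)) := ⟨by
    rw [← ENNReal.ofReal_one]; exact ENNReal.ofReal_le_ofReal (by linarith)⟩
  set w : Phase → ℝ := fun z => angMom z ^ (-l / k) with hw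
  have hwm : Measurable w := measurable_weight k l
  have hw0 : ∀ z, 0 ≤ w z := fun z => Real.rpow_nonneg (angMom_nonneg z) _
  have hwpos : ∀ᵐ z : Phase, 0 < w z := by
    filter_upwards [ae_angMom_pos] with z hz
    exact Real.rpow_pos_of_pos hz _
  have hmem : MemLp (fun z => u z * (w z)⁻¹) (ENNReal.ofReal (k + 1)) (weightedMeasure k l) := by
    refine ⟨(hu.mul hwm.inv).aestronglyMeasurable, ?_⟩
    rw [eLpNorm_lt_top_iff_lintegral_rpow_enorm_lt_top (by simp; linarith) (by simp),
      ENNReal.toReal_ofReal (by linarith), weightedMeasure,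
      lintegral_withDensity_eq_lintegral_mul _ hwm.ennreal_ofReal
        (g := fun z => ‖u z * (w z)⁻¹‖ₑ ^ (k + 1)) ((hu.mul hwm.inv).enorm.pow_const _)]
    have hbound : ∀ᵐ z : Phase, ((fun z => ENNReal.ofReal (w z)) *
        fun z => ‖u z * (w z)⁻¹‖ₑ ^ (k + 1)) z ≤ (box R R).indicator (fun z =>
          ENNReal.ofReal (|B| ^ (k + 1)) * ENNReal.ofReal (angMom z ^ l)) z := by
      filter_upwards [ae_angMom_pos, hwpos] with z hL hwz
      rw [Pi.mul_apply]
      by_cases hz : z ∈ box R R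
      · rw [Set.indicator_of_mem hz, ← ofReal_norm, Real.norm_eq_abs,
          ENNReal.ofReal_rpow_of_nonneg (abs_nonneg _) (by linarith),
          ← ENNReal.ofReal_mul hwz.le, ← ENNReal.ofReal_mul (by positivity)]
        refine ENNReal.ofReal_le_ofReal ?_
        rw [abs_mul, abs_of_pos (inv_pos.2 hwz), Real.mul_rpow (abs_nonneg _) (by positivity)]
        have e1 : w z * (w z)⁻¹ ^ (k + 1) = angMom z ^ l := by
          rw [Real.inv_rpow hwz.le, Real.rpow_add hwz, Real.rpow_one, hw,
            ← Real.rpow_mul hL.le, show -l / k * k = -l by field_simp, Real.rpow_neg hL.le]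
          have h1 : angMom z ^ l ≠ 0 := (Real.rpow_pos_of_pos hL _).ne'
          have h2 : angMom z ^ (-l / k) ≠ 0 := (Real.rpow_pos_of_pos hL _).ne'
          field_simp
        calc w z * (|u z| ^ (k + 1) * (w z)⁻¹ ^ (k + 1))
            = |u z| ^ (k + 1) * (w z * (w z)⁻¹ ^ (k + 1)) := by ring
          _ = |u z| ^ (k + 1) * angMom z ^ l := by rw [e1]
          _ ≤ |B| ^ (k + 1) * angMom z ^ l := by
              exact mul_le_mul_of_nonneg_right (Real.rpow_le_rpow (abs_nonneg _)
                ((hB z).trans (le_abs_self B)) (by linarith)) (by positivity)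
      · rw [Set.indicator_of_notMem hz, hsupp z hz]
        simp [(by linarith : 0 < k + 1)]
    refine (lintegral_mono_ae hbound).trans_lt ?_
    rw [lintegral_indicator (measurableSet_box R R),
      lintegral_const_mul' _ _ ENNReal.ofReal_ne_top]
    refine ENNReal.mul_lt_top ENNReal.ofReal_lt_top ?_
    change boxWeight l R R < ⊤
    rw [boxWeight_scale l hR hR]
    exact ENNReal.mul_lt_top ENNReal.ofReal_lt_top (boxWeight_one_lt_top hl)
  have hdens : ∀ p : Phase → ℝ,
      Integrable (fun z => u z * (w z)⁻¹ * p z) (weightedMeasure k l) →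
      Integrable (fun z => u z * p z) ∧
        ∫ z, u z * (w z)⁻¹ * p z ∂(weightedMeasure k l) = ∫ z, u z * p z := by
    intro p hint
    have hcancel : (fun z => (ENNReal.ofReal (w z)).toReal • (u z * (w z)⁻¹ * p z)) =ᵐ[volume]
        fun z => u z * p z := by
      filter_upwards [hwpos] with z hz
      rw [ENNReal.toReal_ofReal hz.le, smul_eq_mul]
      field_simp
    have hfin : ∀ᵐ z : Phase, ENNReal.ofReal (w z) < ⊤ :=
      Eventually.of_forall fun z => ENNReal.ofReal_lt_top
    constructor
    · rw [weightedMeasure, integrable_withDensity_iff_integrable_smul' hwm.ennreal_ofReal hfin]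
        at hint
      exact hint.congr hcancel
    · rw [weightedMeasure, integral_withDensity_eq_integral_toReal_smul hwm.ennreal_ofReal hfin]
      exact integral_congr_ae hcancel
  refine ⟨dualPairing _ (ENNReal.ofReal (k + 1)) (lpExponent k) (hmem.toLp _), fun h => ?_⟩
  obtain ⟨h1, h2⟩ := hdens h (hmem.integrable_mul (Lp.memLp h))
  refine ⟨h1, ?_⟩
  rw [dualPairing_apply, ← h2]
  refine integral_congr_ae ?_
  filter_upwards [hmem.coeFn_toLp] with z hz
  rw [hz]

end WeightedSpace

/-! ### Weak limits of sequences with bounded positive part. -/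

section WeakLimit

variable {l k₁ k₂ k₃ C₁ C₂ F₀ γ M : ℝ} {Q : ℝ → ℝ}

/-- Besides weak convergence in $L^{k_1,l}$ it records the convergence of unweighted integrals
against bounded functions supported in boxes, the only form in which the weak limit is used
afterwards. -/
theorem exists_weak_limit (hQ : CasimirAssumptions l k₁ k₂ k₃ C₁ C₂ F₀ Q) (hM : 0 < M)
    {f : ℕ → Phase → ℝ} (hf : ∀ n, f n ∈ feasible Q l γ M) {B : ℝ}
    (hB : ∀ n, (positivePart Q l γ (f n)).toReal ≤ B) :
    ∃ (f₀ : Phase → ℝ) (n : ℕ → ℕ), StrictMono n ∧ Measurable f₀ ∧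
      (∃ g : Phase → ℝ, SphericallySymmetric g ∧ g =ᵐ[volume] f₀) ∧
      WeaklyConverges k₁ l (fun j => f (n j)) f₀ ∧
      ∀ (u : Phase → ℝ) (b R : ℝ), Measurable u → 0 < R → (∀ z, |u z| ≤ b) →
        (∀ z, z ∉ box R R → u z = 0) → Integrable (fun z => u z * f₀ z) ∧
        Tendsto (fun j => ∫ z, u z * f (n j) z) atTop (𝓝 (∫ z, u z * f₀ z)) := by
  have hk := hQ.k₁_pos
  have hl := hQ.l_gt
  have hconj := holderConjugate_lpExponent hk
  have : Fact (1 ≤ ENNReal.ofReal (k₁ + 1)) := ⟨by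
    rw [← ENNReal.ofReal_one]; exact ENNReal.ofReal_le_ofReal (by linarith)⟩
  obtain ⟨c, hc, hcf⟩ := exists_weightedPow_le (M := M) hQ hM.le
  have hB' : ∀ n, weightedPow k₁ l (f n) ≤ ENNReal.ofReal (c * (1 + B)) := fun n => by
    refine (hcf γ (f n) (hf n)).trans (ENNReal.ofReal_le_ofReal ?_)
    have := hB n
    unfold energySize
    gcongr
  have hmem : ∀ n, MemLp (f n) (lpExponent k₁) (weightedMeasure k₁ l) := fun n => by
    refine ⟨(hf n).1.aestronglyMeasurable.mono_ac (weightedMeasure_ac k₁ l), ?_⟩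
    rw [eLpNorm_weightedMeasure hk (hf n).2.1 (hf n).1.aemeasurable]
    exact ENNReal.rpow_lt_top_of_nonneg (by positivity)
      ((hB' n).trans_lt ENNReal.ofReal_lt_top).ne
  have hbound : ∀ n, ‖(hmem n).toLp (f n)‖ ≤
      (ENNReal.ofReal (c * (1 + B)) ^ (1 / (1 + 1 / k₁))).toReal := fun n => by
    rw [Lp.norm_toLp, eLpNorm_weightedMeasure hk (hf n).2.1 (hf n).1.aemeasurable]
    refine ENNReal.toReal_mono (ENNReal.rpow_lt_top_of_nonneg (by positivity)
      ENNReal.ofReal_ne_top).ne (ENNReal.rpow_le_rpow (hB' n) (by positivity))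
  obtain ⟨h₀, n, hn, hlim⟩ := exists_weakly_convergent_subseq (q := ENNReal.ofReal (k₁ + 1))
    (lpExponent_ne_top k₁) ENNReal.ofReal_ne_top hbound
  have hspace : ∀ j, (hmem j).toLp (f j) ∈ weightedSpace k₁ l := fun j => by
    obtain ⟨g, hg, hgf⟩ := (hf j).2.2.2.2
    exact ⟨g, hg, ((weightedMeasure_ac k₁ l).ae_eq hgf).trans (hmem j).coeFn_toLp.symm⟩
  have hspace₀ : h₀ ∈ weightedSpace k₁ l :=
    mem_weightedSpace_of_weak_limit (h := fun j => ⟨_, hspace (n j)⟩) hlim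
  refine ⟨h₀, n, hn, (Lp.stronglyMeasurable h₀).measurable, ?_, ?_, ?_⟩
  · obtain ⟨g, hg, hgf⟩ := hspace₀
    exact ⟨g, hg, (ac_weightedMeasure k₁ l).ae_eq hgf⟩
  · refine ⟨fun j => ⟨_, hspace (n j)⟩, ⟨h₀, hspace₀⟩, fun j => (hmem (n j)).coeFn_toLp,
      EventuallyEq.rfl, fun φ => ?_⟩
    -- Functionals on the symmetric subspace extend to the whole Lebesgue space by Hahn–Banach.
    obtain ⟨ψ, hψ, -⟩ := exists_extension_norm_eq (weightedSpace k₁ l) φ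
    have := hlim ψ
    simpa only [← hψ] using this
  · intro u b R hu hR hub hsupp
    obtain ⟨φ, hφ⟩ := exists_test_functional (k := k₁) hk hl hu hR hub hsupp
    refine ⟨(hφ h₀).1, ?_⟩
    have h1 := hlim φ
    rw [(hφ h₀).2] at h1
    refine h1.congr fun j => ?_
    rw [(hφ _).2]
    refine integral_congr_ae ?_
    filter_upwards [(ac_weightedMeasure k₁ l).ae_le (hmem (n j)).coeFn_toLp] with z hz
    rw [hz]

end WeakLimit

/-! ### Consequences of local weak convergence; tightness and conservation of mass. -/

section TestConvergence

variable {F : ℕ → Phase → ℝ} {f₀ : Phase → ℝ}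

/-- Convergence of the integrals against bounded functions supported in bounded boxes. -/
def TestConvergence (F : ℕ → Phase → ℝ) (f₀ : Phase → ℝ) : Prop :=
  ∀ (u : Phase → ℝ) (b R : ℝ), Measurable u → 0 < R → (∀ z, |u z| ≤ b) →
    (∀ z, z ∉ box R R → u z = 0) → Integrable (fun z => u z * f₀ z) ∧
    Tendsto (fun j => ∫ z, u z * F j z) atTop (𝓝 (∫ z, u z * f₀ z))

theorem box_mono {R R' : ℝ} (h : R ≤ R') : box R R ⊆ box R' R' :=
  fun _ hz => ⟨hz.1.trans h, hz.2.trans h⟩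

theorem exists_mem_box (z : Phase) : ∀ᶠ j : ℕ in atTop, z ∈ box ((j : ℝ) + 1) ((j : ℝ) + 1) := by
  obtain ⟨N, hN⟩ := exists_nat_ge (max ‖z.1‖ ‖z.2‖)
  filter_upwards [eventually_ge_atTop N] with j hj
  have : (N : ℝ) ≤ j := by exact_mod_cast hj
  exact ⟨(le_max_left _ _).trans (by linarith), (le_max_right _ _).trans (by linarith)⟩

theorem aecover_box :
    AECover (volume : Measure Phase) atTop fun j : ℕ => box ((j : ℝ) + 1) ((j : ℝ) + 1) :=
  ⟨Eventually.of_forall exists_mem_box, fun _ => measurableSet_box _ _⟩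

theorem abs_indicator_one_le (S : Set Phase) (z : Phase) :
    |S.indicator (fun _ => (1 : ℝ)) z| ≤ 1 := by
  by_cases h : z ∈ S <;> simp [h]

theorem integral_indicator_one_mul {S : Set Phase} (hS : MeasurableSet S) (f : Phase → ℝ) :
    ∫ z, S.indicator (fun _ => (1 : ℝ)) z * f z = ∫ z in S, f z := by
  rw [← integral_indicator hS]
  refine integral_congr_ae (Eventually.of_forall fun z => ?_)
  by_cases h : z ∈ S <;> simp [h]

/-- The test function is the indicator of $\{f_0<0\}$ within a box: the limit of the integrals is
nonnegative, while the integrand is nonpositive. -/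
theorem TestConvergence.ae_nonneg (h : TestConvergence F f₀) (hm : Measurable f₀)
    (hF : ∀ n, 0 ≤ᵐ[volume] F n) : 0 ≤ᵐ[volume] f₀ := by
  have key : ∀ j : ℕ, ∀ᵐ z, z ∈ box ((j : ℝ) + 1) ((j : ℝ) + 1) → 0 ≤ f₀ z := by
    intro j
    set S : Set Phase := box ((j : ℝ) + 1) ((j : ℝ) + 1) ∩ {z | f₀ z < 0} with hS
    have hSm : MeasurableSet S := (measurableSet_box _ _).inter
      (measurableSet_lt hm measurable_const)
    set u : Phase → ℝ := S.indicator fun _ => 1 with hu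
    obtain ⟨hi, hlim⟩ := h u 1 ((j : ℝ) + 1) (measurable_const.indicator hSm) (by positivity)
      (abs_indicator_one_le S) (fun z hz => Set.indicator_of_notMem (fun h => hz h.1) _)
    have h0 : 0 ≤ ∫ z, u z * f₀ z := by
      refine ge_of_tendsto hlim (Eventually.of_forall fun n => integral_nonneg_of_ae ?_)
      filter_upwards [hF n] with z hz
      exact mul_nonneg (Set.indicator_nonneg (fun _ _ => zero_le_one) z) hz
    have hneg : ∀ z, 0 ≤ -(u z * f₀ z) := by
      intro z
      by_cases hz : z ∈ S
      · have : f₀ z < 0 := hz.2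
        simp only [hu, Set.indicator_of_mem hz, one_mul]
        linarith
      · simp [hu, Set.indicator_of_notMem hz]
    have h1 : ∫ z, -(u z * f₀ z) = 0 := by
      refine le_antisymm ?_ (integral_nonneg hneg)
      rw [integral_neg]
      linarith
    rw [integral_eq_zero_iff_of_nonneg hneg hi.neg] at h1
    filter_upwards [h1] with z hz hzb
    by_contra hlt
    have hzS : z ∈ S := ⟨hzb, not_le.1 hlt⟩
    simp only [hu, Set.indicator_of_mem hzS, one_mul, Pi.zero_apply] at hz
    linarith [not_le.1 hlt]
  filter_upwards [ae_all_iff.2 key] with z hz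
  obtain ⟨j, hj⟩ := (exists_mem_box z).exists
  exact hz j hj

theorem TestConvergence.lintegral (h : TestConvergence F f₀) (h0 : 0 ≤ᵐ[volume] f₀)
    (hFi : ∀ n, Integrable (F n)) (hF : ∀ n, 0 ≤ᵐ[volume] F n) {u : Phase → ℝ} {b R : ℝ}
    (hu : Measurable u) (hR : 0 < R) (hu0 : ∀ z, 0 ≤ u z) (hb : ∀ z, u z ≤ b)
    (hsupp : ∀ z, z ∉ box R R → u z = 0) :
    ∫⁻ z, ENNReal.ofReal (u z * f₀ z) < ⊤ ∧
    Tendsto (fun n => ∫⁻ z, ENNReal.ofReal (u z * F n z)) atTop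
      (𝓝 (∫⁻ z, ENNReal.ofReal (u z * f₀ z))) := by
  obtain ⟨hi, hlim⟩ := h u b R hu hR (fun z => by rw [abs_of_nonneg (hu0 z)]; exact hb z) hsupp
  refine ⟨hi.lintegral_lt_top, ?_⟩
  have hmul : ∀ f : Phase → ℝ, 0 ≤ᵐ[volume] f → 0 ≤ᵐ[volume] fun z => u z * f z := by
    intro f hf
    filter_upwards [hf] with z hz
    exact mul_nonneg (hu0 z) hz
  rw [← ofReal_integral_eq_lintegral_ofReal hi (hmul _ h0)]
  refine (ENNReal.tendsto_ofReal hlim).congr fun n => ?_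
  refine ofReal_integral_eq_lintegral_ofReal ?_ (hmul _ (hF n))
  exact (hFi n).bdd_mul hu.aestronglyMeasurable (Eventually.of_forall fun z => by
    rw [Real.norm_eq_abs, abs_of_nonneg (hu0 z)]; exact hb z)

theorem TestConvergence.lintegral_le (h : TestConvergence F f₀) (hm : Measurable f₀)
    (h0 : 0 ≤ᵐ[volume] f₀) (hFi : ∀ n, Integrable (F n)) (hF : ∀ n, 0 ≤ᵐ[volume] F n) {K : ℝ≥0∞}
    (hK : ∀ n, ∫⁻ z, ENNReal.ofReal (F n z) ≤ K) : ∫⁻ z, ENNReal.ofReal (f₀ z) ≤ K := by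
  refine le_of_tendsto (aecover_box.lintegral_tendsto_of_countably_generated
    hm.ennreal_ofReal.aemeasurable) (Eventually.of_forall fun j => ?_)
  set S := box ((j : ℝ) + 1) ((j : ℝ) + 1) with hS
  have hSm : MeasurableSet S := measurableSet_box _ _
  have hconv : ∀ f : Phase → ℝ, ∫⁻ z, ENNReal.ofReal (S.indicator (fun _ => (1 : ℝ)) z * f z)
      = ∫⁻ z in S, ENNReal.ofReal (f z) := by
    intro f
    rw [← lintegral_indicator hSm]
    refine lintegral_congr fun z => ?_
    by_cases h : z ∈ S <;> simp [h]
  have h1 := (h.lintegral h0 hFi hF (u := S.indicator fun _ => 1) (b := 1) (R := (j : ℝ) + 1)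
    (measurable_const.indicator hSm) (by positivity)
    (Set.indicator_nonneg fun _ _ => zero_le_one)
    (fun z => (le_abs_self _).trans (abs_indicator_one_le S z))
    (fun z hz => Set.indicator_of_notMem hz _)).2
  simp only [hconv] at h1
  exact le_of_tendsto h1 (Eventually.of_forall fun n =>
    (setLIntegral_le_lintegral _ _).trans (hK n))

/-- Tightness upgrades local convergence to arbitrary measurable sets. The box is enlarged until the
tails of $f_0$ and of almost all $F_n$ are below $\varepsilon/3$; inside it the indicator is an
admissible test function. -/
theorem TestConvergence.setIntegral (h : TestConvergence F f₀) (hi : Integrable f₀)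
    (h0 : 0 ≤ᵐ[volume] f₀) (hFi : ∀ n, Integrable (F n)) (hF : ∀ n, 0 ≤ᵐ[volume] F n)
    (ht : ∀ ε : ℝ, 0 < ε → ∃ R : ℝ, 0 < R ∧ ∀ᶠ n in atTop, ∫ z in (box R R)ᶜ, F n z ≤ ε)
    {S : Set Phase} (hS : MeasurableSet S) :
    Tendsto (fun n => ∫ z in S, F n z) atTop (𝓝 (∫ z in S, f₀ z)) := by
  rw [Metric.tendsto_atTop']
  intro ε hε
  obtain ⟨R₁, hR₁, h1⟩ := ht (ε / 3) (by positivity)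
  have h2 : Tendsto (fun j : ℕ => ∫ z in (box ((j : ℝ) + 1) ((j : ℝ) + 1))ᶜ, f₀ z) atTop
      (𝓝 0) := by
    have h3 := (aecover_box.integral_tendsto_of_countably_generated hi).const_sub (∫ z, f₀ z)
    rw [sub_self] at h3
    refine h3.congr fun j => ?_
    rw [← integral_add_compl (measurableSet_box ((j : ℝ) + 1) ((j : ℝ) + 1)) hi]
    ring
  obtain ⟨j, hj1, hj2⟩ := ((h2.eventually_lt_const (by positivity : 0 < ε / 3)).and
    (eventually_ge_atTop ⌈R₁⌉₊)).exists
  set R : ℝ := (j : ℝ) + 1 with hR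
  have hR₁R : R₁ ≤ R := by
    have h4 : (⌈R₁⌉₊ : ℝ) ≤ j := by exact_mod_cast hj2
    linarith [Nat.le_ceil R₁]
  have hbm := measurableSet_box R R
  have hlim := (h ((S ∩ box R R).indicator fun _ => 1) 1 R
    (measurable_const.indicator (hS.inter hbm)) (by positivity) (abs_indicator_one_le _)
    (fun z hz => Set.indicator_of_notMem (fun h => hz h.2) _)).2
  simp only [integral_indicator_one_mul (hS.inter hbm)] at hlim
  have hsplit : ∀ f : Phase → ℝ, Integrable f → 0 ≤ᵐ[volume] f →
      |(∫ z in S, f z) - ∫ z in S ∩ box R R, f z| ≤ ∫ z in (box R R)ᶜ, f z := by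
    intro f hf hf0
    rw [← integral_inter_add_sdiff hbm hf.integrableOn (s := S), add_sub_cancel_left,
      abs_of_nonneg (integral_nonneg_of_ae (ae_restrict_of_ae hf0))]
    exact setIntegral_mono_set hf.integrableOn (ae_restrict_of_ae hf0)
      (LE.le.eventuallyLE fun z hz => hz.2)
  have h5 := Metric.tendsto_nhds.1 hlim (ε / 3) (by positivity)
  obtain ⟨N, hN⟩ := eventually_atTop.1 (h1.and h5)
  refine ⟨N, fun n hn => ?_⟩
  obtain ⟨h6, h7⟩ := hN n hn.le
  have h8 : ∫ z in (box R R)ᶜ, F n z ≤ ε / 3 := by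
    refine le_trans (setIntegral_mono_set (hFi n).integrableOn (ae_restrict_of_ae (hF n))
      (LE.le.eventuallyLE ?_)) h6
    exact Set.compl_subset_compl.2 (box_mono hR₁R)
  have h9 := hsplit (F n) (hFi n) (hF n)
  have h10 := hsplit f₀ hi h0
  rw [Real.dist_eq] at h7 ⊢
  rw [abs_le] at h9 h10
  rw [abs_lt] at h7 ⊢
  constructor <;> linarith [h9.1, h9.2, h10.1, h10.2, h7.1, h7.2]

end TestConvergence

/-! ### Convergence of the gravitational fields. -/

section Field

/-- Dominated convergence. The majorant is $(Br^b)^2r^{-4}$ near the origin, integrable since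
$b>1/2$, and $N^2r^{-4}$ outside the unit ball. -/
theorem tendsto_fieldEnergy {m : ℕ → ℝ → ℝ≥0∞} {m₀ : ℝ → ℝ≥0∞} (hm : ∀ n, Measurable (m n))
    {B b N : ℝ} (hb : 1 / 2 < b)
    (h1 : ∀ n r, 0 < r → r < 1 → m n r ≤ ENNReal.ofReal (B * r ^ b))
    (h2 : ∀ n r, m n r ≤ ENNReal.ofReal N)
    (hlim : ∀ r, Tendsto (fun n => m n r) atTop (𝓝 (m₀ r))) :
    Tendsto (fun n => fieldEnergy (m n)) atTop (𝓝 (fieldEnergy m₀)) := by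
  set bd : ℝ → ℝ≥0∞ := fun r => if r < 1 then (if 0 < r then ENNReal.ofReal (B * r ^ b) else 0)
    else ENNReal.ofReal N with hbd
  have hfin : fieldEnergy bd < ⊤ := by
    refine (fieldEnergy_le (B := B) (b := b) (N := |B| + |N|)
      (fun r h0 h1 => by simp [hbd, h0, h1]) fun r => ?_).trans_lt ?_
    · simp only [hbd]
      split_ifs with h h'
      · refine ENNReal.ofReal_le_ofReal ?_
        have h3 : r ^ b ≤ 1 := Real.rpow_le_one h'.le h.le (by linarith)
        have h4 : 0 ≤ r ^ b := by positivity
        have h5 := le_abs_self B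
        nlinarith [abs_nonneg N, abs_nonneg B]
      · exact zero_le
      · exact ENNReal.ofReal_le_ofReal (by linarith [le_abs_self N, abs_nonneg B])
    · refine ENNReal.mul_lt_top ENNReal.ofReal_lt_top (ENNReal.add_lt_top.2 ⟨?_, ?_⟩)
      · exact ENNReal.mul_lt_top ENNReal.ofReal_lt_top
          (lintegral_norm_rpow_lt_top (by linarith))
      · exact ENNReal.mul_lt_top ENNReal.ofReal_lt_top tailConst_lt_top
  unfold fieldEnergy at hfin ⊢
  have hq : ENNReal.ofReal (1 / (8 * Real.pi)) ≠ 0 := by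
    simp only [ne_eq, ENNReal.ofReal_eq_zero, not_le]
    positivity
  refine ENNReal.Tendsto.const_mul ?_ (Or.inr ENNReal.ofReal_ne_top)
  refine tendsto_lintegral_of_dominated_convergence
    (fun x => bd ‖x‖ ^ 2 * ENNReal.ofReal ((‖x‖ ^ 4)⁻¹))
    (fun n => (((hm n).comp measurable_norm).pow_const 2).mul (by fun_prop))
    (fun n => ?_) ?_ ?_
  · have h0 : ∀ᵐ x : Space, x ≠ 0 := by
      rw [ae_iff]; simp
    filter_upwards [h0] with x hx
    have hx' : 0 < ‖x‖ := norm_pos_iff.2 hx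
    gcongr
    simp only [hbd, hx', if_true]
    split_ifs with h
    · exact h1 n _ hx' h
    · exact h2 n _
  · intro htop
    rw [htop, ENNReal.mul_top hq] at hfin
    exact lt_irrefl _ hfin
  · refine Eventually.of_forall fun x => ?_
    rcases eq_or_ne x 0 with rfl | hx
    · simp
    · exact ENNReal.Tendsto.mul_const ((ENNReal.continuous_pow 2).tendsto _ |>.comp (hlim ‖x‖))
        (Or.inr ENNReal.ofReal_ne_top)

variable {f g : Phase → ℝ}

theorem measurable_massFun (hf : Integrable f) (h0 : 0 ≤ᵐ[volume] f) :
    Measurable (massFun f) := by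
  have : massFun f = fun r => (massIn f r).toReal := funext (massFun_eq hf h0)
  rw [this]
  exact (massIn_mono f).measurable.ennreal_toReal

theorem measurable_gradU (hf : Integrable f) (h0 : 0 ≤ᵐ[volume] f) : Measurable (gradU f) := by
  have h1 : Measurable fun x : Space => massFun f ‖x‖ :=
    (measurable_massFun hf h0).comp measurable_norm
  exact (h1.div (measurable_norm.pow_const 2)).smul (measurable_norm.inv.smul measurable_id)

theorem lintegral_of_const_mul_lt_top {I : ℝ≥0∞}
    (h : ENNReal.ofReal (1 / (8 * Real.pi)) * I < ⊤) : I < ⊤ := by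
  rw [lt_top_iff_ne_top]
  rintro rfl
  rw [ENNReal.mul_top] at h
  · exact lt_irrefl _ h
  · simp only [ne_eq, ENNReal.ofReal_eq_zero, not_le]
    positivity

theorem memLp_gradU (hf : Integrable f) (h0 : 0 ≤ᵐ[volume] f) (h : negPotentialEnergy f < ⊤) :
    MemLp (gradU f) 2 := by
  refine ⟨(measurable_gradU hf h0).aestronglyMeasurable, ?_⟩
  rw [eLpNorm_lt_top_iff_lintegral_rpow_enorm_lt_top (by norm_num) (by norm_num)]
  have := lintegral_of_const_mul_lt_top h
  simpa using this

theorem eLpNorm_gradU_sub (f g : Phase → ℝ) :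
    eLpNorm (gradU f - gradU g) 2 volume = (∫⁻ x : Space,
      ENNReal.ofReal |massFun f ‖x‖ - massFun g ‖x‖| ^ 2 * ENNReal.ofReal ((‖x‖ ^ 4)⁻¹))
        ^ (1 / 2 : ℝ) := by
  rw [eLpNorm_eq_lintegral_rpow_enorm_toReal (by norm_num) (by norm_num)]
  simp only [ENNReal.toReal_ofNat]
  congr 1
  refine lintegral_congr fun x => ?_
  have h1 : ‖(gradU f - gradU g) x‖ ^ 2 =
      |massFun f ‖x‖ - massFun g ‖x‖| ^ 2 * (‖x‖ ^ 4)⁻¹ := by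
    rw [Pi.sub_apply, gradU, gradU, ← sub_smul, ← sub_div]
    rcases eq_or_ne x 0 with rfl | hx
    · simp
    · have hx' : ‖x‖ ≠ 0 := norm_ne_zero_iff.2 hx
      rw [norm_smul, norm_smul, Real.norm_eq_abs, norm_inv, norm_norm,
        inv_mul_cancel₀ hx', mul_one, sq_abs, sq_abs]
      field_simp
  rw [← ofReal_norm, ENNReal.ofReal_rpow_of_nonneg (norm_nonneg _) (by norm_num), Real.rpow_two,
    h1, ENNReal.ofReal_mul (by positivity), ENNReal.ofReal_pow (abs_nonneg _)]

end Field

/-! ### The tangent inequality for $Q$. -/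

section Convexity

variable {l k₁ k₂ k₃ C₁ C₂ F₀ : ℝ} {Q : ℝ → ℝ}

/-- The derivative of `Q` on `[0, ∞)`, extended by its value at `0`. -/
noncomputable def casimirDeriv (Q : ℝ → ℝ) (y : ℝ) : ℝ := derivWithin Q (Set.Ici 0) (max y 0)

theorem continuous_casimirDeriv (hQ : CasimirAssumptions l k₁ k₂ k₃ C₁ C₂ F₀ Q) :
    Continuous (casimirDeriv Q) :=
  (hQ.contDiffOn_one.continuousOn_derivWithin (uniqueDiffOn_Ici 0) le_rfl).comp_continuous
    (by fun_prop) fun _ => Set.mem_Ici.2 (le_max_right _ _)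

theorem convexOn_casimir (hQ : CasimirAssumptions l k₁ k₂ k₃ C₁ C₂ F₀ Q) :
    ConvexOn ℝ (Set.Ici 0) Q := by
  refine (strictConvexOn_of_deriv2_pos (convex_Ici 0) hQ.contDiffOn_one.continuousOn
    fun x hx => ?_).convexOn
  rw [interior_Ici] at hx
  exact hQ.Q4 x hx

/-- At $b=0$ only a one-sided derivative is available; it vanishes, as does $Q(0)$, and the
inequality is $Q\ge0$. -/
theorem casimir_tangent (hQ : CasimirAssumptions l k₁ k₂ k₃ C₁ C₂ F₀ Q) {a b : ℝ} (ha : 0 ≤ a)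
    (hb : 0 ≤ b) : Q b + casimirDeriv Q b * (a - b) ≤ Q a := by
  rcases hb.eq_or_lt with rfl | hb'
  · rw [casimirDeriv, max_self, hQ.Q4_zero, hQ.map_zero]
    simpa using hQ.nonneg a ha
  · have hd : HasDerivAt Q (casimirDeriv Q b) b := by
      have h1 : DifferentiableWithinAt ℝ Q (Set.Ici 0) b :=
        hQ.contDiffOn_one.differentiableOn one_ne_zero b hb
      rw [casimirDeriv, max_eq_left hb]
      exact h1.hasDerivWithinAt.hasDerivAt (Ici_mem_nhds hb')
    have hconv := convexOn_casimir hQ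
    rcases lt_trichotomy a b with h | rfl | h
    · have := hconv.slope_le_of_hasDerivAt ha hb h hd
      rw [slope_def_field, div_le_iff₀ (by linarith)] at this
      linarith
    · simp
    · have := hconv.le_slope_of_hasDerivAt hb ha h hd
      rw [slope_def_field, le_div_iff₀ (by linarith)] at this
      linarith

/-- This makes $Q'(L^{-l}f_0)$ usable as a weight in integrals with values in $[0,\infty]$. -/
theorem casimirDeriv_nonneg (hQ : CasimirAssumptions l k₁ k₂ k₃ C₁ C₂ F₀ Q) (b : ℝ) :
    0 ≤ casimirDeriv Q b := by
  rcases le_or_gt b 0 with hb | hb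
  · rw [casimirDeriv, max_eq_right hb, hQ.Q4_zero]
  · have h := casimir_tangent hQ le_rfl hb.le
    rw [hQ.map_zero] at h
    have h1 := hQ.nonneg b hb.le
    have h2 : 0 ≤ casimirDeriv Q b * b := by linarith
    exact nonneg_of_mul_nonneg_left h2 hb

end Convexity

/-! ### Weak lower semicontinuity of the positive part. -/

section LowerSemicontinuity

variable {l k₁ k₂ k₃ C₁ C₂ F₀ γ : ℝ} {Q : ℝ → ℝ} {F : ℕ → Phase → ℝ} {f₀ : Phase → ℝ}

/-- On $T$ the factors $L$, $|v|^2$ and $Q'(L^{-l}f_0)$ are bounded, so the corresponding integrals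
converge. The tangent inequality at $L^{-l}f_0$ bounds the Casimir functional of $F_n$ from below by
an expression affine in $F_n$, whose linear part vanishes in the limit. -/
theorem positivePart_cutoff_le_of_testConvergence
    (hQ : CasimirAssumptions l k₁ k₂ k₃ C₁ C₂ F₀ Q) (h : TestConvergence F f₀)
    (hm : Measurable f₀) (h0 : 0 ≤ᵐ[volume] f₀) (hFi : ∀ n, Integrable (F n))
    (hF : ∀ n, 0 ≤ᵐ[volume] F n) {p : ℝ≥0∞}
    (hp : Tendsto (fun n => positivePart Q l γ (F n)) atTop (𝓝 p)) {T : Set Phase}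
    (hT : MeasurableSet T) {R : ℝ} (hR : 0 < R) (hTR : T ⊆ box R R)
    (hTb : ∀ z ∈ T, angMom z ^ (-l) * f₀ z ≤ R) :
    ENNReal.ofReal γ * (∫⁻ z in T, ENNReal.ofReal (angMom z * f₀ z)) +
      (∫⁻ z in T, ENNReal.ofReal (Q (angMom z ^ (-l) * f₀ z) * angMom z ^ l)) +
      ENNReal.ofReal (1 / 2) * (∫⁻ z in T, ENNReal.ofReal (‖z.2‖ ^ 2 * f₀ z)) ≤ p := by
  set dq : Phase → ℝ := fun z => casimirDeriv Q (angMom z ^ (-l) * f₀ z) with hdq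
  have hdqm : Measurable dq := (continuous_casimirDeriv hQ).measurable.comp
    ((measurable_angMom.pow_const _).mul hm)
  obtain ⟨b, hb⟩ := (isCompact_Icc (a := (0 : ℝ)) (b := R)).exists_bound_of_continuousOn
    (continuous_casimirDeriv hQ).continuousOn
  have hset : ∀ (a f : Phase → ℝ), ∫⁻ z, ENNReal.ofReal (T.indicator a z * f z) =
      ∫⁻ z in T, ENNReal.ofReal (a z * f z) := by
    intro a f
    rw [← lintegral_indicator hT]
    refine lintegral_congr fun z => ?_
    by_cases hz : z ∈ T <;> simp [hz]
  have hconv : ∀ {a : Phase → ℝ} {c : ℝ}, Measurable a → (∀ z, 0 ≤ a z) → 0 ≤ c →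
      (∀ z ∈ T, a z ≤ c) → ∫⁻ z in T, ENNReal.ofReal (a z * f₀ z) < ⊤ ∧
      Tendsto (fun n => ∫⁻ z in T, ENNReal.ofReal (a z * F n z)) atTop
        (𝓝 (∫⁻ z in T, ENNReal.ofReal (a z * f₀ z))) := by
    intro a c ha ha0 hc hac
    have := h.lintegral h0 hFi hF (u := T.indicator a) (b := c) (ha.indicator hT) hR
      (fun z => Set.indicator_nonneg (fun z _ => ha0 z) z)
      (fun z => Set.indicator_le' hac (fun _ _ => hc) z)
      (fun z hz => Set.indicator_of_notMem (fun h => hz (hTR h)) _)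
    simpa only [hset] using this
  have hL := (hconv measurable_angMom angMom_nonneg (c := R ^ 2 * R ^ 2) (by positivity)
    fun z hz => (angMom_le z).trans (by
      have h1 := (hTR hz).1
      have h2 := (hTR hz).2
      gcongr)).2
  have hV := (hconv (a := fun z => ‖z.2‖ ^ 2) (measurable_snd.norm.pow_const 2)
    (fun z => by positivity) (c := R ^ 2) (by positivity) fun z hz => by
      have h2 := (hTR hz).2
      gcongr).2
  have hD := hconv hdqm (fun z => casimirDeriv_nonneg hQ _) (c := |b|) (abs_nonneg b) fun z hz => by
    rcases le_or_gt 0 (angMom z ^ (-l) * f₀ z) with hpos | hneg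
    · exact (le_abs_self _).trans ((hb _ ⟨hpos, hTb z hz⟩).trans (le_abs_self b))
    · have h1 : dq z = casimirDeriv Q 0 := by
        simp only [hdq, casimirDeriv, max_eq_right hneg.le, max_self]
      rw [h1]
      exact (le_abs_self _).trans ((hb 0 ⟨le_rfl, hR.le⟩).trans (le_abs_self b))
  set c := ∫⁻ z in T, ENNReal.ofReal (dq z * f₀ z) with hc
  -- The tangent inequality multiplied by $L^l$ and integrated; the negative term is moved to the
  -- other side to avoid subtraction in $[0,\infty]$. The powers $L^{-l}$ and $L^l$ cancel in the
  -- linear term.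
  have htan : ∀ n, (∫⁻ z in T, ENNReal.ofReal (Q (angMom z ^ (-l) * f₀ z) * angMom z ^ l)) +
      (∫⁻ z in T, ENNReal.ofReal (dq z * F n z)) ≤ casimir Q l (F n) + c := by
    intro n
    refine le_trans ?_ (add_le_add_left (setLIntegral_le_lintegral T _) c)
    have hm1 : AEMeasurable (fun z => ENNReal.ofReal (dq z * F n z)) :=
      (hdqm.aemeasurable.mul (hFi n).aemeasurable).ennreal_ofReal
    have hm2 : Measurable fun z => ENNReal.ofReal (dq z * f₀ z) := (hdqm.mul hm).ennreal_ofReal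
    rw [hc, ← lintegral_add_right' _ hm1.restrict, ← lintegral_add_right' _ hm2.aemeasurable]
    refine lintegral_mono_ae (ae_restrict_of_ae ?_)
    filter_upwards [h0, hF n, ae_angMom_pos] with z hz hzn hL
    have hz : 0 ≤ f₀ z := hz
    have hzn : 0 ≤ F n z := hzn
    have hd : 0 ≤ dq z := casimirDeriv_nonneg hQ _
    have hw : 0 < angMom z ^ l := Real.rpow_pos_of_pos hL _
    have q1 := hQ.nonneg (angMom z ^ (-l) * f₀ z) (by positivity)
    have q2 := hQ.nonneg (angMom z ^ (-l) * F n z) (by positivity)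
    rw [← ENNReal.ofReal_add (by positivity) (by positivity),
      ← ENNReal.ofReal_add (by positivity) (by positivity)]
    refine ENNReal.ofReal_le_ofReal ?_
    have ht := casimir_tangent hQ (a := angMom z ^ (-l) * F n z) (b := angMom z ^ (-l) * f₀ z)
      (by positivity) (by positivity)
    have hw2 : angMom z ^ (-l) * angMom z ^ l = 1 := by
      rw [← Real.rpow_add hL, neg_add_cancel, Real.rpow_zero]
    have ht2 := mul_le_mul_of_nonneg_right ht hw.le
    have e : (Q (angMom z ^ (-l) * f₀ z) + casimirDeriv Q (angMom z ^ (-l) * f₀ z) *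
        (angMom z ^ (-l) * F n z - angMom z ^ (-l) * f₀ z)) * angMom z ^ l =
        Q (angMom z ^ (-l) * f₀ z) * angMom z ^ l + dq z * (F n z - f₀ z) := by
      calc _ = Q (angMom z ^ (-l) * f₀ z) * angMom z ^ l +
            dq z * (F n z - f₀ z) * (angMom z ^ (-l) * angMom z ^ l) := by rw [hdq]; ring
        _ = _ := by rw [hw2, mul_one]
    rw [e] at ht2
    linarith
  have hle : ∀ n, ENNReal.ofReal γ * (∫⁻ z in T, ENNReal.ofReal (angMom z * F n z)) +
      ((∫⁻ z in T, ENNReal.ofReal (Q (angMom z ^ (-l) * f₀ z) * angMom z ^ l)) +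
        (∫⁻ z in T, ENNReal.ofReal (dq z * F n z))) +
      ENNReal.ofReal (1 / 2) * (∫⁻ z in T, ENNReal.ofReal (‖z.2‖ ^ 2 * F n z)) ≤
      positivePart Q l γ (F n) + c := by
    intro n
    calc _ ≤ ENNReal.ofReal γ * (∫⁻ z, ENNReal.ofReal (angMom z * F n z)) +
          (casimir Q l (F n) + c) + kineticEnergy (F n) := by
          unfold kineticEnergy
          exact add_le_add (add_le_add (mul_le_mul_right (setLIntegral_le_lintegral _ _) _)
            (htan n)) (mul_le_mul_right (setLIntegral_le_lintegral _ _) _)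
      _ = _ := by unfold positivePart; ring
  have hlim := le_of_tendsto_of_tendsto
    (((ENNReal.Tendsto.const_mul hL (Or.inr ENNReal.ofReal_ne_top)).add
      (tendsto_const_nhds.add hD.2)).add
      (ENNReal.Tendsto.const_mul hV (Or.inr ENNReal.ofReal_ne_top)))
    (hp.add tendsto_const_nhds) (Eventually.of_forall hle)
  refine (ENNReal.add_le_add_iff_right hD.1.ne).1 (le_trans (le_of_eq ?_) hlim)
  ring

theorem positivePart_le_of_testConvergence
    (hQ : CasimirAssumptions l k₁ k₂ k₃ C₁ C₂ F₀ Q) (h : TestConvergence F f₀)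
    (hm : Measurable f₀) (h0 : 0 ≤ᵐ[volume] f₀) (hFi : ∀ n, Integrable (F n))
    (hF : ∀ n, 0 ≤ᵐ[volume] F n) {p : ℝ≥0∞}
    (hp : Tendsto (fun n => positivePart Q l γ (F n)) atTop (𝓝 p)) :
    positivePart Q l γ f₀ ≤ p := by
  -- These sets exhaust phase space, so the bound on each of them passes to the full integrals.
  set T : ℕ → Set Phase := fun j => box ((j : ℝ) + 1) ((j : ℝ) + 1) ∩
    {z | angMom z ^ (-l) * f₀ z ≤ (j : ℝ) + 1} with hT
  have hcover : AECover (volume : Measure Phase) atTop T := by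
    refine ⟨Eventually.of_forall fun z => ?_, fun j => (measurableSet_box _ _).inter
      (measurableSet_le ((measurable_angMom.pow_const _).mul hm) measurable_const)⟩
    obtain ⟨N, hN⟩ := exists_nat_ge (angMom z ^ (-l) * f₀ z)
    filter_upwards [exists_mem_box z, eventually_ge_atTop N] with j hj hjN
    have : (N : ℝ) ≤ j := by exact_mod_cast hjN
    exact ⟨hj, hN.trans (by linarith)⟩
  have hlim := (((ENNReal.Tendsto.const_mul (hcover.lintegral_tendsto_of_countably_generated
    (measurable_angMom.mul hm).ennreal_ofReal.aemeasurable)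
      (Or.inr (ENNReal.ofReal_ne_top (r := γ)))).add
    (hcover.lintegral_tendsto_of_countably_generated
      (aemeasurable_casimir hQ hm.aemeasurable h0).ennreal_ofReal)).add
    (ENNReal.Tendsto.const_mul (hcover.lintegral_tendsto_of_countably_generated
      ((measurable_snd.norm.pow_const 2).mul hm).ennreal_ofReal.aemeasurable)
      (Or.inr (ENNReal.ofReal_ne_top (r := 1 / 2)))))
  refine le_of_tendsto hlim (Eventually.of_forall fun j => ?_)
  exact positivePart_cutoff_le_of_testConvergence hQ h hm h0 hFi hF hp (hcover.measurableSet j)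
    (R := (j : ℝ) + 1) (by positivity) Set.inter_subset_left fun z hz => hz.2

end LowerSemicontinuity

/-! ### Tightness of minimizing sequences and existence of minimizers. -/

section Minimizers

variable {l k₁ k₂ k₃ C₁ C₂ F₀ γ M : ℝ} {Q : ℝ → ℝ} {F : ℕ → Phase → ℝ} {f₀ : Phase → ℝ}

/-- With $\mathcal P$ bounded no interpolation is needed, and the exponent $2m/N$ with $m=2l+3$,
$N=2k_1+2+m$ exceeds $1/2$ because $N<4m$. -/
theorem exists_forall_massIn_le (hQ : CasimirAssumptions l k₁ k₂ k₃ C₁ C₂ F₀ Q) (hM : 0 < M)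
    (hF : ∀ n, F n ∈ feasible Q l γ M) {B : ℝ}
    (hB : ∀ n, (positivePart Q l γ (F n)).toReal ≤ B) :
    ∃ A b : ℝ, 1 / 2 < b ∧ ∀ n r, 0 < r → massIn (F n) r ≤ ENNReal.ofReal (A * r ^ b) := by
  have hk := hQ.k₁_pos
  have hk' := hQ.k₁_lt
  have hl := hQ.l_gt
  obtain ⟨C, hC, h⟩ := exists_massIn_le (M := M) hQ hM.le
  refine ⟨C * (1 + B) ^ ((2 * k₁ + (2 * l + 3)) / (2 * k₁ + 2 + (2 * l + 3))),
    2 * (2 * l + 3) / (2 * k₁ + 2 + (2 * l + 3)), ?_, fun n r hr => ?_⟩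
  · rw [div_lt_div_iff₀ (by norm_num) (by linarith)]
    linarith
  · refine (h γ (F n) (hF n) r hr).trans (ENNReal.ofReal_le_ofReal ?_)
    have h1 := one_le_energySize (Q := Q) (l := l) (γ := γ) (f := F n)
    have h2 : energySize Q l γ (F n) ≤ 1 + B := by
      have := hB n
      unfold energySize
      linarith
    have h3 : 0 ≤ (2 * k₁ + (2 * l + 3)) / (2 * k₁ + 2 + (2 * l + 3)) :=
      div_nonneg (by linarith) (by linarith)
    gcongr

/-- By symmetry the squared distance of the fields is a multiple of the field energy of
$|m_{F_n}-m_{f_0}|$. This function obeys the same bounds as the masses themselves, both being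
nonnegative, and it tends to zero pointwise. -/
theorem tendsto_eLpNorm_gradU_sub (hi : Integrable f₀) (h0 : 0 ≤ᵐ[volume] f₀)
    (hFi : ∀ n, Integrable (F n)) (hF : ∀ n, 0 ≤ᵐ[volume] F n) {A b N : ℝ} (hb : 1 / 2 < b)
    (h1 : ∀ n r, 0 < r → massIn (F n) r ≤ ENNReal.ofReal (A * r ^ b))
    (h2 : ∀ n r, massIn (F n) r ≤ ENNReal.ofReal N)
    (hlim : ∀ r, Tendsto (fun n => massIn (F n) r) atTop (𝓝 (massIn f₀ r))) :
    Tendsto (fun n => eLpNorm (gradU (F n) - gradU f₀) 2 volume) atTop (𝓝 0) := by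
  have hle : ∀ {r : ℝ} {c : ℝ≥0∞}, c ≠ ⊤ → (∀ n, massIn (F n) r ≤ c) → ∀ n,
      ENNReal.ofReal |massFun (F n) r - massFun f₀ r| ≤ c := by
    intro r c hc hn n
    have h3 : massIn f₀ r ≤ c := le_of_tendsto (hlim r) (Eventually.of_forall hn)
    have h4 := ENNReal.toReal_mono hc h3
    have h5 := ENNReal.toReal_mono hc (hn n)
    refine ENNReal.ofReal_le_of_le_toReal ?_
    rw [massFun_eq (hFi n) (hF n), massFun_eq hi h0, abs_le]
    constructor <;> linarith [ENNReal.toReal_nonneg (a := massIn f₀ r),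
      ENNReal.toReal_nonneg (a := massIn (F n) r)]
  have hδ : ∀ r, Tendsto (fun n => ENNReal.ofReal |massFun (F n) r - massFun f₀ r|) atTop
      (𝓝 0) := by
    intro r
    have h3 : massIn f₀ r ≠ ⊤ :=
      ((massIn_le_lintegral f₀ r).trans_lt (lintegral_ofReal_lt_top hi)).ne
    have h4 := ((((ENNReal.tendsto_toReal h3).comp (hlim r)).sub_const
      (massIn f₀ r).toReal).abs)
    rw [sub_self, abs_zero] at h4
    have h5 := ENNReal.tendsto_ofReal h4
    rw [ENNReal.ofReal_zero] at h5
    refine h5.congr fun n => ?_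
    rw [massFun_eq (hFi n) (hF n), massFun_eq hi h0, Function.comp_apply]
  have h3 := tendsto_fieldEnergy (m₀ := fun _ => 0)
    (fun n => ((measurable_massFun (hFi n) (hF n)).sub
      (measurable_massFun hi h0)).norm.ennreal_ofReal) hb
    (fun n r hr _ => hle ENNReal.ofReal_ne_top (fun n => h1 n r hr) n)
    (fun n r => hle ENNReal.ofReal_ne_top (fun n => h2 n r) n) hδ
  have h4 := ENNReal.Tendsto.const_mul (a := ENNReal.ofReal (8 * Real.pi)) h3
    (Or.inr ENNReal.ofReal_ne_top)
  have h5 : fieldEnergy (fun _ => 0) = 0 := by simp [fieldEnergy]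
  rw [h5, mul_zero] at h4
  have h6 := ((ENNReal.continuous_rpow_const (y := (1 / 2 : ℝ))).tendsto 0).comp h4
  rw [ENNReal.zero_rpow_of_pos (by norm_num)] at h6
  refine h6.congr fun n => ?_
  rw [eLpNorm_gradU_sub, Function.comp_apply, fieldEnergy, ← mul_assoc,
    ← ENNReal.ofReal_mul (by positivity),
    show 8 * Real.pi * (1 / (8 * Real.pi)) = 1 by field_simp, ENNReal.ofReal_one, one_mul]
  rfl

theorem exists_forall_positivePart_le (hQ : CasimirAssumptions l k₁ k₂ k₃ C₁ C₂ F₀ Q)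
    (hM : 0 < M) {d : ℝ} (hd : infEnergy Q l γ M = d) {f : ℕ → Phase → ℝ}
    (hf : IsMinimizingSeq Q l γ M f) :
    ∃ B : ℝ, ∀ n, (positivePart Q l γ (f n)).toReal ≤ B := by
  obtain ⟨C, -, h⟩ := exists_le_energyCasimir (M := M) hQ hM
  obtain ⟨E, hE⟩ := (tendsto_energy_of_isMinimizingSeq hQ hM hd hf).bddAbove_range
  refine ⟨2 * (E + C), fun n => ?_⟩
  have h1 := h γ (f n) (hf.1 n)
  rw [energyCasimir_eq_coe (hf.1 n).2.2.2.1 (negPotentialEnergy_lt_top hQ hM (hf.1 n)),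
    EReal.coe_le_coe_iff] at h1
  have h2 : (positivePart Q l γ (f n)).toReal - (negPotentialEnergy (f n)).toReal ≤ E :=
    hE (Set.mem_range_self n)
  linarith

theorem setIntegral_high_velocity_le {f : Phase → ℝ} (hf : f ∈ feasible Q l γ M) {V : ℝ} (hV : 0 < V) :
    ∫ z in {z : Phase | V < ‖z.2‖}, f z ≤
      2 * (V ^ 2)⁻¹ * (positivePart Q l γ f).toReal := by
  rw [setIntegral_eq_toReal hf.1 hf.2.1]
  have h1 : ENNReal.ofReal (2 * (V ^ 2)⁻¹) * positivePart Q l γ f ≠ ⊤ :=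
    ENNReal.mul_ne_top ENNReal.ofReal_ne_top hf.2.2.2.1.ne
  have h2 := ENNReal.toReal_mono h1 ((setLIntegral_high_velocity_le (f := f) hV).trans
    (mul_le_mul_right kineticEnergy_le_positivePart _))
  rwa [ENNReal.toReal_mul, ENNReal.toReal_ofReal (by positivity)] at h2

theorem exists_tight {R₀ : ℝ} (hR₀ : IsConcentrationRadius Q l γ M R₀)
    (hF : IsMinimizingSeq Q l γ M F) {B : ℝ}
    (hB : ∀ n, (positivePart Q l γ (F n)).toReal ≤ B) {ε : ℝ} (hε : 0 < ε) :
    ∃ R : ℝ, 0 < R ∧ ∀ᶠ n in atTop, ∫ z in (box R R)ᶜ, F n z ≤ ε := by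
  have hB0 : 0 ≤ B := ENNReal.toReal_nonneg.trans (hB 0)
  -- Exceeding $R_0$, this radius makes the mass far out in space small eventually. From $R\ge1$ and
  -- $R\ge4B/\varepsilon$ the mass of fast particles is at most $2B/R^2\le\varepsilon/2$.
  set R : ℝ := R₀ + 1 + 4 * B / ε with hR
  have hR₀' := hR₀.1
  have hB' : 0 ≤ 4 * B / ε := by positivity
  have hR1 : 1 ≤ R := by linarith
  have hR2 : R₀ < R := by linarith
  refine ⟨R, by linarith, ?_⟩
  filter_upwards [(hR₀.2 F hF R hR2).eventually_lt_const (half_pos hε)] with n hn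
  have hsub : (box R R)ᶜ ⊆ {z : Phase | R ≤ ‖z.1‖} ∪ {z : Phase | R < ‖z.2‖} := by
    intro z hz
    by_contra h
    simp only [Set.mem_union, Set.mem_ofPred_eq, not_or, not_le, not_lt] at h
    exact hz ⟨h.1.le, h.2⟩
  obtain ⟨hi, h0, -⟩ := hF.1 n
  have hkin := setIntegral_high_velocity_le (hF.1 n) (V := R) (by linarith)
  have h1 : 2 * (R ^ 2)⁻¹ * (positivePart Q l γ (F n)).toReal ≤ ε / 2 := by
    have h2 : 4 * B ≤ ε * R := by
      rw [hR, mul_add, mul_div_cancel₀ _ hε.ne']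
      nlinarith
    have h3 : ε * R ≤ ε * R ^ 2 := by
      refine mul_le_mul_of_nonneg_left ?_ hε.le
      nlinarith
    rw [mul_assoc, inv_mul_eq_div, ← mul_div_assoc, div_le_div_iff₀ (by positivity) (by norm_num)]
    linarith [hB n]
  have h4 : ∫ z in (box R R)ᶜ, F n z ≤
      ∫ z in {z : Phase | R ≤ ‖z.1‖} ∪ {z : Phase | R < ‖z.2‖}, F n z :=
    setIntegral_mono_set hi.integrableOn (ae_restrict_of_ae h0) (LE.le.eventuallyLE hsub)
  have h5 : ∫ z in {z : Phase | R ≤ ‖z.1‖} ∪ {z : Phase | R < ‖z.2‖}, F n z ≤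
      (∫ z in {z : Phase | R ≤ ‖z.1‖}, F n z) + ∫ z in {z : Phase | R < ‖z.2‖}, F n z := by
    have ht : ∀ S : Set Phase, ∫⁻ z in S, ENNReal.ofReal (F n z) ≠ ⊤ := fun S =>
      ((setLIntegral_le_lintegral _ _).trans_lt (lintegral_ofReal_lt_top hi)).ne
    simp only [setIntegral_eq_toReal hi h0]
    rw [← ENNReal.toReal_add (ht _) (ht _)]
    exact ENNReal.toReal_mono (ENNReal.add_ne_top.2 ⟨ht _, ht _⟩) (lintegral_union_le _ _ _)
  linarith

theorem exists_minimizer (hQ : CasimirAssumptions l k₁ k₂ k₃ C₁ C₂ F₀ Q) (hM : 0 < M)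
    (hneg : infEnergy Q l γ M < 0) {f : ℕ → Phase → ℝ} (hf : IsMinimizingSeq Q l γ M f) :
    ∃ (f₀ : Phase → ℝ) (n : ℕ → ℕ), StrictMono n ∧ f₀ ∈ feasible Q l γ M ∧
      energyCasimir Q l γ f₀ = infEnergy Q l γ M ∧
      (∀ R : ℝ, IsConcentrationRadius Q l γ M R → ∀ᵐ z : Phase, R < ‖z.1‖ → f₀ z = 0) ∧
      WeaklyConverges k₁ l (fun j => f (n j)) f₀ ∧
      MemLp (gradU f₀) 2 ∧ (∀ j, MemLp (gradU (f (n j))) 2) ∧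
      Tendsto (fun j => eLpNorm (gradU (f (n j)) - gradU f₀) 2 volume) atTop (𝓝 0) := by
  obtain ⟨d, -, hd⟩ := exists_coe_infEnergy hQ hM hneg
  obtain ⟨B, hB⟩ := exists_forall_positivePart_le hQ hM hd hf
  obtain ⟨f₀, n, hn, hm, hsym, hweak, htest⟩ := exists_weak_limit hQ hM hf.1 hB
  set F : ℕ → Phase → ℝ := fun j => f (n j) with hFdef
  have hF : IsMinimizingSeq Q l γ M F := ⟨fun j => hf.1 (n j), hf.2.comp hn.tendsto_atTop⟩
  have hFi : ∀ j, Integrable (F j) := fun j => (hF.1 j).1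
  have hF0 : ∀ j, 0 ≤ᵐ[volume] F j := fun j => (hF.1 j).2.1
  have hFB : ∀ j, (positivePart Q l γ (F j)).toReal ≤ B := fun j => hB (n j)
  have htest : TestConvergence F f₀ := htest
  have h0 : 0 ≤ᵐ[volume] f₀ := htest.ae_nonneg hm hF0
  have hmass : ∫⁻ z, ENNReal.ofReal (f₀ z) ≤ ENNReal.ofReal M :=
    htest.lintegral_le hm h0 hFi hF0 fun j => (lintegral_eq_of_feasible (hF.1 j)).le
  have hi : Integrable f₀ := ⟨hm.aestronglyMeasurable, by
    rw [hasFiniteIntegral_iff_ofReal h0]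
    exact hmass.trans_lt ENNReal.ofReal_lt_top⟩
  obtain ⟨R₀, hR₀⟩ := exists_isConcentrationRadius hQ hM hneg
  have hset : ∀ {S : Set Phase}, MeasurableSet S →
      Tendsto (fun j => ∫ z in S, F j z) atTop (𝓝 (∫ z in S, f₀ z)) := fun hS =>
    htest.setIntegral hi h0 hFi hF0 (fun ε hε => exists_tight hR₀ hF hFB hε) hS
  have htotal : ∫ z, f₀ z = M := by
    have h1 := hset MeasurableSet.univ
    simp only [setIntegral_univ, (hF.1 _).2.2.1] at h1
    exact tendsto_nhds_unique h1 tendsto_const_nhds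
  have hlim : ∀ r, Tendsto (fun j => massIn (F j) r) atTop (𝓝 (massIn f₀ r)) := by
    intro r
    have h1 := ENNReal.tendsto_ofReal (hset (measurableSet_norm_fst_le r))
    have h2 : ∀ g : Phase → ℝ, Integrable g → 0 ≤ᵐ[volume] g →
        ENNReal.ofReal (∫ z in {z : Phase | ‖z.1‖ ≤ r}, g z) = massIn g r := by
      intro g hg hg0
      rw [setIntegral_eq_toReal hg hg0, ENNReal.ofReal_toReal, massIn]
      exact ((setLIntegral_le_lintegral _ _).trans_lt (lintegral_ofReal_lt_top hg)).ne
    rw [h2 _ hi h0] at h1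
    exact h1.congr fun j => h2 _ (hFi j) (hF0 j)
  obtain ⟨A, b, hb, hA⟩ := exists_forall_massIn_le hQ hM hF.1 hFB
  have hN : ∀ j r, massIn (F j) r ≤ ENNReal.ofReal M := fun j r =>
    (massIn_le_lintegral _ _).trans (lintegral_eq_of_feasible (hF.1 j)).le
  have hpot : Tendsto (fun j => negPotentialEnergy (F j)) atTop (𝓝 (negPotentialEnergy f₀)) := by
    have h1 := tendsto_fieldEnergy (fun j => (massIn_mono (F j)).measurable) hb
      (fun j r hr _ => hA j r hr) hN hlim
    rw [negPotentialEnergy_eq hi h0]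
    exact h1.congr fun j => (negPotentialEnergy_eq (hFi j) (hF0 j)).symm
  have hpot0 : negPotentialEnergy f₀ < ⊤ := by
    rw [negPotentialEnergy_eq hi h0]
    refine (fieldEnergy_le (B := A) (b := b) (N := M) (fun r hr _ => ?_) fun r => ?_).trans_lt ?_
    · exact le_of_tendsto (hlim r) (Eventually.of_forall fun j => hA j r hr)
    · exact le_of_tendsto (hlim r) (Eventually.of_forall fun j => hN j r)
    · exact ENNReal.mul_lt_top ENNReal.ofReal_lt_top (ENNReal.add_lt_top.2
        ⟨ENNReal.mul_lt_top ENNReal.ofReal_lt_top (lintegral_norm_rpow_lt_top (by linarith)),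
          ENNReal.mul_lt_top ENNReal.ofReal_lt_top tailConst_lt_top⟩)
  -- The limit of $\mathcal P(F_j)$, known because the total energies and the potential energies
  -- both converge. Lower semicontinuity then gives $\mathcal D(f_0)\le p-(p-d)=\mathcal D_M$.
  set p : ℝ := d + (negPotentialEnergy f₀).toReal with hp
  have hPlim : Tendsto (fun j => (positivePart Q l γ (F j)).toReal) atTop (𝓝 p) := by
    have h1 := (tendsto_energy_of_isMinimizingSeq hQ hM hd hF).add
      ((ENNReal.tendsto_toReal hpot0.ne).comp hpot)
    refine h1.congr fun j => ?_
    rw [Function.comp_apply]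
    ring
  have hp0 : 0 ≤ p := ge_of_tendsto hPlim (Eventually.of_forall fun j => ENNReal.toReal_nonneg)
  have hPle : positivePart Q l γ f₀ ≤ ENNReal.ofReal p :=
    positivePart_le_of_testConvergence hQ htest hm h0 hFi hF0
      ((ENNReal.tendsto_ofReal hPlim).congr fun j =>
        ENNReal.ofReal_toReal (hF.1 j).2.2.2.1.ne)
  have hPtop : positivePart Q l γ f₀ < ⊤ := hPle.trans_lt ENNReal.ofReal_lt_top
  have hfeas : f₀ ∈ feasible Q l γ M := ⟨hi, h0, htotal, hPtop, hsym⟩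
  refine ⟨f₀, n, hn, hfeas, le_antisymm ?_ (iInf₂_le f₀ hfeas), fun R hR => ?_, hweak,
    memLp_gradU hi h0 hpot0, fun j => memLp_gradU (hFi j) (hF0 j)
      (negPotentialEnergy_lt_top hQ hM (hF.1 j)),
    tendsto_eLpNorm_gradU_sub hi h0 hFi hF0 hb hA hN hlim⟩
  · rw [hd, energyCasimir_eq_coe hPtop hpot0, EReal.coe_le_coe_iff]
    have h1 := ENNReal.toReal_mono ENNReal.ofReal_ne_top hPle
    rw [ENNReal.toReal_ofReal hp0] at h1
    linarith
  -- The definition controls only radii strictly larger than $R$, so $\{|x|>R\}$ is covered by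
  -- countably many sets $\{|x|\ge R+1/(m+1)\}$.
  · have key : ∀ m : ℕ, ∀ᵐ z : Phase, R + 1 / ((m : ℝ) + 1) ≤ ‖z.1‖ → f₀ z = 0 := by
      intro m
      have hS := measurableSet_le_norm_fst (R + 1 / ((m : ℝ) + 1))
      have h1 := tendsto_nhds_unique (hset hS)
        (hR.2 F hF _ (lt_add_of_pos_right R (by positivity)))
      rw [setIntegral_eq_zero_iff_of_nonneg_ae (ae_restrict_of_ae h0) hi.integrableOn,
        EventuallyEq, ae_restrict_iff' hS] at h1
      exact h1
    filter_upwards [ae_all_iff.2 key] with z hz hRz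
    obtain ⟨m, hm⟩ := exists_nat_one_div_lt (sub_pos.2 hRz)
    exact hz m (by linarith)

end Minimizers

end VlasovPoisson

theorem theorem4p1 (l k₁ k₂ k₃ C₁ C₂ F₀ : ℝ) (Q : ℝ → ℝ)
    (hQ : CasimirAssumptions l k₁ k₂ k₃ C₁ C₂ F₀ Q) (M : ℝ) (hM : 0 < M) :
    (∃ γ₀ : ℝ, 0 < γ₀ ∧ ∀ γ : ℝ, 0 ≤ γ → γ ≤ γ₀ →
      ⊥ < infEnergy Q l γ M ∧ infEnergy Q l γ M < 0) ∧
    ∀ γ : ℝ, 0 ≤ γ → infEnergy Q l γ M < 0 →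
      (∃ R : ℝ, IsConcentrationRadius Q l γ M R) ∧
      ∀ f : ℕ → Phase → ℝ, IsMinimizingSeq Q l γ M f →
        ∃ (f₀ : Phase → ℝ) (n : ℕ → ℕ), StrictMono n ∧
          f₀ ∈ feasible Q l γ M ∧
          energyCasimir Q l γ f₀ = infEnergy Q l γ M ∧
          (∀ R : ℝ, IsConcentrationRadius Q l γ M R →
            ∀ᵐ z : Phase, R < ‖z.1‖ → f₀ z = 0) ∧
          WeaklyConverges k₁ l (fun j => f (n j)) f₀ ∧
          MemLp (gradU f₀) 2 ∧ (∀ j, MemLp (gradU (f (n j))) 2) ∧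
          Tendsto (fun j => eLpNorm (gradU (f (n j)) - gradU f₀) 2 volume) atTop (𝓝 0) := by
  refine ⟨?_, fun γ _ hneg => ⟨exists_isConcentrationRadius hQ hM hneg, fun f hf =>
    exists_minimizer hQ hM hneg hf⟩⟩
  obtain ⟨γ₀, hγ₀, h⟩ := exists_infEnergy_neg hQ hM
  exact ⟨γ₀, hγ₀, fun γ h0 h1 => ⟨bot_lt_infEnergy hQ hM γ, h γ h0 h1⟩⟩
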